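/- Consider the problem $\max\{f(S) : S\in\mathcal I\}$, where $f:2^X\to\mathbb R_{\ge 0}$ is a nonnegative (not necessarily monotone) submodular function on a finite ground set $X$ with $|X|=n$, i.e. $f(S\cup T)+f(S\cap T)\le f(S)+f(T)$ for all $S,T\subseteq X$, and $\mathcal I$ is the collection of independent sets of a matroid on $X$. The function $f$ is given by a value oracle (which returns $f(S)$ for a queried set $S$), and $\mathcal I$ is given by a membership oracle (which answers whether $S\in\mathcal I$). Let $OPT=\max\{f(S):S\in\mathcal I\}$. A randomized algorithm is an $\alpha$-approximation (on ground sets of size $n$) if on every instance it outputs a set that is (almost surely) in $\mathcal I$ and whose expected value is at least $\alpha\cdot OPT$. (1) For every $\epsilon>0$ there are $c>0$ and $n_0$ such that for every $n\ge n_0$, every (adaptive, possibly randomized, computationally unbounded) query algorithm that is a $(\frac12+\epsilon)$-approximation on ground sets of size $n$ makes, on some instance with ground set of size $n$, at least $e^{cn}$ value queries in expectation, even if membership queries are free. (2) There is a randomized polynomial-time $\frac14(-1+\sqrt5-o(1))\simeq 0.309$-approximation algorithm: there are a single program for a randomized oracle machine, a polynomial $p$ and a sequence $\eta(n)\to0$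 such that on every instance with ground set of size $n$ the program always halts within $p(n)$ steps, always outputs a set $S\in\mathcal I$, and satisfies $\mathbf E[f(S)]\ge\frac14(-1+\sqrt5-\eta(n))\cdot OPT$. Here the machine is a random access machine with cells for natural and for real numbers; at unit cost it performs additions, subtractions and comparisons, draws a uniformly random element of $\{0,\dots,m\}$ for a computed natural number $m$, and asks queries to the two oracles. -/

import Mathlib

open MeasureTheory Filter Topology
open scoped ENNReal

namespace SubmodMax

/-- An instance of nonnegative submodular maximization over the independent sets of a matroid,
`max {f(S) : S ∈ 𝓘}`, whose ground set `X` has `n` elements, labelled by `Fin n`. -/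
structure MatroidInstance (n : ℕ) where
  /-- the objective function `f : 2^X → ℝ₊` -/
  f : Finset (Fin n) → ℝ
  /-- the matroid on `X` -/
  M : Matroid (Fin n)
  ground : M.E = Set.univ
  nonneg : ∀ S, 0 ≤ f S
  submodular : ∀ S T, f (S ∪ T) + f (S ∩ T) ≤ f S + f T

namespace MatroidInstance

/-- `S ∈ 𝓘`: the set `S` is independent in the matroid. -/
def Feasible {n : ℕ} (I : MatroidInstance n) (S : Finset (Fin n)) : Prop :=
  I.M.Indep (S : Set (Fin n))

theorem feasible_empty {n : ℕ} (I : MatroidInstance n) : I.Feasible ∅ := by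
  simp [Feasible]

open Classical in
/-- The (finite) collection `𝓘` of independent sets. -/
noncomputable def feasibleSets {n : ℕ} (I : MatroidInstance n) : Finset (Finset (Fin n)) :=
  Finset.univ.filter I.Feasible

theorem feasibleSets_nonempty {n : ℕ} (I : MatroidInstance n) : I.feasibleSets.Nonempty :=
  ⟨∅, by simp [feasibleSets, feasible_empty]⟩

/-- `OPT = max {f(S) : S ∈ 𝓘}`. -/
noncomputable def opt {n : ℕ} (I : MatroidInstance n) : ℝ :=
  I.feasibleSets.sup' I.feasibleSets_nonempty I.f

end MatroidInstance

/-! ### Query algorithms of unlimited computational power -/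

/-- A deterministic adaptive query algorithm on a ground set of `n` elements. It may ask the value
oracle for `f(S)` or the membership oracle for whether `S ∈ 𝓘`, continues in an arbitrary way
depending on the answer, and finally outputs a set. -/
inductive QueryTree (n : ℕ) : Type
  | output (S : Finset (Fin n)) : QueryTree n
  | value (S : Finset (Fin n)) (next : ℝ → QueryTree n) : QueryTree n
  | member (S : Finset (Fin n)) (next : Prop → QueryTree n) : QueryTree n

namespace QueryTree

/-- The set that the algorithm outputs on the instance `I`. -/
def result {n : ℕ} (I : MatroidInstance n) : QueryTree n → Finset (Fin n)
  | output S => S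
  | value S next => result I (next (I.f S))
  | member S next => result I (next (I.Feasible S))

/-- The number of value queries that the algorithm asks on the instance `I`
(membership queries are free). -/
def valueQueries {n : ℕ} (I : MatroidInstance n) : QueryTree n → ℕ
  | output _ => 0
  | value S next => valueQueries I (next (I.f S)) + 1
  | member S next => valueQueries I (next (I.Feasible S))

end QueryTree

/-- A randomized query algorithm on a ground set of `n` elements: a random deterministic query
algorithm, over an arbitrary probability space, such that on each instance the output and the
number of value queries are random variables. -/
structure RandomizedQueryAlgorithm (n : ℕ) where
  Ω : Type*
  [mΩ : MeasurableSpace Ω]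
  P : Measure Ω
  [prob : IsProbabilityMeasure P]
  tree : Ω → QueryTree n
  measurable_result : ∀ (I : MatroidInstance n) (S : Finset (Fin n)),
    MeasurableSet {ω | (tree ω).result I = S}
  measurable_valueQueries : ∀ (I : MatroidInstance n) (k : ℕ),
    MeasurableSet {ω | (tree ω).valueQueries I = k}

namespace RandomizedQueryAlgorithm

attribute [instance] mΩ prob

/-- `A` is an `α`-approximation algorithm on ground sets of `n` elements: on each instance the
output is almost surely an independent set and its expected value is at least `α · OPT`. -/
def IsApproximation {n : ℕ} (A : RandomizedQueryAlgorithm n) (α : ℝ) : Prop :=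
  ∀ I : MatroidInstance n,
    (∀ᵐ ω ∂A.P, I.Feasible ((A.tree ω).result I)) ∧
    α * I.opt ≤ ∫ ω, I.f ((A.tree ω).result I) ∂A.P

/-- The expected number of value queries on the instance `I`. -/
noncomputable def expectedValueQueries {n : ℕ} (A : RandomizedQueryAlgorithm n)
    (I : MatroidInstance n) : ℝ≥0∞ :=
  ∫⁻ ω, ((A.tree ω).valueQueries I : ℝ≥0∞) ∂A.P

end RandomizedQueryAlgorithm

/-! ### A random access machine with oracles, and its running time

The memory consists of cells holding natural numbers and cells holding real numbers. Both kinds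
are arranged in two-dimensional arrays: the cell `(a, i, j)` is entry `(i, j)` of array `a`. A
program is a finite text. One step executes one elementary command or evaluates one test, whose
expressions have a size fixed by the program. The only arithmetic is addition and subtraction, so
within `T` steps no number gets more than `O(T)` bits longer than the input `n` and no real number
becomes anything but an integer combination of answers of the value oracle. -/

/-- Expressions with natural numbers as values. -/
inductive NatExpr : Type
  | const (k : ℕ) : NatExpr
  | read (a : ℕ) (i j : NatExpr) : NatExpr
  | add (x y : NatExpr) : NatExpr
  | sub (x y : NatExpr) : NatExpr

/-- Expressions with real numbers as values. -/
inductive RealExpr : Type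
  | read (a : ℕ) (i j : NatExpr) : RealExpr
  | add (x y : RealExpr) : RealExpr
  | sub (x y : RealExpr) : RealExpr

/-- Tests. -/
inductive Test : Type
  | natLT (x y : NatExpr) : Test
  | realLT (x y : RealExpr) : Test

/-- Programs. -/
inductive Program : Type
  /-- do nothing -/
  | skip : Program
  /-- `c`, then `d` -/
  | seq (c d : Program) : Program
  /-- if `b` then `c` else `d` -/
  | cond (b : Test) (c d : Program) : Program
  /-- while `b` do `c` -/
  | loop (b : Test) (c : Program) : Program
  /-- write `x` into the natural number cell `(a, i, j)` -/
  | setNat (a : ℕ) (i j : NatExpr) (x : NatExpr) : Program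
  /-- write `x` into the real number cell `(a, i, j)` -/
  | setReal (a : ℕ) (i j : NatExpr) (x : RealExpr) : Program
  /-- write a uniformly random element of `{0, …, x}` into the natural number cell `(a, i, j)` -/
  | random (a : ℕ) (i j : NatExpr) (x : NatExpr) : Program
  /-- write `f(S)` into the real number cell `(a, i, j)`,
  where `S` is the set described by row `r` of array `s` -/
  | value (a : ℕ) (i j : NatExpr) (s : ℕ) (r : NatExpr) : Program
  /-- write `1` into the natural number cell `(a, i, j)` if `S ∈ 𝓘`, and `0` if not,
  where `S` is the set described by row `r` of array `s` -/
  | member (a : ℕ) (i j : NatExpr) (s : ℕ) (r : NatExpr) : Program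

/-- The contents of the memory. -/
structure Store where
  nat : ℕ × ℕ × ℕ → ℕ
  real : ℕ × ℕ × ℕ → ℝ

namespace Store

def writeNat (σ : Store) (p : ℕ × ℕ × ℕ) (v : ℕ) : Store :=
  { σ with nat := Function.update σ.nat p v }

noncomputable def writeReal (σ : Store) (p : ℕ × ℕ × ℕ) (v : ℝ) : Store :=
  { σ with real := Function.update σ.real p v }

/-- The set described by row `r` of array `s` of natural numbers: an element of the ground set
belongs to it if the corresponding entry of the row is not zero. -/
def row (σ : Store) (n s r : ℕ) : Finset (Fin n) :=
  Finset.univ.filter fun v : Fin n => σ.nat (s, r, (v : ℕ)) ≠ 0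

/-- At the start entry `(0, 0)` of array `0` of natural numbers holds `n`, all other cells hold
`0`. -/
def init (n : ℕ) : Store where
  nat := fun p => if p = (0, 0, 0) then n else 0
  real := fun _ => 0

/-- At the end the output is the set described by row `0` of array `1`. -/
def output (σ : Store) (n : ℕ) : Finset (Fin n) :=
  σ.row n 1 0

end Store

def NatExpr.eval (σ : Store) : NatExpr → ℕ
  | const k => k
  | read a i j => σ.nat (a, i.eval σ, j.eval σ)
  | add x y => x.eval σ + y.eval σ
  | sub x y => x.eval σ - y.eval σ

noncomputable def RealExpr.eval (σ : Store) : RealExpr → ℝ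
  | read a i j => σ.real (a, i.eval σ, j.eval σ)
  | add x y => x.eval σ + y.eval σ
  | sub x y => x.eval σ - y.eval σ

def Test.holds (σ : Store) : Test → Prop
  | natLT x y => x.eval σ < y.eval σ
  | realLT x y => x.eval σ < y.eval σ

/-- A configuration: the list of the programs that remain to be executed, one after the other, and
the contents of the memory. The machine has halted when the list is empty. -/
abbrev Config : Type := List Program × Store

open Classical in
/-- One step of the machine on the instance `I`: the distribution of the next configuration. -/
noncomputable def step {n : ℕ} (I : MatroidInstance n) : Config → PMF Config
  | ([], σ) => PMF.pure ([], σ)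
  | (.skip :: K, σ) => PMF.pure (K, σ)
  | (.seq c d :: K, σ) => PMF.pure (c :: d :: K, σ)
  | (.cond b c d :: K, σ) => PMF.pure (if b.holds σ then (c :: K, σ) else (d :: K, σ))
  | (.loop b c :: K, σ) =>
      PMF.pure (if b.holds σ then (c :: .loop b c :: K, σ) else (K, σ))
  | (.setNat a i j x :: K, σ) =>
      PMF.pure (K, σ.writeNat (a, i.eval σ, j.eval σ) (x.eval σ))
  | (.setReal a i j x :: K, σ) =>
      PMF.pure (K, σ.writeReal (a, i.eval σ, j.eval σ) (x.eval σ))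
  | (.random a i j x :: K, σ) =>
      (PMF.uniformOfFintype (Fin (x.eval σ + 1))).map fun v =>
        (K, σ.writeNat (a, i.eval σ, j.eval σ) (v : ℕ))
  | (.value a i j s r :: K, σ) =>
      PMF.pure (K, σ.writeReal (a, i.eval σ, j.eval σ) (I.f (σ.row n s (r.eval σ))))
  | (.member a i j s r :: K, σ) =>
      PMF.pure (K, σ.writeNat (a, i.eval σ, j.eval σ)
        (if I.Feasible (σ.row n s (r.eval σ)) then 1 else 0))

/-- The distribution of the configuration after `T` steps of the program `Q` on the instance
`I`. -/
noncomputable def run {n : ℕ} (I : MatroidInstance n) (Q : Program) : ℕ → PMF Config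
  | 0 => PMF.pure ([Q], Store.init n)
  | T + 1 => (run I Q T).bind (step I)

/-- The program `Q` always halts within `T` steps on the instance `I`, and outputs an independent
set. -/
def HaltsFeasibly {n : ℕ} (I : MatroidInstance n) (Q : Program) (T : ℕ) : Prop :=
  ∀ c ∈ (run I Q T).support, c.1 = [] ∧ I.Feasible (c.2.output n)

/-- The expectation of `f(S)`, where `S` is the output of the program `Q` after `T` steps on the
instance `I`. -/
noncomputable def expectedOutputValue {n : ℕ} (I : MatroidInstance n) (Q : Program) (T : ℕ) : ℝ :=
  ∑ S : Finset (Fin n), (((run I Q T).map fun c => c.2.output n) S).toReal * I.f S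

end SubmodMax

/-! Hardness. Over the free matroid, compare `s (n - s)` with `s (n - s) + (|d| - rn)₊²`, where `s =
|S|` and `d = |S ∩ A| - |S \ A|` for a hidden set `A`. The extra square is submodular up to `2 |S \
T| |T \ S|` (`excess_add_le`), which the first term supplies exactly. The first objective is at most
`n² / 4`, while the second reaches about `n² / 2` on `A` or its complement. For uniformly random
`A`, a fixed set has `|d| > rn` with probability at most `2 exp(-r² n / 2)`
(`card_imbalance_gt_le`), so an algorithm with few value queries sees no difference between the two
and outputs a set of value at most `n² / 4` for most `A`. Since the matroid is free, membership
queries reveal nothing.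

Algorithm. A measured continuous greedy method attains `1/e - 3/100`, which already exceeds `(√5 -
1) / 4`, so no error sequence is needed. Put `δ = 1 / L`, `F(x) = E f(R)` and `H(x) = E f(R ∪ O)`,
where `R` contains each `u` independently with probability `x u` and `O` is optimal. If `P` is an
independent set that is best for the expected marginal values, raising each `x u`, `u ∈ P`, to `x u
+ δ (1 - x u)` gives `F ≥ (1 - δ) F + δ H` up to second order (`greedy_step_le`), while `H` keeps
the fraction `1 - δ` (`le_mlext_probAdd`). After `L` steps, `F ≥ L δ (1 - δ)^(L - 1) f(O) ≥ f(O) /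
e`. Sampling and second-order errors together cost `3/100` of the optimum.

The fractional point is rounded after every step: after `K` steps it is `K / L` times the indicator
of a set `A` inside a base `C`. A new base `B ⊇ P` is merged into `C` by randomized symmetric
exchanges. A move along `e_u - e_v` does not decrease the multilinear extension of a submodular
function in expectation (`mlext_le_exchange`), so both `F` and `H` survive the rounding, and at `K =
L` the point is the indicator of an independent set.

The program is verified in a logic whose triples carry a time bound, a postcondition and a lower
bound on an expectation. Running backwards from the end, the quantity tracked is a nonnegative
combination of `F` and `H` (`potential`) whose coefficients obey the recursion above. Sure halting
and sure feasibility are extracted from expectation bounds alone in `halts_of_tri`. -/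

namespace SubmodMax

/-! ### Query algorithms on instances that agree on the queried sets. -/

namespace QueryTree

open Classical in
/-- The sets whose values the algorithm asks for on the instance `I`. -/
noncomputable def queried {n : ℕ} (I : MatroidInstance n) : QueryTree n → Finset (Finset (Fin n))
  | output _ => ∅
  | value S next => insert S (queried I (next (I.f S)))
  | member S next => queried I (next (I.Feasible S))

theorem card_queried_le {n : ℕ} (I : MatroidInstance n) (t : QueryTree n) :
    (t.queried I).card ≤ t.valueQueries I := by
  induction t with
  | output S => simp [queried]
  | value S next ih =>
    simp only [queried, valueQueries]
    exact (Finset.card_insert_le _ _).trans (Nat.add_le_add_right (ih _) 1)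
  | member S next ih => simpa only [queried, valueQueries] using ih _

/-- As long as the answers agree, an adaptive algorithm stays on the same branch. Only the sets
queried on `I` matter, so the list of sets to control does not depend on `J`. -/
theorem result_congr {n : ℕ} {I J : MatroidInstance n} (hM : ∀ S, I.Feasible S ↔ J.Feasible S)
    (t : QueryTree n) (h : ∀ S ∈ t.queried I, J.f S = I.f S) : t.result J = t.result I := by
  induction t with
  | output S => rfl
  | value S next ih =>
    simp only [queried, Finset.mem_insert, forall_eq_or_imp] at h
    simp only [result, h.1]
    exact ih _ h.2
  | member S next ih =>
    simp only [queried] at h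
    simp only [result, ← propext (hM S)]
    exact ih _ h

end QueryTree

/-! ### Concentration of the imbalance for a random hidden set. -/

section Cut

variable {α : Type*} [DecidableEq α]

/-- The imbalance `|S ∩ A| - |S \ A|`. -/
def imbalance (A S : Finset α) : ℝ := ∑ i ∈ S, if i ∈ A then 1 else -1

theorem imbalance_union_add_inter (A S T : Finset α) :
    imbalance A (S ∪ T) + imbalance A (S ∩ T) = imbalance A S + imbalance A T :=
  Finset.sum_union_inter

theorem abs_imbalance_le (A S : Finset α) : |imbalance A S| ≤ S.card := by
  unfold imbalance
  refine (Finset.abs_sum_le_sum_abs _ _).trans ?_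
  rw [Finset.card_eq_sum_ones]
  push_cast
  refine Finset.sum_le_sum fun i _ => ?_
  split_ifs <;> simp

theorem imbalance_self (A : Finset α) : imbalance A A = A.card := by
  unfold imbalance
  rw [Finset.sum_congr rfl (fun i hi => if_pos hi)]
  simp

theorem imbalance_compl [Fintype α] (A : Finset α) : imbalance A Aᶜ = -(Aᶜ.card : ℝ) := by
  unfold imbalance
  rw [Finset.sum_congr rfl (fun i hi => if_neg (Finset.mem_compl.1 hi))]
  simp

/-- The sum over all `A` factors over the elements: those of `S` contribute `2 cosh r ≤ 2 exp(r² /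
2)`, the others `2`. -/
theorem sum_exp_imbalance [Fintype α] (S : Finset α) (r : ℝ) :
    ∑ A : Finset α, Real.exp (r * imbalance A S) ≤
      2 ^ Fintype.card α * Real.exp (S.card * (r ^ 2 / 2)) := by
  have h1 : ∀ A : Finset α, Real.exp (r * imbalance A S) =
      (∏ i ∈ A, if i ∈ S then Real.exp r else 1) *
        ∏ i ∈ Finset.univ \ A, if i ∈ S then Real.exp (-r) else 1 := by
    intro A
    rw [imbalance, Finset.mul_sum, Real.exp_sum]
    have : ∏ i ∈ S, Real.exp (r * if i ∈ A then 1 else -1) =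
        ∏ i, if i ∈ S then (if i ∈ A then Real.exp r else Real.exp (-r)) else 1 := by
      rw [Finset.prod_ite_mem, Finset.univ_inter]
      refine Finset.prod_congr rfl fun i _ => ?_
      split_ifs <;> simp
    rw [this, ← Finset.prod_sdiff (Finset.subset_univ A), mul_comm]
    congr 1
    · refine Finset.prod_congr rfl fun i hi => ?_
      simp [hi]
    · refine Finset.prod_congr rfl fun i hi => ?_
      simp [(Finset.mem_sdiff.1 hi).2]
  simp_rw [h1]
  rw [← Finset.powerset_univ, ← Finset.prod_add]
  have h2 : ∀ i : α, ((if i ∈ S then Real.exp r else 1) + if i ∈ S then Real.exp (-r) else 1) ≤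
      2 * if i ∈ S then Real.exp (r ^ 2 / 2) else 1 := by
    intro i
    split_ifs
    · have := Real.cosh_le_exp_half_sq r
      rw [Real.cosh_eq] at this
      linarith
    · norm_num
  refine (Finset.prod_le_prod (fun i _ => ?_) fun i _ => h2 i).trans ?_
  · split_ifs <;> positivity
  · rw [Finset.prod_mul_distrib, Finset.prod_ite_mem, Finset.univ_inter]
    simp [Real.exp_nat_mul]

/-- Chernoff's method with exponent equal to the threshold `r`, which is the optimal choice; the two
signs of the imbalance give the factor `2`. -/
theorem card_imbalance_gt_le [Fintype α] (S : Finset α) {r : ℝ} (hr : 0 ≤ r) :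
    ((Finset.univ.filter fun A : Finset α => r * Fintype.card α < |imbalance A S|).card : ℝ) ≤
      2 ^ Fintype.card α * (2 * Real.exp (-(r ^ 2 / 2 * Fintype.card α))) := by
  set m : ℝ := (Fintype.card α : ℝ)
  have hS : (S.card : ℝ) ≤ m := Nat.cast_le.2 (Finset.card_le_univ S)
  have h1 : ∀ A : Finset α, (if r * m < |imbalance A S| then (1 : ℝ) else 0) ≤
      Real.exp (-(r ^ 2 * m)) *
        (Real.exp (r * imbalance A S) + Real.exp (-r * imbalance A S)) := by
    intro A
    split_ifs with h
    · have h3 : r * (r * m) ≤ r * |imbalance A S| := mul_le_mul_of_nonneg_left h.le hr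
      rw [mul_add, ← Real.exp_add, ← Real.exp_add]
      rcases abs_cases (imbalance A S) with h2 | h2
      · have : 0 ≤ -(r ^ 2 * m) + r * imbalance A S := by rw [h2.1] at h3; nlinarith
        have := Real.one_le_exp this
        have := Real.exp_pos (-(r ^ 2 * m) + -r * imbalance A S)
        linarith
      · have : 0 ≤ -(r ^ 2 * m) + -r * imbalance A S := by rw [h2.1] at h3; nlinarith
        have := Real.one_le_exp this
        have := Real.exp_pos (-(r ^ 2 * m) + r * imbalance A S)
        linarith
    · positivity
  have h2 := sum_exp_imbalance S r
  have h3 := sum_exp_imbalance S (-r)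
  have h4 : Real.exp (S.card * (r ^ 2 / 2)) ≤ Real.exp (m * (r ^ 2 / 2)) := by gcongr
  have h5 : ((2 : ℝ) ^ Fintype.card α) * Real.exp (S.card * (r ^ 2 / 2)) ≤
      2 ^ Fintype.card α * Real.exp (m * (r ^ 2 / 2)) := by gcongr
  rw [neg_sq] at h3
  rw [Finset.card_filter]
  push_cast
  calc (∑ A : Finset α, if r * m < |imbalance A S| then (1 : ℝ) else 0)
      ≤ ∑ A : Finset α, Real.exp (-(r ^ 2 * m)) *
        (Real.exp (r * imbalance A S) + Real.exp (-r * imbalance A S)) :=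
        Finset.sum_le_sum fun A _ => h1 A
    _ ≤ Real.exp (-(r ^ 2 * m)) * (2 * (2 ^ Fintype.card α * Real.exp (m * (r ^ 2 / 2)))) := by
        rw [← Finset.mul_sum, Finset.sum_add_distrib]
        gcongr
        linarith
    _ = _ := by
        have : Real.exp (-(r ^ 2 / 2 * m)) =
          Real.exp (-(r ^ 2 * m)) * Real.exp (m * (r ^ 2 / 2)) := by
          rw [← Real.exp_add]; congr 1; ring
        rw [this]; ring

end Cut

/-! ### The hard instances. -/

/-- The squared distance of `y` to the interval `[-c, c]`. -/
def excess (c y : ℝ) : ℝ := (max (|y| - c) 0) ^ 2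

theorem excess_nonneg (c y : ℝ) : 0 ≤ excess c y := sq_nonneg _

/-- With `exists_excess_eq` this presents the excess as a minimum over `|t| ≤ c`: an upper bound may
use any `t`, an exact value uses a minimizer. -/
theorem excess_le_sq {c t : ℝ} (ht : |t| ≤ c) (y : ℝ) : excess c y ≤ (y - t) ^ 2 := by
  unfold excess
  rw [← sq_abs (y - t)]
  have := abs_sub_abs_le_abs_sub y t
  gcongr
  exact max_le (by linarith) (abs_nonneg _)

theorem exists_excess_eq {c : ℝ} (hc : 0 ≤ c) (y : ℝ) :
    ∃ t, |t| ≤ c ∧ excess c y = (y - t) ^ 2 := by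
  unfold excess
  rcases le_or_gt |y| c with h | h
  · exact ⟨y, h, by rw [max_eq_right (by linarith)]; ring⟩
  · rw [max_eq_left (by linarith)]
    rcases abs_cases y with ⟨h1, -⟩ | ⟨h1, -⟩
    · exact ⟨c, by rw [abs_of_nonneg hc], by rw [h1]⟩
    · exact ⟨-c, by rw [abs_neg, abs_of_nonneg hc], by rw [h1]; ring⟩

/-- The slope of the excess is Lipschitz with constant `2`, which bounds its mixed second
difference. This is the amount that the strictly submodular term `s (n - s)` can absorb in
`cutInstance`. -/
theorem excess_add_le {c : ℝ} (hc : 0 ≤ c) (x p q : ℝ) :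
    excess c (x + p + q) + excess c x ≤
      excess c (x + p) + excess c (x + q) + 2 * (|p| * |q|) := by
  obtain ⟨t, ht, h1⟩ := exists_excess_eq hc (x + p)
  obtain ⟨s, hs, h2⟩ := exists_excess_eq hc (x + q)
  rw [h1, h2]
  rcases le_or_gt 0 (p * q) with hpq | hpq
  · rw [← abs_mul, abs_of_nonneg hpq]
    have h3 : 0 ≤ p * (t - s) ∨ 0 ≤ p * (s - t) := by
      rcases le_or_gt 0 (p * (t - s)) with h | h
      · exact Or.inl h
      · right; nlinarith
    -- Using `t` at `x + p + q` and `s` at `x` gives the defect `2pq - 2q(t - s)`; the other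
    -- assignment gives `2pq - 2p(s - t)`. As `p` and `q` do not have opposite signs, one of them is
    -- at most `2pq`.
    have h4 : 0 ≤ q * (t - s) ∨ 0 ≤ p * (s - t) := by
      rcases le_total 0 p with hp | hp <;> rcases le_total 0 q with hq | hq <;>
        rcases le_total s t with hst | hst
      · left; nlinarith
      · right; nlinarith
      · rcases hp.eq_or_lt with rfl | hp
        · right; simp
        · have : q = 0 := by nlinarith
          left; simp [this]
      · right; nlinarith
      · left; nlinarith
      · rcases hq.eq_or_lt with rfl | hq
        · left; simp
        · have : p = 0 := by nlinarith
          right; simp [this]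
      · right; nlinarith
      · left; nlinarith
    rcases h4 with h | h
    · have := excess_le_sq ht (x + p + q)
      have := excess_le_sq hs x
      nlinarith
    · have := excess_le_sq hs (x + p + q)
      have := excess_le_sq ht x
      nlinarith
  · have hd : p - q ≠ 0 := by
      intro h
      have : p = q := by linarith
      subst this
      nlinarith [sq_nonneg p]
    -- With opposite signs, `x` and `x + p + q` lie between `x + p` and `x + q`, at weights `l` and
    -- `1 - l`. Plain convexity then suffices, with the minimizers mixed by the same weights.
    obtain ⟨l, hl⟩ : ∃ l : ℝ, l * (p - q) = -q := ⟨-q / (p - q), by field_simp⟩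
    have h0 : 0 ≤ l ∧ l ≤ 1 := by
      have hp : 0 < (p - q) ^ 2 := by positivity
      have e1 : l * (p - q) ^ 2 = -q * (p - q) := by rw [← hl]; ring
      have e2 : (1 - l) * (p - q) ^ 2 = p * (p - q) := by
        rw [sub_mul, e1]; ring
      constructor
      · by_contra h
        push Not at h
        nlinarith [sq_nonneg q]
      · by_contra h
        push Not at h
        nlinarith [sq_nonneg p]
    have hb : ∀ m : ℝ, 0 ≤ m → m ≤ 1 → |m * t + (1 - m) * s| ≤ c := by
      intro m h0 h1
      rw [abs_le] at *
      constructor <;> nlinarith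
    have e1 := excess_le_sq (hb l h0.1 h0.2) x
    have e2 := excess_le_sq (hb (1 - l) (by linarith [h0.2]) (by linarith [h0.1])) (x + p + q)
    have e3 : x - (l * t + (1 - l) * s) = l * (x + p - t) + (1 - l) * (x + q - s) := by
      linear_combination (-1 : ℝ) * hl
    have e4 : x + p + q - ((1 - l) * t + (1 - (1 - l)) * s) =
        (1 - l) * (x + p - t) + l * (x + q - s) := by
      linear_combination hl
    rw [e3] at e1
    rw [e4] at e2
    have e5 : 0 ≤ l * (1 - l) * ((x + p - t) - (x + q - s)) ^ 2 :=
      mul_nonneg (mul_nonneg h0.1 (by linarith [h0.2])) (sq_nonneg _)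
    have e6 : 0 ≤ |p| * |q| := by positivity
    nlinarith

/-- The instance with objective `s (n - s) + (|d| - c)₊²`, where `s = |S|` and `d` is the imbalance
of `S` with respect to `A`, over the free matroid. -/
def cutInstance (n : ℕ) (A : Finset (Fin n)) (c : ℝ) (hc : 0 ≤ c) : MatroidInstance n where
  f S := (S.card : ℝ) * (n - S.card) + excess c (imbalance A S)
  M := Matroid.freeOn Set.univ
  ground := rfl
  nonneg S := by
    have h : (S.card : ℝ) ≤ n := by exact_mod_cast card_finset_fin_le S
    have := excess_nonneg c (imbalance A S)
    have : 0 ≤ (S.card : ℝ) * (n - S.card) := mul_nonneg (by positivity) (by linarith)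
    linarith
  submodular S T := by
    have a1 := abs_imbalance_le A (S \ T)
    have a2 := abs_imbalance_le A (T \ S)
    have h1 : imbalance A S = imbalance A (S ∩ T) + imbalance A (S \ T) :=
      (Finset.sum_inter_add_sum_sdiff S T _).symm
    have h2 : imbalance A T = imbalance A (S ∩ T) + imbalance A (T \ S) := by
      rw [Finset.inter_comm]
      exact (Finset.sum_inter_add_sum_sdiff T S _).symm
    have h3 := imbalance_union_add_inter A S T
    have h4 : (S.card : ℝ) = (S ∩ T).card + (S \ T).card := by
      exact_mod_cast (Finset.card_inter_add_card_sdiff S T).symm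
    have h5 : (T.card : ℝ) = (S ∩ T).card + (T \ S).card := by
      rw [Finset.inter_comm]; exact_mod_cast (Finset.card_inter_add_card_sdiff T S).symm
    have h6 : ((S ∪ T).card : ℝ) + (S ∩ T).card = S.card + T.card := by
      exact_mod_cast Finset.card_union_add_card_inter S T
    have h7 := excess_add_le hc (imbalance A (S ∩ T)) (imbalance A (S \ T)) (imbalance A (T \ S))
    have h8 : imbalance A (S ∪ T) =
      imbalance A (S ∩ T) + imbalance A (S \ T) + imbalance A (T \ S) := by linarith
    have h9 : ((S ∪ T).card : ℝ) = (S ∩ T).card + (S \ T).card + (T \ S).card := by linarith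
    have h10 : |imbalance A (S \ T)| * |imbalance A (T \ S)| ≤
        ((S \ T).card : ℝ) * (T \ S).card := by gcongr
    rw [h8, h9, h1, h2, h4, h5]
    nlinarith

/-- The instance with objective `s (n - s)`, where `s = |S|`, over the free matroid. -/
def uniformInstance (n : ℕ) : MatroidInstance n where
  f S := (S.card : ℝ) * (n - S.card)
  M := Matroid.freeOn Set.univ
  ground := rfl
  nonneg S := by
    have h : (S.card : ℝ) ≤ n := by exact_mod_cast card_finset_fin_le S
    exact mul_nonneg (by positivity) (by linarith)
  submodular S T := by
    have h4 : (S.card : ℝ) = (S ∩ T).card + (S \ T).card := by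
      exact_mod_cast (Finset.card_inter_add_card_sdiff S T).symm
    have h5 : (T.card : ℝ) = (S ∩ T).card + (T \ S).card := by
      rw [Finset.inter_comm]; exact_mod_cast (Finset.card_inter_add_card_sdiff T S).symm
    have h6 : ((S ∪ T).card : ℝ) + (S ∩ T).card = S.card + T.card := by
      exact_mod_cast Finset.card_union_add_card_inter S T
    have h9 : ((S ∪ T).card : ℝ) = (S ∩ T).card + (S \ T).card + (T \ S).card := by linarith
    have h10 : 0 ≤ ((S \ T).card : ℝ) * (T \ S).card := by positivity
    rw [h9, h4, h5]
    nlinarith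

theorem feasible_cutInstance {n : ℕ} {A : Finset (Fin n)} {c : ℝ} {hc : 0 ≤ c}
    (S : Finset (Fin n)) : (cutInstance n A c hc).Feasible S := by
  simp [MatroidInstance.Feasible, cutInstance]

theorem feasible_uniformInstance {n : ℕ} (S : Finset (Fin n)) :
    (uniformInstance n).Feasible S := by
  simp [MatroidInstance.Feasible, uniformInstance]

theorem MatroidInstance.le_opt {n : ℕ} (I : MatroidInstance n) {S : Finset (Fin n)}
    (hS : I.Feasible S) : I.f S ≤ I.opt := by
  classical
  exact Finset.le_sup' I.f (by simp [feasibleSets, hS])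

theorem MatroidInstance.exists_opt {n : ℕ} (I : MatroidInstance n) :
    ∃ S, I.Feasible S ∧ I.f S = I.opt := by
  obtain ⟨S, hS, h⟩ := Finset.exists_mem_eq_sup' I.feasibleSets_nonempty I.f
  exact ⟨S, by simpa [feasibleSets] using hS, h.symm⟩

theorem MatroidInstance.opt_nonneg {n : ℕ} (I : MatroidInstance n) : 0 ≤ I.opt :=
  (I.nonneg ∅).trans (I.le_opt I.feasible_empty)

theorem uniformInstance_le {n : ℕ} (S : Finset (Fin n)) :
    (uniformInstance n).f S ≤ (n : ℝ) ^ 2 / 4 := by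
  simp only [uniformInstance]
  nlinarith [sq_nonneg ((S.card : ℝ) - n / 2)]

theorem cutInstance_le {n : ℕ} {A : Finset (Fin n)} {c : ℝ} {hc : 0 ≤ c} (S : Finset (Fin n)) :
    (cutInstance n A c hc).f S ≤ 2 * (n : ℝ) ^ 2 := by
  simp only [cutInstance]
  have h1 := excess_le_sq (c := c) (t := 0) (by simpa using hc) (imbalance A S)
  have h2 := abs_imbalance_le A S
  have h3 : (S.card : ℝ) ≤ n := by exact_mod_cast card_finset_fin_le S
  have h4 : (imbalance A S - 0) ^ 2 ≤ (n : ℝ) ^ 2 := by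
    rw [sub_zero, ← sq_abs]; gcongr; linarith
  nlinarith [sq_nonneg ((S.card : ℝ) - n / 2)]

theorem cutInstance_eq_of_balanced {n : ℕ} {A : Finset (Fin n)} {c : ℝ} {hc : 0 ≤ c}
    {S : Finset (Fin n)} (h : |imbalance A S| ≤ c) :
    (cutInstance n A c hc).f S = (uniformInstance n).f S := by
  simp [cutInstance, uniformInstance, excess, max_eq_right (sub_nonpos.2 h)]

/-- The larger of `A` and its complement has size `s ≥ n / 2` and imbalance `± s`. If `s ≥ rn`, its
value is `s n (1 - 2r) + r² n²`. -/
theorem le_opt_cutInstance {n : ℕ} (A : Finset (Fin n)) {r : ℝ} (hr : 0 ≤ r) :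
    (n : ℝ) ^ 2 / 2 * (1 - 2 * r) ≤ (cutInstance n A (r * n) (by positivity)).opt := by
  have key : ∀ S : Finset (Fin n), |imbalance A S| = S.card → (n : ℝ) ≤ 2 * S.card →
      (n : ℝ) ^ 2 / 2 * (1 - 2 * r) ≤ (cutInstance n A (r * n) (by positivity)).opt := by
    intro S h1 h2
    refine le_trans ?_ (MatroidInstance.le_opt _ (feasible_cutInstance S))
    simp only [cutInstance, excess, h1]
    have h3 : (S.card : ℝ) ≤ n := by exact_mod_cast card_finset_fin_le S
    rcases le_or_gt (r * n) S.card with h | h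
    · rw [max_eq_left (by linarith)]
      have h4 : 0 ≤ (S.card : ℝ) := by positivity
      rcases le_or_gt 0 (1 - 2 * r) with h5 | h5
      · nlinarith [mul_nonneg h5 (mul_nonneg (sub_nonneg.2 h2) (Nat.cast_nonneg (α := ℝ) n)),
          sq_nonneg (r * n)]
      · nlinarith [mul_nonneg h4 (sub_nonneg.2 h3), sq_nonneg ((n:ℝ)),
          sq_nonneg ((S.card : ℝ) - r * n)]
    -- If `rn > |S| ≥ n / 2`, the claimed bound is not positive and nothing is left to show.
    · have h5 : 1 - 2 * r ≤ 0 := by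
        rcases Nat.eq_zero_or_pos n with rfl | hn
        · have : (S.card : ℝ) = 0 := le_antisymm (by simpa using h3) (by positivity)
          simp [this] at h
        · have : (0 : ℝ) < n := by exact_mod_cast hn
          by_contra h6
          push Not at h6
          nlinarith
      have : 0 ≤ (S.card : ℝ) * (n - S.card) := mul_nonneg (by positivity) (by linarith)
      nlinarith [sq_nonneg (n : ℝ), sq_nonneg (max ((S.card : ℝ) - r * n) 0)]
  have hc : (A.card : ℝ) + Aᶜ.card = n := by
    have := Finset.card_add_card_compl A
    rw [Fintype.card_fin] at this
    exact_mod_cast this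
  rcases le_total (Aᶜ.card : ℝ) A.card with h | h
  · exact key A (by rw [imbalance_self]; simp) (by linarith)
  · exact key Aᶜ (by rw [imbalance_compl]; simp) (by linarith)

/-- A union bound over the sets queried on the uniform instance and the output, which accounts for
the `+ 1`. If all of them are balanced for `A`, the run is the same and earns at most `n² / 4`;
otherwise the crude bound `2 n²` is used. -/
theorem sum_cutInstance_result_le {n : ℕ} {r : ℝ} (hr : 0 ≤ r) (t : QueryTree n) :
    ∑ A : Finset (Fin n), (cutInstance n A (r * n) (by positivity)).f
        (t.result (cutInstance n A (r * n) (by positivity))) ≤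
      2 ^ n * ((n : ℝ) ^ 2 / 4 + 2 * (n : ℝ) ^ 2 *
        ((t.valueQueries (uniformInstance n) + 1) * (2 * Real.exp (-(r ^ 2 / 2 * n))))) := by
  classical
  set Z : Finset (Finset (Fin n)) :=
    insert (t.result (uniformInstance n)) (t.queried (uniformInstance n))
  set bad : Finset (Fin n) → Finset (Finset (Fin n)) := fun S =>
    Finset.univ.filter fun A => r * n < |imbalance A S|
  have h1 : ∀ A : Finset (Fin n), (cutInstance n A (r * n) (by positivity)).f
      (t.result (cutInstance n A (r * n) (by positivity))) ≤
        (n : ℝ) ^ 2 / 4 + 2 * (n : ℝ) ^ 2 * ∑ S ∈ Z, if A ∈ bad S then 1 else 0 := by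
    intro A
    by_cases hA : ∃ S ∈ Z, A ∈ bad S
    · obtain ⟨S, hS, hAS⟩ := hA
      have : (1 : ℝ) ≤ ∑ S ∈ Z, if A ∈ bad S then 1 else 0 := by
        refine le_trans ?_ (Finset.single_le_sum (fun T _ => ?_) hS)
        · simp [hAS]
        · split_ifs <;> simp
      have := cutInstance_le (A := A) (c := r * n) (hc := by positivity)
        (t.result (cutInstance n A (r * n) (by positivity)))
      nlinarith [sq_nonneg (n : ℝ)]
    · push Not at hA
      have hb : ∀ S ∈ Z, |imbalance A S| ≤ r * n := by simpa [bad] using hA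
      have hres := QueryTree.result_congr (I := uniformInstance n)
        (J := cutInstance n A (r * n) (by positivity))
        (fun S => by simp [feasible_cutInstance, feasible_uniformInstance]) t
        (fun S hS => cutInstance_eq_of_balanced (hb S (Finset.mem_insert_of_mem hS)))
      rw [hres, cutInstance_eq_of_balanced (hb _ (Finset.mem_insert_self _ _))]
      have := uniformInstance_le (t.result (uniformInstance n))
      have h0 : (0 : ℝ) ≤ ∑ S ∈ Z, if A ∈ bad S then 1 else 0 :=
        Finset.sum_nonneg fun S _ => by split_ifs <;> simp
      nlinarith [mul_nonneg (sq_nonneg (n : ℝ)) h0]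
  have h2 : ∑ A : Finset (Fin n), ∑ S ∈ Z, (if A ∈ bad S then (1 : ℝ) else 0) ≤
      (t.valueQueries (uniformInstance n) + 1) * (2 ^ n * (2 * Real.exp (-(r ^ 2 / 2 * n)))) := by
    rw [Finset.sum_comm]
    have h3 : ∀ S ∈ Z, ∑ A : Finset (Fin n), (if A ∈ bad S then (1 : ℝ) else 0) ≤
        2 ^ n * (2 * Real.exp (-(r ^ 2 / 2 * n))) := by
      intro S _
      have := card_imbalance_gt_le S hr
      rw [Fintype.card_fin] at this
      rw [Finset.sum_boole]
      simpa [bad] using this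
    refine (Finset.sum_le_card_nsmul _ _ _ h3).trans ?_
    rw [nsmul_eq_mul]
    gcongr
    have := (Finset.card_insert_le (t.result (uniformInstance n)) _).trans
      (Nat.add_le_add_right (t.card_queried_le (uniformInstance n)) 1)
    exact_mod_cast this
  refine (Finset.sum_le_sum fun A _ => h1 A).trans ?_
  rw [Finset.sum_add_distrib, ← Finset.mul_sum]
  simp only [Finset.sum_const, Finset.card_univ, Fintype.card_finset, Fintype.card_fin,
    nsmul_eq_mul]
  push_cast
  nlinarith [mul_le_mul_of_nonneg_left h2 (by positivity : 0 ≤ 2 * (n : ℝ) ^ 2)]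

/-! ### The exponential lower bound on value queries. -/

namespace RandomizedQueryAlgorithm

theorem measurable_comp_result {n : ℕ} (A : RandomizedQueryAlgorithm n) (I : MatroidInstance n)
    (g : Finset (Fin n) → ℝ) : Measurable fun ω => g ((A.tree ω).result I) := by
  let _ : MeasurableSpace (Finset (Fin n)) := ⊤
  have : Measurable fun ω => (A.tree ω).result I :=
    measurable_to_countable' fun S => A.measurable_result I S
  exact (measurable_from_top (f := g)).comp this

theorem measurable_valueQueries_nat {n : ℕ} (A : RandomizedQueryAlgorithm n)
    (I : MatroidInstance n) : Measurable fun ω => (A.tree ω).valueQueries I :=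
  measurable_to_countable' fun k => A.measurable_valueQueries I k

theorem integrable_comp_result {n : ℕ} (A : RandomizedQueryAlgorithm n) (I : MatroidInstance n)
    (g : Finset (Fin n) → ℝ) : Integrable (fun ω => g ((A.tree ω).result I)) A.P := by
  refine Integrable.of_bound (A.measurable_comp_result I g).aestronglyMeasurable
    (∑ S, ‖g S‖) (Filter.Eventually.of_forall fun ω => ?_)
  exact Finset.single_le_sum (f := fun S => ‖g S‖) (fun _ _ => norm_nonneg _)
    (Finset.mem_univ _)

theorem IsApproximation.mono {n : ℕ} {A : RandomizedQueryAlgorithm n} {a b : ℝ}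
    (h : A.IsApproximation a) (hb : b ≤ a) : A.IsApproximation b := fun I =>
  ⟨(h I).1, (mul_le_mul_of_nonneg_right hb I.opt_nonneg).trans (h I).2⟩

end RandomizedQueryAlgorithm

/-- An approximation factor above `1 / 2` forces many value queries on the uniform instance. -/
theorem approximation_gap_le {n : ℕ} (A : RandomizedQueryAlgorithm n) {ε r : ℝ}
    (hr : 0 ≤ r) (hε : 0 ≤ 1 / 2 + ε) (hA : A.IsApproximation (1 / 2 + ε)) {q : ℝ}
    (hq0 : 0 ≤ q) (hq : A.expectedValueQueries (uniformInstance n) ≤ ENNReal.ofReal q) :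
    (1 / 2 + ε) * ((n : ℝ) ^ 2 / 2 * (1 - 2 * r)) ≤
      (n : ℝ) ^ 2 / 4 + 2 * (n : ℝ) ^ 2 * ((q + 1) * (2 * Real.exp (-(r ^ 2 / 2 * n)))) := by
  set J : Finset (Fin n) → MatroidInstance n := fun B => cutInstance n B (r * n) (by positivity)
  set Z : A.Ω → ℝ := fun ω => ((A.tree ω).valueQueries (uniformInstance n) : ℝ)
  have hZm : Measurable Z := measurable_from_top.comp (A.measurable_valueQueries_nat _)
  have hZe : ∀ ω, ENNReal.ofReal (Z ω) =
      ((A.tree ω).valueQueries (uniformInstance n) : ℝ≥0∞) := fun ω => by simp [Z]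
  have hZi : Integrable Z A.P := by
    refine ⟨hZm.aestronglyMeasurable, ?_⟩
    rw [hasFiniteIntegral_iff_ofReal (Filter.Eventually.of_forall fun ω => by simp [Z])]
    simp_rw [hZe]
    exact hq.trans_lt ENNReal.ofReal_lt_top
  have hZq : ∫ ω, Z ω ∂A.P ≤ q := by
    rw [integral_eq_lintegral_of_nonneg_ae (Filter.Eventually.of_forall fun ω => by simp [Z])
      hZm.aestronglyMeasurable]
    simp_rw [hZe]
    exact ENNReal.toReal_le_of_le_ofReal hq0 hq
  set e : ℝ := 2 * Real.exp (-(r ^ 2 / 2 * n))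
  have hI : Integrable (fun ω => (Z ω + 1) * e) A.P :=
    (hZi.add (integrable_const 1)).mul_const e
  have h1 : (2 : ℝ) ^ n * ((1 / 2 + ε) * ((n : ℝ) ^ 2 / 2 * (1 - 2 * r))) ≤
      ∑ B : Finset (Fin n), ∫ ω, (J B).f ((A.tree ω).result (J B)) ∂A.P := by
    have : ∀ B ∈ (Finset.univ : Finset (Finset (Fin n))),
        (1 / 2 + ε) * ((n : ℝ) ^ 2 / 2 * (1 - 2 * r)) ≤
          ∫ ω, (J B).f ((A.tree ω).result (J B)) ∂A.P := fun B _ =>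
      (mul_le_mul_of_nonneg_left (le_opt_cutInstance B hr) hε).trans (hA (J B)).2
    refine le_trans (le_of_eq ?_) (Finset.card_nsmul_le_sum _ _ _ this)
    simp
  -- Exchanging the sum over hidden sets with the expectation lets the bound for deterministic trees
  -- apply to each outcome separately.
  rw [← integral_finsetSum _ fun B _ => A.integrable_comp_result (J B) (J B).f] at h1
  have h2 : ∫ ω, ∑ B : Finset (Fin n), (J B).f ((A.tree ω).result (J B)) ∂A.P ≤
      ∫ ω, 2 ^ n * ((n : ℝ) ^ 2 / 4 + 2 * (n : ℝ) ^ 2 * ((Z ω + 1) * e)) ∂A.P := by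
    refine integral_mono (integrable_finsetSum _ fun B _ =>
      A.integrable_comp_result (J B) (J B).f) ?_ fun ω => sum_cutInstance_result_le hr (A.tree ω)
    exact ((integrable_const _).add (hI.const_mul _)).const_mul _
  have h3 : ∫ ω, 2 ^ n * ((n : ℝ) ^ 2 / 4 + 2 * (n : ℝ) ^ 2 * ((Z ω + 1) * e)) ∂A.P =
      2 ^ n * ((n : ℝ) ^ 2 / 4 + 2 * (n : ℝ) ^ 2 * ((∫ ω, Z ω ∂A.P + 1) * e)) := by
    rw [integral_const_mul, integral_add (integrable_const _) (hI.const_mul _), integral_const_mul,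
      integral_mul_const, integral_add hZi (integrable_const 1)]
    simp
  rw [h3] at h2
  have h4 := le_of_mul_le_mul_left (h1.trans h2) (by positivity)
  refine h4.trans ?_
  have : 0 ≤ e := by positivity
  gcongr

theorem exists_exp_le_expectedValueQueries {ε : ℝ} (hε : 0 < ε) :
    ∃ c : ℝ, 0 < c ∧ ∃ n₀ : ℕ, ∀ n : ℕ, n₀ ≤ n →
      ∀ A : RandomizedQueryAlgorithm n, A.IsApproximation (1 / 2 + ε) →
        ∃ I : MatroidInstance n,
          ENNReal.ofReal (Real.exp (c * (n : ℝ))) ≤ A.expectedValueQueries I := by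
  -- For `δ ≤ 1 / 2` and `r = δ / 4` the left side of the gap inequality, divided by `n²`, is at
  -- least `1/4 + δ/4`.
  set δ : ℝ := min ε (1 / 2)
  have hδ : 0 < δ := lt_min hε (by norm_num)
  have hδ2 : δ ≤ 1 / 2 := min_le_right _ _
  -- Half of the decay rate `r² / 2`, so that `exp(c n)` queries still leave a failure probability
  -- of order `exp(-c n)`.
  set c : ℝ := (δ / 4) ^ 2 / 4
  have hc : 0 < c := by positivity
  have hlim : Tendsto (fun n : ℕ => Real.exp (-(c * (n : ℝ)))) atTop (𝓝 0) :=
    Real.tendsto_exp_neg_atTop_nhds_zero.comp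
      (tendsto_natCast_atTop_atTop.const_mul_atTop hc)
  obtain ⟨n₀, hn₀⟩ := Filter.eventually_atTop.1
    -- With this threshold the error term, including its outer factor `2`, stays strictly below `δ /
    -- 4`.
    (hlim.eventually (gt_mem_nhds (by positivity : 0 < δ / 32)))
  refine ⟨c, hc, n₀ + 1, fun n hn A hA => ⟨uniformInstance n, ?_⟩⟩
  by_contra hlt
  push Not at hlt
  have hn1 : (0 : ℝ) < n := by exact_mod_cast (Nat.succ_pos n₀).trans_le hn
  have key := approximation_gap_le A (ε := δ) (r := δ / 4) (by positivity) (by positivity)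
    (hA.mono (by linarith [min_le_left ε (1 / 2)])) (Real.exp_nonneg _) hlt.le
  have hsmall := hn₀ n (by omega)
  have e1 : Real.exp (c * n) * Real.exp (-((δ / 4) ^ 2 / 2 * n)) = Real.exp (-(c * n)) := by
    rw [← Real.exp_add]; congr 1; simp only [c]; ring
  have e2 : Real.exp (-((δ / 4) ^ 2 / 2 * n)) ≤ Real.exp (-(c * n)) := by
    apply Real.exp_le_exp.2
    have : 0 ≤ (δ / 4) ^ 2 / 4 * n := by positivity
    simp only [c]; linarith
  have e3 : (Real.exp (c * n) + 1) * (2 * Real.exp (-((δ / 4) ^ 2 / 2 * n))) < δ / 8 := by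
    have : (Real.exp (c * n) + 1) * (2 * Real.exp (-((δ / 4) ^ 2 / 2 * n))) =
      2 * (Real.exp (c * n) * Real.exp (-((δ / 4) ^ 2 / 2 * n))) +
        2 * Real.exp (-((δ / 4) ^ 2 / 2 * n)) := by ring
    rw [this, e1]
    linarith
  have e4 : 0 < (n : ℝ) ^ 2 := by positivity
  have e5 : (1 / 2 + δ) * (1 / 2 * (1 - 2 * (δ / 4))) ≤ 1 / 4 + 2 *
      ((Real.exp (c * n) + 1) * (2 * Real.exp (-((δ / 4) ^ 2 / 2 * n)))) := by
    refine le_of_mul_le_mul_left ?_ e4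
    linarith
  nlinarith

/-! ### The multilinear extension and one step of the measured continuous greedy method. -/

section Multilinear

variable {α : Type*} [DecidableEq α]

/-- Submodularity of a real set function. -/
def IsSubmodular (f : Finset α → ℝ) : Prop := ∀ S T, f (S ∪ T) + f (S ∩ T) ≤ f S + f T

theorem IsSubmodular.comp_insert {f : Finset α → ℝ} (hf : IsSubmodular f) (u : α) :
    IsSubmodular fun S => f (insert u S) := by
  intro S T
  have := hf (insert u S) (insert u T)
  rwa [← Finset.insert_union_distrib, ← Finset.insert_inter_distrib] at this

theorem IsSubmodular.comp_union {f : Finset α → ℝ} (hf : IsSubmodular f) (O : Finset α) :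
    IsSubmodular fun S => f (S ∪ O) := by
  intro S T
  have := hf (S ∪ O) (T ∪ O)
  rwa [← Finset.union_union_distrib_right, ← Finset.inter_union_distrib_right] at this

theorem IsSubmodular.union_sub_le_sum {f : Finset α → ℝ} (hf : IsSubmodular f)
    (S O : Finset α) : f (S ∪ O) - f S ≤ ∑ u ∈ O, (f (insert u S) - f S) := by
  induction O using Finset.induction_on with
  | empty => simp
  | insert u O hu ih =>
    rw [Finset.sum_insert hu]
    have h := hf (insert u S) (S ∪ O)
    have e1 : insert u S ∪ (S ∪ O) = S ∪ insert u O := by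
      ext i; simp only [Finset.mem_union, Finset.mem_insert]; tauto
    have e2 : insert u S ∩ (S ∪ O) = S := by
      ext i
      simp only [Finset.mem_inter, Finset.mem_union, Finset.mem_insert]
      constructor
      · rintro ⟨rfl | h, h' | h'⟩
        · exact h'
        · exact absurd h' hu
        · exact h
        · exact h
      · exact fun h => ⟨Or.inr h, Or.inl h⟩
    rw [e1, e2] at h
    linarith

/-- The coordinates in `P` are raised by independent events of probability `δ`. -/
def probAdd (δ : ℝ) (P : Finset α) (x : α → ℝ) (i : α) : ℝ :=
  if i ∈ P then x i + (1 - x i) * δ else x i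

theorem probAdd_mem {δ : ℝ} (h0 : 0 ≤ δ) (h1 : δ ≤ 1) (P : Finset α) {x : α → ℝ}
    (hx : ∀ i, x i ∈ Set.Icc (0 : ℝ) 1) (i : α) : probAdd δ P x i ∈ Set.Icc (0 : ℝ) 1 := by
  obtain ⟨h2, h3⟩ := hx i
  unfold probAdd
  split_ifs
  · exact ⟨by nlinarith, by nlinarith⟩
  · exact hx i

variable [Fintype α]

/-- The multilinear extension of a set function: the expectation of `f(R)`, where `R` contains
each `i` independently with probability `x i`. -/
def mlext (f : Finset α → ℝ) (x : α → ℝ) : ℝ :=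
  ∑ R : Finset α, (∏ i, if i ∈ R then x i else 1 - x i) * f R

theorem mlext_add (f g : Finset α → ℝ) (x : α → ℝ) :
    mlext (fun S => f S + g S) x = mlext f x + mlext g x := by
  simp only [mlext, mul_add, Finset.sum_add_distrib]

theorem mlext_const_mul (c : ℝ) (f : Finset α → ℝ) (x : α → ℝ) :
    mlext (fun S => c * f S) x = c * mlext f x := by
  simp only [mlext, Finset.mul_sum]
  exact Finset.sum_congr rfl fun _ _ => by ring

theorem mlext_sum {ι : Type*} (s : Finset ι) (f : ι → Finset α → ℝ) (x : α → ℝ) :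
    mlext (fun S => ∑ j ∈ s, f j S) x = ∑ j ∈ s, mlext (f j) x := by
  simp only [mlext, Finset.mul_sum]
  exact Finset.sum_comm

theorem mlext_sub (f g : Finset α → ℝ) (x : α → ℝ) :
    mlext (fun S => f S - g S) x = mlext f x - mlext g x := by
  simp only [mlext, mul_sub, Finset.sum_sub_distrib]

theorem mlext_weight_nonneg {x : α → ℝ} (hx : ∀ i, x i ∈ Set.Icc (0 : ℝ) 1) (R : Finset α) :
    0 ≤ ∏ i, if i ∈ R then x i else 1 - x i := by
  refine Finset.prod_nonneg fun i _ => ?_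
  have := hx i
  split_ifs
  · exact this.1
  · exact sub_nonneg.2 this.2

theorem mlext_mono {f g : Finset α → ℝ} {x : α → ℝ} (hx : ∀ i, x i ∈ Set.Icc (0 : ℝ) 1)
    (h : ∀ S, f S ≤ g S) : mlext f x ≤ mlext g x :=
  Finset.sum_le_sum fun R _ => mul_le_mul_of_nonneg_left (h R) (mlext_weight_nonneg hx R)

theorem mlext_nonneg {f : Finset α → ℝ} {x : α → ℝ} (hx : ∀ i, x i ∈ Set.Icc (0 : ℝ) 1)
    (h : ∀ S, 0 ≤ f S) : 0 ≤ mlext f x :=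
  Finset.sum_nonneg fun R _ => mul_nonneg (mlext_weight_nonneg hx R) (h R)

theorem mlext_const (c : ℝ) (x : α → ℝ) : mlext (fun _ => c) x = c := by
  have h := Finset.prod_add x (fun i => 1 - x i) Finset.univ
  simp only [add_sub_cancel, Finset.prod_const_one, Finset.powerset_univ] at h
  rw [mlext, ← Finset.sum_mul]
  conv_rhs => rw [← one_mul c, h]
  congr 1
  refine Finset.sum_congr rfl fun R _ => ?_
  rw [← Finset.prod_sdiff (Finset.subset_univ R), mul_comm]
  congr 1
  · exact Finset.prod_congr rfl fun i hi => by simp [hi]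
  · exact Finset.prod_congr rfl fun i hi => by simp [(Finset.mem_sdiff.1 hi).2]

theorem mlext_eq_sum_erase (f : Finset α → ℝ) (x : α → ℝ) (u : α) :
    mlext f x = ∑ T ∈ (Finset.univ.erase u).powerset,
      (∏ i ∈ Finset.univ.erase u, if i ∈ T then x i else 1 - x i) *
        ((1 - x u) * f T + x u * f (insert u T)) := by
  have hu : u ∉ Finset.univ.erase u := by simp
  have h : (Finset.univ : Finset (Finset α)) = (insert u (Finset.univ.erase u)).powerset := by
    rw [Finset.insert_erase (Finset.mem_univ u), Finset.powerset_univ]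
  rw [mlext, h, Finset.sum_powerset_insert hu, ← Finset.sum_add_distrib]
  refine Finset.sum_congr rfl fun T hT => ?_
  have hT' : u ∉ T := fun h => hu (Finset.mem_powerset.1 hT h)
  have e1 : ∀ R : Finset α, (∏ i, if i ∈ R then x i else 1 - x i) =
      (if u ∈ R then x u else 1 - x u) *
        ∏ i ∈ Finset.univ.erase u, if i ∈ R then x i else 1 - x i := fun R =>
    (Finset.mul_prod_erase Finset.univ (fun i => if i ∈ R then x i else 1 - x i)
      (Finset.mem_univ u)).symm
  have e2 : (∏ i ∈ Finset.univ.erase u, if i ∈ insert u T then x i else 1 - x i) =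
      ∏ i ∈ Finset.univ.erase u, if i ∈ T then x i else 1 - x i := by
    refine Finset.prod_congr rfl fun i hi => ?_
    simp [Finset.ne_of_mem_erase hi]
  rw [e1 T, e1 (insert u T), e2, if_neg hT', if_pos (Finset.mem_insert_self u T)]
  ring

theorem mlext_update (f : Finset α → ℝ) (x : α → ℝ) (u : α) (c : ℝ) :
    mlext f (Function.update x u c) =
      c * mlext (fun S => f (insert u S)) x + (1 - c) * mlext (fun S => f (S.erase u)) x := by
  rw [mlext_eq_sum_erase _ _ u, mlext_eq_sum_erase _ x u, mlext_eq_sum_erase _ x u,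
    Finset.mul_sum, Finset.mul_sum, ← Finset.sum_add_distrib]
  refine Finset.sum_congr rfl fun T hT => ?_
  have hT' : u ∉ T := fun h => (Finset.notMem_erase u _) (Finset.mem_powerset.1 hT h)
  have : (∏ i ∈ Finset.univ.erase u,
      if i ∈ T then Function.update x u c i else 1 - Function.update x u c i) =
      ∏ i ∈ Finset.univ.erase u, if i ∈ T then x i else 1 - x i := by
    refine Finset.prod_congr rfl fun i hi => ?_
    rw [Function.update_of_ne (Finset.ne_of_mem_erase hi)]
  rw [this, Function.update_self, Finset.insert_idem, Finset.erase_insert hT',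
    Finset.erase_eq_of_notMem hT']
  ring

theorem mlext_expand (f : Finset α → ℝ) (x : α → ℝ) (u : α) :
    mlext f x =
      x u * mlext (fun S => f (insert u S)) x + (1 - x u) * mlext (fun S => f (S.erase u)) x := by
  rw [← mlext_update, Function.update_eq_self]

/-- `mlext f` is affine in each coordinate. -/
theorem mlext_update_convex (f : Finset α → ℝ) (x : α → ℝ) (u : α) (p a b : ℝ) :
    mlext f (Function.update x u (p * a + (1 - p) * b)) =
      p * mlext f (Function.update x u a) + (1 - p) * mlext f (Function.update x u b) := by
  simp only [mlext_update]
  ring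

/-- Restricting to subsets of the support matters because values are bounded by the optimum only on
independent sets; in the application `A` is independent. -/
theorem mlext_congr_support {x : α → ℝ} {A : Finset α} (hx : ∀ i, i ∉ A → x i = 0)
    {f g : Finset α → ℝ} (h : ∀ S ⊆ A, f S = g S) : mlext f x = mlext g x := by
  refine Finset.sum_congr rfl fun R _ => ?_
  by_cases hR : R ⊆ A
  · rw [h R hR]
  · obtain ⟨i, hi, hiA⟩ := Finset.not_subset.1 hR
    have : (∏ i, if i ∈ R then x i else 1 - x i) = 0 :=
      Finset.prod_eq_zero (Finset.mem_univ i) (by simp [hi, hx i hiA])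
    rw [this, zero_mul, zero_mul]

theorem mlext_mono_support {x : α → ℝ} (hx : ∀ i, x i ∈ Set.Icc (0 : ℝ) 1) {A : Finset α}
    (hA : ∀ i, i ∉ A → x i = 0) {f g : Finset α → ℝ} (h : ∀ S ⊆ A, f S ≤ g S) :
    mlext f x ≤ mlext g x := by
  rw [mlext_congr_support hA (f := f) (g := fun S => f (S ∩ A))
      (fun S hS => by rw [Finset.inter_eq_left.2 hS]),
    mlext_congr_support hA (f := g) (g := fun S => g (S ∩ A))
      (fun S hS => by rw [Finset.inter_eq_left.2 hS])]
  exact mlext_mono hx fun S => h _ Finset.inter_subset_right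

theorem mlext_indicator (f : Finset α → ℝ) (A : Finset α) :
    mlext f (fun i => if i ∈ A then 1 else 0) = f A := by
  rw [mlext, Finset.sum_eq_single A]
  · rw [Finset.prod_eq_one, one_mul]
    intro i _
    split_ifs <;> simp
  · intro R _ hR
    obtain ⟨i, hi⟩ : ∃ i, ¬ (i ∈ R ↔ i ∈ A) := by
      by_contra h
      push Not at h
      exact hR (Finset.ext h)
    rw [Finset.prod_eq_zero (Finset.mem_univ i), zero_mul]
    by_cases h1 : i ∈ R <;> by_cases h2 : i ∈ A <;> simp_all
  · simp

/-- The multilinear extension of a submodular function is convex in the directions `e_u - e_v`. -/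
theorem IsSubmodular.mlext_le_exchange {f : Finset α → ℝ} (hf : IsSubmodular f) {z : α → ℝ}
    (hz : ∀ i, z i ∈ Set.Icc (0 : ℝ) 1) {u v : α} {p a b : ℝ}
    (ha : p * a = z u) (hb : (1 - p) * b = z v) :
    mlext f z ≤ p * mlext f (Function.update (Function.update z u a) v 0) +
      (1 - p) * mlext f (Function.update (Function.update z u 0) v b) := by
  have h1 : mlext f z = mlext f (Function.update (Function.update z u (z u)) v (z v)) := by
    rw [Function.update_eq_self, Function.update_eq_self]
  rw [h1]
  simp only [mlext_update]
  -- In the coordinates `u`, `v` the extension is bilinear. The constant and linear terms of both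
  -- sides agree, and the product terms on the right vanish. What remains is `z u * z v` times this
  -- mixed difference, which is not positive.
  have h2 : mlext (fun S => f (insert v (insert u S))) z +
        mlext (fun S => f ((S.erase u).erase v)) z ≤
      mlext (fun S => f ((insert u S).erase v)) z +
        mlext (fun S => f (insert v (S.erase u))) z := by
    rw [← mlext_add, ← mlext_add]
    refine mlext_mono hz fun S => ?_
    have h := hf ((insert u S).erase v) (insert v (S.erase u))
    have e1 : (insert u S).erase v ∪ insert v (S.erase u) = insert v (insert u S) := by
      ext i; simp only [Finset.mem_union, Finset.mem_erase, Finset.mem_insert]; tauto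
    have e2 : (insert u S).erase v ∩ insert v (S.erase u) = (S.erase u).erase v := by
      ext i
      simp only [Finset.mem_inter, Finset.mem_erase, Finset.mem_insert]
      constructor
      · rintro ⟨⟨h1, h2⟩, h3⟩
        rcases h3 with h3 | h3
        · exact absurd h3 h1
        · exact ⟨h1, h3⟩
      · rintro ⟨h1, h2, h3⟩
        exact ⟨⟨h1, Or.inr h3⟩, Or.inr ⟨h2, h3⟩⟩
    rwa [e1, e2] at h
  have h3 := mul_nonneg (mul_nonneg (hz u).1 (hz v).1) (sub_nonneg.2 h2)
  rw [← ha, ← hb] at *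
  nlinarith [h3]

theorem mlext_probAdd_insert (f : Finset α → ℝ) (δ : ℝ) {P : Finset α} {u : α} (hu : u ∉ P)
    (x : α → ℝ) : mlext f (probAdd δ (insert u P) x) =
      (1 - δ) * mlext f (probAdd δ P x) + δ * mlext (fun S => f (insert u S)) (probAdd δ P x) := by
  have : probAdd δ (insert u P) x =
      Function.update (probAdd δ P x) u (x u + (1 - x u) * δ) := by
    ext i
    by_cases hi : i = u
    · subst hi; simp [probAdd]
    · simp [probAdd, hi]
  rw [this, mlext_update, mlext_expand f (probAdd δ P x) u]
  simp only [probAdd, if_neg hu]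
  ring

theorem mlext_probAdd_empty (f : Finset α → ℝ) (δ : ℝ) (x : α → ℝ) :
    mlext f (probAdd δ ∅ x) = mlext f x := by
  congr 1

/-- Diminishing returns: adding a random `δ`-fraction of `P` is worth at least the interpolation
between adding nothing and adding all of `P`. Applied to `f(S ∪ O)`, it shows that the value
together with `O` loses at most a factor `1 - δ` per step. -/
theorem IsSubmodular.le_mlext_probAdd {f : Finset α → ℝ} (hf : IsSubmodular f) {δ : ℝ}
    (h0 : 0 ≤ δ) (h1 : δ ≤ 1) (P : Finset α) {x : α → ℝ} (hx : ∀ i, x i ∈ Set.Icc (0 : ℝ) 1) :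
    (1 - δ) * mlext f x + δ * mlext (fun S => f (S ∪ P)) x ≤ mlext f (probAdd δ P x) := by
  induction P using Finset.induction_on generalizing f with
  | empty =>
    simp only [Finset.union_empty, mlext_probAdd_empty]
    linarith
  | insert u P hu ih =>
    rw [mlext_probAdd_insert f δ hu]
    have i1 := ih hf
    have i2 := ih (hf.comp_insert u)
    have h2 : mlext f x + mlext (fun S => f (S ∪ insert u P)) x ≤
        mlext (fun S => f (insert u S)) x + mlext (fun S => f (S ∪ P)) x := by
      rw [← mlext_add, ← mlext_add]
      refine mlext_mono hx fun S => ?_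
      have h := hf (insert u S) (S ∪ P)
      have e1 : insert u S ∪ (S ∪ P) = S ∪ insert u P := by
        ext i; simp only [Finset.mem_union, Finset.mem_insert]; tauto
      have e2 : insert u S ∩ (S ∪ P) = S := by
        ext i
        simp only [Finset.mem_inter, Finset.mem_union, Finset.mem_insert]
        constructor
        · rintro ⟨rfl | h, h' | h'⟩
          · exact h'
          · exact absurd h' hu
          · exact h
          · exact h
        · exact fun h => ⟨Or.inr h, Or.inl h⟩
      rw [e1, e2] at h
      linarith
    have h3 : mlext (fun S => f (insert u (S ∪ P))) x = mlext (fun S => f (S ∪ insert u P)) x := by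
      simp only [Finset.union_insert]
    rw [h3] at i2
    nlinarith [mul_le_mul_of_nonneg_left i1 (sub_nonneg.2 h1), mul_le_mul_of_nonneg_left i2 h0,
      mul_le_mul_of_nonneg_left h2 (mul_nonneg h0 (sub_nonneg.2 h1))]

theorem pow_mul_mlext_le_mlext_probAdd {f : Finset α → ℝ} (hf : ∀ S, 0 ≤ f S) {δ : ℝ}
    (h0 : 0 ≤ δ) (h1 : δ ≤ 1) (P : Finset α) {x : α → ℝ} (hx : ∀ i, x i ∈ Set.Icc (0 : ℝ) 1) :
    (1 - δ) ^ P.card * mlext f x ≤ mlext f (probAdd δ P x) := by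
  induction P using Finset.induction_on with
  | empty => simp [mlext_probAdd_empty]
  | insert u P hu ih =>
    rw [mlext_probAdd_insert f δ hu, Finset.card_insert_of_notMem hu, pow_succ]
    have h2 := mul_nonneg h0 (mlext_nonneg (probAdd_mem h0 h1 P hx) fun S => hf (insert u S))
    nlinarith [mul_le_mul_of_nonneg_left ih (sub_nonneg.2 h1)]

/-- By nonnegativity it suffices to keep the outcomes in which no event, or exactly one event,
raises a coordinate. Their probabilities are at least `(1 - δ)^|P|` and `δ (1 - δ)^|P|`. -/
theorem pow_mul_sum_le_mlext_probAdd {f : Finset α → ℝ} (hf : ∀ S, 0 ≤ f S) {δ : ℝ}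
    (h0 : 0 ≤ δ) (h1 : δ ≤ 1) (P : Finset α) {x : α → ℝ} (hx : ∀ i, x i ∈ Set.Icc (0 : ℝ) 1) :
    (1 - δ) ^ P.card * (mlext f x + δ * ∑ u ∈ P, mlext (fun S => f (insert u S)) x) ≤
      mlext f (probAdd δ P x) := by
  induction P using Finset.induction_on with
  | empty => simp [mlext_probAdd_empty]
  | insert u P hu ih =>
    rw [mlext_probAdd_insert f δ hu, Finset.card_insert_of_notMem hu, pow_succ,
      Finset.sum_insert hu]
    have h2 := mul_le_mul_of_nonneg_left
      (pow_mul_mlext_le_mlext_probAdd (fun S => hf (insert u S)) h0 h1 P hx) h0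
    have h3 := mul_le_mul_of_nonneg_left ih (sub_nonneg.2 h1)
    have h4 : 0 ≤ (1 - δ) ^ P.card * mlext (fun S => f (insert u S)) x :=
      mul_nonneg (pow_nonneg (sub_nonneg.2 h1) _) (mlext_nonneg hx fun S => hf _)
    nlinarith [mul_nonneg (mul_nonneg h0 h0) h4]

/-- The expected marginal value of `u`. -/
def marginal (f : Finset α → ℝ) (x : α → ℝ) (u : α) : ℝ :=
  mlext (fun S => f (insert u S)) x - mlext f x

theorem IsSubmodular.mlext_union_sub_le {f : Finset α → ℝ} (hf : IsSubmodular f) (O : Finset α)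
    {x : α → ℝ} (hx : ∀ i, x i ∈ Set.Icc (0 : ℝ) 1) :
    mlext (fun S => f (S ∪ O)) x - mlext f x ≤ ∑ u ∈ O, marginal f x u := by
  have := mlext_mono hx fun S => hf.union_sub_le_sum S O
  rwa [mlext_sub, mlext_sum, Finset.sum_congr rfl fun u _ => mlext_sub _ _ _] at this

/-- The gain of one step of the continuous greedy algorithm with inexact weights `c`. -/
theorem IsSubmodular.greedy_step_le {f : Finset α → ℝ} (hf : IsSubmodular f) (hf0 : ∀ S, 0 ≤ f S)
    {δ V : ℝ} (h0 : 0 ≤ δ) (h1 : δ ≤ 1) {P O D : Finset α} (hP : P ⊆ D) (hO : O ⊆ D) {x : α → ℝ}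
    (hx : ∀ i, x i ∈ Set.Icc (0 : ℝ) 1) {c : α → ℝ} (hc : ∑ u ∈ O, c u ≤ ∑ u ∈ P, c u)
    (hV : mlext f x ≤ V) (hw : ∀ u ∈ P, marginal f x u ≤ V) :
    (1 - δ) * mlext f x + δ * mlext (fun S => f (S ∪ O)) x
        - 2 * (Fintype.card α : ℝ) ^ 2 * δ ^ 2 * V - 2 * δ * ∑ u ∈ D, |c u - marginal f x u| ≤
      mlext f (probAdd δ P x) := by
  set w := marginal f x
  set m : ℝ := (P.card : ℝ) with hm
  have hm0 : 0 ≤ m := Nat.cast_nonneg _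
  have hmn : m ≤ Fintype.card α := Nat.cast_le.2 (Finset.card_le_univ P)
  have hF : 0 ≤ mlext f x := mlext_nonneg hx hf0
  have a1 := hf.mlext_union_sub_le O hx
  -- The inexact weights are paid for twice, here on `O` and below on `P`.
  have a2 : ∑ u ∈ O, w u ≤ ∑ u ∈ O, c u + ∑ u ∈ D, |c u - w u| := by
    have := Finset.sum_le_sum_of_subset_of_nonneg (f := fun u => |c u - w u|) hO
      fun _ _ _ => abs_nonneg _
    have h2 : ∑ u ∈ O, (w u - c u) ≤ ∑ u ∈ O, |c u - w u| :=
      Finset.sum_le_sum fun u _ => by rw [abs_sub_comm]; exact le_abs_self _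
    rw [Finset.sum_sub_distrib] at h2
    linarith
  have a3 : ∑ u ∈ P, c u ≤ ∑ u ∈ P, w u + ∑ u ∈ D, |c u - w u| := by
    have := Finset.sum_le_sum_of_subset_of_nonneg (f := fun u => |c u - w u|) hP
      fun _ _ _ => abs_nonneg _
    have h2 : ∑ u ∈ P, (c u - w u) ≤ ∑ u ∈ P, |c u - w u| :=
      Finset.sum_le_sum fun u _ => le_abs_self _
    rw [Finset.sum_sub_distrib] at h2
    linarith
  have a4 := pow_mul_sum_le_mlext_probAdd hf0 h0 h1 P hx
  have a5 : ∑ u ∈ P, mlext (fun S => f (insert u S)) x = m * mlext f x + ∑ u ∈ P, w u := by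
    simp only [w, marginal, Finset.sum_sub_distrib, Finset.sum_const, nsmul_eq_mul]
    ring
  have a6 : ∑ u ∈ P, w u ≤ m * V := by
    have := Finset.sum_le_card_nsmul _ _ _ hw
    rwa [nsmul_eq_mul] at this
  -- After Bernoulli's inequality the first-order terms `mδF` cancel. The remaining losses `m²δ²F`
  -- and `mδ²∑w` are each at most `n²δ²V`.
  have a7 : 1 - m * δ ≤ (1 - δ) ^ P.card := by
    have := one_add_mul_le_pow (a := -δ) (by linarith) P.card
    rw [← sub_eq_add_neg] at this
    linarith
  have a8 : 0 ≤ mlext f x + δ * ∑ u ∈ P, mlext (fun S => f (insert u S)) x :=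
    add_nonneg hF (mul_nonneg h0 (Finset.sum_nonneg fun u _ => mlext_nonneg hx fun S => hf0 _))
  have a9 := (mul_le_mul_of_nonneg_right a7 a8).trans a4
  rw [a5] at a9
  have b1 : m ^ 2 * δ ^ 2 * mlext f x ≤ (Fintype.card α : ℝ) ^ 2 * δ ^ 2 * V := by gcongr
  have b2 : m * δ ^ 2 * ∑ u ∈ P, w u ≤ (Fintype.card α : ℝ) ^ 2 * δ ^ 2 * V := by
    have hV0 : 0 ≤ V := hF.trans hV
    calc m * δ ^ 2 * ∑ u ∈ P, w u ≤ m * δ ^ 2 * (m * V) := by gcongr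
      _ = m ^ 2 * δ ^ 2 * V := by ring
      _ ≤ _ := by gcongr
  have b3 := mul_le_mul_of_nonneg_left
    (show mlext (fun S => f (S ∪ O)) x - mlext f x - 2 * ∑ u ∈ D, |c u - w u| ≤ ∑ u ∈ P, w u by
      linarith) h0
  linarith

end Multilinear

/-! ### Exchange of bases and the matroid greedy algorithm. -/

namespace MatroidInstance

variable {n : ℕ} (I : MatroidInstance n)

/-- The finite set `C` is a base of the matroid. -/
def Base (C : Finset (Fin n)) : Prop := I.M.IsBase (C : Set (Fin n))

variable {I}

theorem Base.feasible {C : Finset (Fin n)} (h : I.Base C) : I.Feasible C := h.indep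

theorem Feasible.subset {C D : Finset (Fin n)} (h : I.Feasible D) (hC : C ⊆ D) : I.Feasible C :=
  Matroid.Indep.subset h (Finset.coe_subset.2 hC)

theorem base_of_maximal {C : Finset (Fin n)} (h : I.Feasible C)
    (hmax : ∀ u, u ∉ C → ¬ I.Feasible (insert u C)) : I.Base C := by
  refine h.isBase_of_forall_insert fun e he => ?_
  have := hmax e (by simpa using he.2)
  rwa [Feasible, Finset.coe_insert] at this

theorem Base.exchange {C : Finset (Fin n)} (h : I.Base C) {u v : Fin n} (hu : u ∈ C) (hv : v ∉ C)
    (hf : I.Feasible (insert v (C.erase u))) : I.Base (insert v (C.erase u)) := by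
  have h1 := h.exchange_isBase_of_indep' (e := u) (f := v) (by simpa using hu) (by simpa using hv)
  have e : (insert v (C : Set (Fin n)) \ {u}) =
      ((insert v (C.erase u) : Finset (Fin n)) : Set _) := by
    have : v ≠ u := fun h => hv (h ▸ hu)
    ext i
    simp only [Set.mem_sdiff, Set.mem_insert_iff, Finset.mem_coe, Set.mem_singleton_iff,
      Finset.coe_insert, Finset.coe_erase]
    constructor
    · tauto
    · rintro (rfl | h)
      · exact ⟨Or.inl rfl, this⟩
      · tauto
  rw [e] at h1
  exact h1 hf

theorem Base.eq_of_subset {B C : Finset (Fin n)} (hB : I.Base B) (hC : I.Feasible C)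
    (h : B ⊆ C) : B = C :=
  Finset.coe_injective (Matroid.IsBase.eq_of_subset_indep hB hC (Finset.coe_subset.2 h))

/-- Symmetric exchange of bases. -/
theorem Base.symm_exchange {B C : Finset (Fin n)} (hB : I.Base B) (hC : I.Base C) {v : Fin n}
    (hvB : v ∈ B) (hvC : v ∉ C) : ∃ u, u ∈ C ∧ u ∉ B ∧
      I.Feasible (insert v (C.erase u)) ∧ I.Feasible (insert u (B.erase v)) := by
  have hE : ∀ X : Set (Fin n), X ⊆ I.M.E := fun X => by rw [I.ground]; exact Set.subset_univ X
  have hvcl : v ∈ I.M.closure (C : Set (Fin n)) := by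
    rw [hC.closure_eq]; exact hE {v} rfl
  have hcirc : I.M.IsCircuit (I.M.fundCircuit v C) :=
    hC.indep.fundCircuit_isCircuit hvcl (by simpa using hvC)
  have hvK : v ∈ I.M.fundCircuit v C := I.M.mem_fundCircuit v C
  -- Otherwise `v`, which is spanned by the rest of its fundamental circuit, would be spanned by `B`
  -- without `v`. Any `u` of the circuit outside this closure serves both exchanges.
  have h1 : ¬ (I.M.fundCircuit v C \ {v}) ⊆ I.M.closure ((B : Set (Fin n)) \ {v}) := by
    intro hsub
    have h2 := hcirc.mem_closure_sdiff_singleton_of_mem hvK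
    have h3 := I.M.closure_subset_closure_of_subset_closure hsub h2
    exact hB.indep.notMem_closure_sdiff_of_mem (by simpa using hvB) h3
  obtain ⟨u, ⟨huK, huv⟩, hucl⟩ := Set.not_subset.1 h1
  have huv' : u ≠ v := huv
  have huC : u ∈ C := by
    have := I.M.fundCircuit_subset_insert v (C : Set (Fin n)) huK
    simpa [huv'] using this
  have huB : u ∉ B := fun h => hucl <|
    I.M.subset_closure _ (hE _) ⟨by simpa using h, huv⟩
  refine ⟨u, huC, huB, ?_, ?_⟩
  · have h4 := (hC.indep.mem_fundCircuit_iff hvcl (by simpa using hvC)).1 huK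
    have e : (insert v (C : Set (Fin n)) \ {u}) =
        ((insert v (C.erase u) : Finset (Fin n)) : Set _) := by
      ext i
      simp only [Set.mem_sdiff, Set.mem_insert_iff, Finset.mem_coe, Set.mem_singleton_iff,
        Finset.coe_insert, Finset.coe_erase]
      constructor
      · tauto
      · rintro (rfl | h)
        · exact ⟨Or.inl rfl, huv'.symm⟩
        · tauto
    rw [Feasible, ← e]
    exact h4
  · have h5 : I.M.Indep ((B : Set (Fin n)) \ {v}) := hB.indep.subset Set.sdiff_subset
    have h6 := (h5.notMem_closure_iff (by rw [I.ground]; trivial)).1 hucl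
    rw [Feasible, Finset.coe_insert, Finset.coe_erase]
    exact h6.1

variable (I) in
/-- Every independent set can be replaced by an independent superset of `B` without losing positive
weight. -/
def Dominates (c : Fin n → ℝ) (B : Finset (Fin n)) : Prop :=
  ∀ S, I.Feasible S → ∃ T, I.Feasible T ∧ B ⊆ T ∧ ∑ u ∈ S, max (c u) 0 ≤ ∑ u ∈ T, max (c u) 0

theorem dominates_empty (c : Fin n → ℝ) : I.Dominates c ∅ := fun S hS =>
  ⟨S, hS, Finset.empty_subset S, le_rfl⟩

/-- Extend `B + b` to a basis `J` of `T + b`. It is at least as large as `T`, so it gains `b` and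
loses at most one element `a`. As `B + a ⊆ T` is independent, `a` competed with `b` in the greedy
choice. -/
theorem Dominates.insert {c : Fin n → ℝ} {B : Finset (Fin n)} (h : I.Dominates c B) {b : Fin n}
    (hb : b ∉ B) (hf : I.Feasible (insert b B))
    (hmax : ∀ u, u ∉ B → I.Feasible (Insert.insert u B) → c u ≤ c b) :
    I.Dominates c (Insert.insert b B) := by
  intro S hS
  obtain ⟨T, hT, hBT, hle⟩ := h S hS
  by_cases hbT : b ∈ T
  · exact ⟨T, hT, Finset.insert_subset hbT hBT, hle⟩
  have hsub : ((Insert.insert b B : Finset (Fin n)) : Set (Fin n)) ⊆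
        (Insert.insert b T : Finset (Fin n)) := by
    exact_mod_cast Finset.insert_subset_insert b hBT
  obtain ⟨J, hJ, hBJ⟩ := Matroid.Indep.subset_isBasis_of_subset hf hsub
    (by rw [I.ground]; exact Set.subset_univ _)
  have hJfin : J.Finite := Set.toFinite J
  lift J to Finset (Fin n) using hJfin
  have hJsub : J ⊆ Insert.insert b T := by exact_mod_cast hJ.subset
  have hBJ' : Insert.insert b B ⊆ J := by exact_mod_cast hBJ
  have hcard : T.card ≤ J.card := by
    obtain ⟨J', hJ', hTJ'⟩ := Matroid.Indep.subset_isBasis_of_subset hT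
      (Finset.coe_subset.2 (Finset.subset_insert b T)) (by rw [I.ground]; exact Set.subset_univ _)
    have := (Set.encard_le_encard hTJ').trans_eq (hJ'.encard_eq_encard hJ)
    simpa using this
  have hJf : I.Feasible J := hJ.indep
  refine ⟨J, hJf, hBJ', hle.trans ?_⟩
  have hbJ : b ∈ J := hBJ' (Finset.mem_insert_self _ _)
  have hsd : (T \ J).card ≤ 1 := by
    have h1 : T \ J = (Insert.insert b T) \ J := by
      ext i; simp only [Finset.mem_sdiff, Finset.mem_insert]
      constructor
      · tauto
      · rintro ⟨rfl | h, h2⟩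
        · exact absurd hbJ h2
        · exact ⟨h, h2⟩
    rw [h1, Finset.card_sdiff_of_subset hJsub, Finset.card_insert_of_notMem hbT]
    omega
  have hJT : J.erase b ⊆ T := fun i hi => by
    have := hJsub (Finset.mem_of_mem_erase hi)
    simpa [Finset.ne_of_mem_erase hi] using this
  have hsum : ∑ u ∈ J, max (c u) 0 = max (c b) 0 + ∑ u ∈ J.erase b, max (c u) 0 :=
    (Finset.add_sum_erase _ _ hbJ).symm
  have hsum2 : ∑ u ∈ T, max (c u) 0 = ∑ u ∈ T \ J, max (c u) 0 + ∑ u ∈ J.erase b, max (c u) 0 := by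
    rw [← Finset.sum_sdiff hJT]
    congr 1
    refine Finset.sum_congr ?_ fun _ _ => rfl
    ext i
    simp only [Finset.mem_sdiff, Finset.mem_erase]
    constructor
    · exact fun ⟨h1, h2⟩ => ⟨h1, fun h3 => h2 ⟨fun h4 => hbT (h4 ▸ h1), h3⟩⟩
    · exact fun ⟨h1, h2⟩ => ⟨h1, fun h3 => h2 h3.2⟩
  rw [hsum, hsum2]
  gcongr
  obtain ⟨a, ha⟩ := (have : Nonempty (Fin n) := ⟨b⟩; Finset.card_le_one_iff_subset_singleton.1 hsd)
  rcases Finset.subset_singleton_iff.1 ha with h0 | h0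
  · rw [h0]; simp
  · rw [h0, Finset.sum_singleton]
    have haT : a ∈ T \ J := by rw [h0]; simp
    have haB : a ∉ B := fun h => (Finset.mem_sdiff.1 haT).2 (hBJ' (Finset.mem_insert_of_mem h))
    gcongr
    exact hmax a haB (hT.subset (Finset.insert_subset (Finset.mem_sdiff.1 haT).1 hBT))

/-- The only independent set that contains a base is the base itself, so the dominating set is `B`.
-/
theorem Dominates.sum_le {c : Fin n → ℝ} {B : Finset (Fin n)} (h : I.Dominates c B)
    (hB : I.Base B) {S : Finset (Fin n)} (hS : I.Feasible S) :
    ∑ u ∈ S, c u ≤ ∑ u ∈ B.filter fun u => 0 < c u, c u := by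
  obtain ⟨T, hT, hBT, hle⟩ := h S hS
  obtain rfl := hB.eq_of_subset hT hBT
  refine (Finset.sum_le_sum fun u _ => le_max_left (c u) 0).trans (hle.trans (le_of_eq ?_))
  rw [Finset.sum_filter]
  refine Finset.sum_congr rfl fun u _ => ?_
  split_ifs with h
  · exact max_eq_left h.le
  · exact max_eq_right (not_lt.1 h)

end MatroidInstance

/-! ### Expectations under discrete distributions. -/

theorem tsum_pmf_pure_mul {α : Type*} (a : α) (g : α → ℝ≥0∞) :
    ∑' b, PMF.pure a b * g b = g a := by
  rw [tsum_eq_single a fun b hb => by simp [PMF.pure_apply, hb]]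
  simp

theorem tsum_pmf_bind_mul {α β : Type*} (p : PMF α) (q : α → PMF β) (g : β → ℝ≥0∞) :
    ∑' b, p.bind q b * g b = ∑' a, p a * ∑' b, q a b * g b := by
  simp only [PMF.bind_apply, ← ENNReal.tsum_mul_right, ← ENNReal.tsum_mul_left, mul_assoc]
  exact ENNReal.tsum_comm

theorem tsum_pmf_map_mul {α β : Type*} (p : PMF α) (h : α → β) (g : β → ℝ≥0∞) :
    ∑' b, p.map h b * g b = ∑' a, p a * g (h a) := by
  rw [← PMF.bind_pure_comp, tsum_pmf_bind_mul]
  simp only [Function.comp, tsum_pmf_pure_mul]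

/-! ### A quantitative program logic -/

section Logic

variable {n : ℕ} (I : MatroidInstance n)

open Classical in
/-- The expectation of `φ` of the memory after `T` steps, where runs that have not halted count
as `0`. -/
noncomputable def haltValue (φ : Store → ℝ≥0∞) : ℕ → Config → ℝ≥0∞
  | 0, c => if c.1 = [] then φ c.2 else 0
  | T + 1, c => ∑' d, step I c d * haltValue φ T d

theorem haltValue_nil (φ : Store → ℝ≥0∞) (T : ℕ) (σ : Store) :
    haltValue I φ T ([], σ) = φ σ := by
  induction T with
  | zero => simp [haltValue]
  | succ T ih => rw [haltValue, step, tsum_pmf_pure_mul, ih]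

theorem haltValue_mono_succ (φ : Store → ℝ≥0∞) (T : ℕ) (c : Config) :
    haltValue I φ T c ≤ haltValue I φ (T + 1) c := by
  induction T generalizing c with
  | zero =>
    obtain ⟨K, σ⟩ := c
    by_cases h : K = []
    · subst h
      rw [haltValue_nil, haltValue_nil]
    · simp [haltValue, h]
  | succ T ih =>
    rw [haltValue, haltValue]
    exact ENNReal.tsum_le_tsum fun d => mul_le_mul_right (ih d) _

theorem haltValue_mono (φ : Store → ℝ≥0∞) (c : Config) {S T : ℕ} (h : S ≤ T) :
    haltValue I φ S c ≤ haltValue I φ T c :=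
  monotone_nat_of_le_succ (fun T => haltValue_mono_succ I φ T c) h

/-- This links the forward distribution `run` with the backward expectation `haltValue`; the case `S
= 0` transfers what the logic proves to the machine. -/
theorem tsum_run_mul_haltValue (φ : Store → ℝ≥0∞) (Q : Program) (T S : ℕ) :
    ∑' c, run I Q T c * haltValue I φ S c = haltValue I φ (T + S) ([Q], Store.init n) := by
  induction T generalizing S with
  | zero => rw [run, tsum_pmf_pure_mul, Nat.zero_add]
  | succ T ih =>
    rw [run, tsum_pmf_bind_mul]
    have := ih (S + 1)
    simp only [haltValue] at this
    rw [this, Nat.add_assoc, Nat.add_comm 1 S]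
    rfl

/-- Started in `σ`, the program `c` halts within `t` steps in a state that satisfies `Q`, and the
expectation of `W` in the final state is at least `v`. -/
def Tri (c : Program) (t : ℕ) (σ : Store) (Q : Store → Prop) (W : Store → ℝ) (v : ℝ) : Prop :=
  ∀ (φ : Store → ℝ≥0∞) (K : List Program) (T : ℕ),
    (∀ σ', Q σ' → ENNReal.ofReal (W σ') ≤ haltValue I φ T (K, σ')) →
      ENNReal.ofReal v ≤ haltValue I φ (T + t) (c :: K, σ)

/-- Started in `σ`, the program `c` halts within `t` steps in a state that satisfies `Q`. -/
def Hoare (c : Program) (t : ℕ) (σ : Store) (Q : Store → Prop) : Prop :=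
  ∀ v : ℝ, Tri I c t σ Q (fun _ => v) v

variable {I}

theorem Tri.conseq {c : Program} {t t' : ℕ} {σ : Store} {Q Q' : Store → Prop} {W W' : Store → ℝ}
    {v v' : ℝ} (h : Tri I c t σ Q W v) (ht : t ≤ t') (hQ : ∀ σ', Q σ' → Q' σ' ∧ W σ' ≤ W' σ')
    (hv : v' ≤ v) : Tri I c t' σ Q' W' v' := fun φ K T hT =>
  (ENNReal.ofReal_le_ofReal hv).trans <| (h φ K T fun σ' hσ' =>
    (ENNReal.ofReal_le_ofReal (hQ σ' hσ').2).trans (hT σ' (hQ σ' hσ').1)).trans <|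
      haltValue_mono I φ _ (Nat.add_le_add_left ht T)

theorem Hoare.conseq {c : Program} {t t' : ℕ} {σ : Store} {Q Q' : Store → Prop}
    (h : Hoare I c t σ Q) (ht : t ≤ t') (hQ : ∀ σ', Q σ' → Q' σ') : Hoare I c t' σ Q' := fun v =>
  (h v).conseq ht (fun σ' hσ' => ⟨hQ σ' hσ', le_rfl⟩) le_rfl

theorem Hoare.tri {c : Program} {t : ℕ} {σ : Store} {Q : Store → Prop} (h : Hoare I c t σ Q)
    {W : Store → ℝ} {v : ℝ} (hW : ∀ σ', Q σ' → v ≤ W σ') : Tri I c t σ Q W v :=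
  (h v).conseq le_rfl (fun σ' hσ' => ⟨hσ', hW σ' hσ'⟩) le_rfl

/-- Triples quantify over the continuation, so composition is the first triple used with `d :: K`.
The extra step unfolds `seq`. -/
theorem Tri.seq {c d : Program} {s t : ℕ} {σ : Store} {Q Q' : Store → Prop} {W W' : Store → ℝ}
    {v : ℝ} (hc : Tri I c s σ Q W v) (hd : ∀ σ', Q σ' → Tri I d t σ' Q' W' (W σ')) :
    Tri I (.seq c d) (s + t + 1) σ Q' W' v := by
  intro φ K T hT
  rw [← Nat.add_assoc, haltValue, step, tsum_pmf_pure_mul, ← Nat.add_assoc, Nat.add_right_comm]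
  exact hc φ (d :: K) (T + t) fun σ' hσ' => hd σ' hσ' φ K T hT

theorem Hoare.seq_tri {c d : Program} {s t : ℕ} {σ : Store} {Q Q' : Store → Prop} {W' : Store → ℝ}
    {v : ℝ} (hc : Hoare I c s σ Q) (hd : ∀ σ', Q σ' → Tri I d t σ' Q' W' v) :
    Tri I (.seq c d) (s + t + 1) σ Q' W' v := (hc v).seq hd

theorem Hoare.seq {c d : Program} {s t : ℕ} {σ : Store} {Q Q' : Store → Prop}
    (hc : Hoare I c s σ Q) (hd : ∀ σ', Q σ' → Hoare I d t σ' Q') :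
    Hoare I (.seq c d) (s + t + 1) σ Q' := fun v => (hc v).seq fun σ' hσ' => hd σ' hσ' v

theorem tri_skip {t : ℕ} {σ : Store} {Q : Store → Prop} {W : Store → ℝ} {v : ℝ} (hQ : Q σ)
    (hW : v ≤ W σ) : Tri I .skip (t + 1) σ Q W v := by
  intro φ K T hT
  rw [← Nat.add_assoc, haltValue, step, tsum_pmf_pure_mul]
  exact (ENNReal.ofReal_le_ofReal hW).trans
    ((hT _ hQ).trans (haltValue_mono I φ _ (Nat.le_add_right T t)))

theorem tri_setNat {t a : ℕ} {i j x : NatExpr} {σ : Store} {Q : Store → Prop} {W : Store → ℝ}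
    {v : ℝ} (hQ : Q (σ.writeNat (a, i.eval σ, j.eval σ) (x.eval σ)))
    (hW : v ≤ W (σ.writeNat (a, i.eval σ, j.eval σ) (x.eval σ))) :
    Tri I (.setNat a i j x) (t + 1) σ Q W v := by
  intro φ K T hT
  rw [← Nat.add_assoc, haltValue, step, tsum_pmf_pure_mul]
  exact (ENNReal.ofReal_le_ofReal hW).trans
    ((hT _ hQ).trans (haltValue_mono I φ _ (Nat.le_add_right T t)))

theorem tri_setReal {t a : ℕ} {i j : NatExpr} {x : RealExpr} {σ : Store} {Q : Store → Prop}
    {W : Store → ℝ} {v : ℝ} (hQ : Q (σ.writeReal (a, i.eval σ, j.eval σ) (x.eval σ)))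
    (hW : v ≤ W (σ.writeReal (a, i.eval σ, j.eval σ) (x.eval σ))) :
    Tri I (.setReal a i j x) (t + 1) σ Q W v := by
  intro φ K T hT
  rw [← Nat.add_assoc, haltValue, step, tsum_pmf_pure_mul]
  exact (ENNReal.ofReal_le_ofReal hW).trans
    ((hT _ hQ).trans (haltValue_mono I φ _ (Nat.le_add_right T t)))

theorem tri_setNat_seq {t a : ℕ} {i j x : NatExpr} {d : Program} {σ : Store} {Q : Store → Prop}
    {W : Store → ℝ} {v : ℝ}
    (h : Tri I d t (σ.writeNat (a, i.eval σ, j.eval σ) (x.eval σ)) Q W v) :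
    Tri I (.seq (.setNat a i j x) d) (t + 2) σ Q W v := by
  intro φ K T hT
  rw [← Nat.add_assoc, haltValue, step, tsum_pmf_pure_mul, haltValue, step, tsum_pmf_pure_mul]
  exact h φ K T hT

theorem tri_value_seq {t a : ℕ} {i j : NatExpr} {s : ℕ} {r : NatExpr} {d : Program} {σ : Store}
    {Q : Store → Prop} {W : Store → ℝ} {v : ℝ}
    (h : Tri I d t (σ.writeReal (a, i.eval σ, j.eval σ) (I.f (σ.row n s (r.eval σ)))) Q W v) :
    Tri I (.seq (.value a i j s r) d) (t + 2) σ Q W v := by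
  intro φ K T hT
  rw [← Nat.add_assoc, haltValue, step, tsum_pmf_pure_mul, haltValue, step, tsum_pmf_pure_mul]
  exact h φ K T hT

theorem tri_member_seq {t a : ℕ} {i j : NatExpr} {s : ℕ} {r : NatExpr} {d : Program} {σ : Store}
    {Q : Store → Prop} {W : Store → ℝ} {v : ℝ}
    (h1 : I.Feasible (σ.row n s (r.eval σ)) →
      Tri I d t (σ.writeNat (a, i.eval σ, j.eval σ) 1) Q W v)
    (h0 : ¬ I.Feasible (σ.row n s (r.eval σ)) →
      Tri I d t (σ.writeNat (a, i.eval σ, j.eval σ) 0) Q W v) :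
    Tri I (.seq (.member a i j s r) d) (t + 2) σ Q W v := by
  intro φ K T hT
  rw [← Nat.add_assoc, haltValue, step, tsum_pmf_pure_mul, haltValue, step, tsum_pmf_pure_mul]
  split_ifs with h
  · exact h1 h φ K T hT
  · exact h0 h φ K T hT

theorem tri_random {a : ℕ} {i j x : NatExpr} {σ : Store} {Q : Store → Prop} {W : Store → ℝ} {v : ℝ}
    (hQ : ∀ r ≤ x.eval σ, Q (σ.writeNat (a, i.eval σ, j.eval σ) r))
    (hW : v * (x.eval σ + 1) ≤ ∑ r ∈ Finset.range (x.eval σ + 1),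
      W (σ.writeNat (a, i.eval σ, j.eval σ) r)) :
    Tri I (.random a i j x) 1 σ Q W v := by
  intro φ K T hT
  rw [haltValue, step, tsum_pmf_map_mul]
  have h1 : ∑ r : Fin (x.eval σ + 1), (PMF.uniformOfFintype (Fin (x.eval σ + 1))) r *
      ENNReal.ofReal (W (σ.writeNat (a, i.eval σ, j.eval σ) r)) ≤
      ∑' r : Fin (x.eval σ + 1), (PMF.uniformOfFintype (Fin (x.eval σ + 1))) r *
        haltValue I φ T (K, σ.writeNat (a, i.eval σ, j.eval σ) r) := by
    rw [tsum_fintype]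
    exact Finset.sum_le_sum fun r _ =>
      mul_le_mul_right (hT _ (hQ r (Nat.lt_succ_iff.1 r.2))) _
  change _ ≤ ∑' r, (PMF.bind (PMF.uniformOfFintype (Fin (x.eval σ + 1)))
    fun r => PMF.pure (r : ℕ)) r * haltValue I φ T (K, σ.writeNat (a, i.eval σ, j.eval σ) r)
  rw [tsum_pmf_bind_mul]
  simp only [tsum_pmf_pure_mul]
  refine le_trans ?_ h1
  simp only [PMF.uniformOfFintype_apply, Fintype.card_fin]
  rw [← Finset.mul_sum, Fin.sum_univ_eq_sum_range
    (fun r => ENNReal.ofReal (W (σ.writeNat (a, i.eval σ, j.eval σ) r)))]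
  set m := x.eval σ
  have hm : ((m + 1 : ℕ) : ℝ≥0∞) = ENNReal.ofReal (m + 1 : ℝ) := by
    rw [← Nat.cast_succ, ENNReal.ofReal_natCast]
  rw [hm, ← ENNReal.div_eq_inv_mul, ENNReal.le_div_iff_mul_le
    (Or.inl (by simp; positivity)) (Or.inl ENNReal.ofReal_ne_top),
    ← ENNReal.ofReal_mul' (by positivity)]
  -- `W` may be negative and `ENNReal.ofReal` truncates it at `0`; subadditivity still goes in the
  -- direction needed for a lower bound.
  exact (ENNReal.ofReal_le_ofReal hW).trans (Finset.le_sum_of_subadditive ENNReal.ofReal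
    ENNReal.ofReal_zero.le (fun _ _ => ENNReal.ofReal_add_le) _ _)

theorem tri_cond {b : Test} {c d : Program} {t : ℕ} {σ : Store} {Q : Store → Prop} {W : Store → ℝ}
    {v : ℝ} (hc : b.holds σ → Tri I c t σ Q W v) (hd : ¬ b.holds σ → Tri I d t σ Q W v) :
    Tri I (.cond b c d) (t + 1) σ Q W v := by
  intro φ K T hT
  rw [← Nat.add_assoc, haltValue, step, tsum_pmf_pure_mul]
  by_cases h : b.holds σ
  · rw [if_pos h]; exact hc h φ K T hT
  · rw [if_neg h]; exact hd h φ K T hT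

theorem tri_loop_step {b : Test} {c : Program} {t s : ℕ} {σ : Store} {Q Q' : Store → Prop}
    {W W' : Store → ℝ} {v : ℝ} (hb : b.holds σ) (hc : Tri I c t σ Q W v)
    (hl : ∀ σ', Q σ' → Tri I (.loop b c) s σ' Q' W' (W σ')) :
    Tri I (.loop b c) (t + s + 1) σ Q' W' v := by
  intro φ K T hT
  rw [← Nat.add_assoc, haltValue, step, tsum_pmf_pure_mul, if_pos hb, Nat.add_comm t s,
    ← Nat.add_assoc]
  exact hc φ (.loop b c :: K) (T + s) fun σ' hσ' => hl σ' hσ' φ K T hT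

theorem tri_loop_end {b : Test} {c : Program} {σ : Store} {Q : Store → Prop}
    {W : Store → ℝ} {v : ℝ} (hb : ¬ b.holds σ) (hQ : Q σ) (hW : v ≤ W σ) :
    Tri I (.loop b c) 1 σ Q W v := by
  intro φ K T hT
  rw [haltValue, step, tsum_pmf_pure_mul, if_neg hb]
  exact (ENNReal.ofReal_le_ofReal hW).trans (hT _ hQ)

end Logic

/-! ### Counting loops. -/

/-- The natural number variable `a`. -/
abbrev nvar (a : ℕ) : NatExpr := .read a (.const 0) (.const 0)

/-- The entry of the natural number array `a` whose index is the variable `u`. -/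
abbrev nent (a u : ℕ) : NatExpr := .read a (.const 0) (nvar u)

/-- Assign to the natural number variable `a`. -/
abbrev setVar (a : ℕ) (x : NatExpr) : Program := .setNat a (.const 0) (.const 0) x

/-- Assign to the entry of the array `a` whose index is the variable `u`. -/
abbrev setEnt (a u : ℕ) (x : NatExpr) : Program := .setNat a (.const 0) (nvar u) x

/-- `for i in 0 .. m - 1 do c`. -/
def forLoop (i : ℕ) (m : NatExpr) (c : Program) : Program :=
  .seq (setVar i (.const 0))
    (.loop (.natLT (nvar i) m) (.seq c (setVar i (.add (nvar i) (.const 1)))))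

section ForLoop

variable {n : ℕ} {I : MatroidInstance n}

/-- The family `W j` plays the role of a submartingale: each round preserves its lower bound in
expectation. A round costs a test, an unfolding and an increment besides the body; the outer `3` are
the unfolding, the initialization and the last test. -/
theorem tri_forLoop {i : ℕ} {m : NatExpr} {c : Program} {N t : ℕ} (Inv : ℕ → Store → Prop)
    (W : ℕ → Store → ℝ) (hInv : ∀ j σ v, Inv j σ → Inv j (σ.writeNat (i, 0, 0) v))
    (hW : ∀ j σ v, Inv j σ → W j σ ≤ W j (σ.writeNat (i, 0, 0) v))
    (hm : ∀ j σ, Inv j σ → m.eval σ = N)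
    (hbody : ∀ j σ, j < N → Inv j σ → σ.nat (i, 0, 0) = j →
      Tri I c t σ (fun σ' => σ'.nat (i, 0, 0) = j ∧ Inv (j + 1) σ') (W (j + 1)) (W j σ))
    {σ : Store} (h0 : Inv 0 σ) :
    Tri I (forLoop i m c) (N * (t + 3) + 3) σ (Inv N) (W N) (W 0 σ) := by
  have key : ∀ k j σ, j + k = N → Inv j σ → σ.nat (i, 0, 0) = j →
      Tri I (.loop (.natLT (nvar i) m) (.seq c (setVar i (.add (nvar i) (.const 1)))))
        (k * (t + 3) + 1) σ (Inv N) (W N) (W j σ) := by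
    intro k
    induction k with
    | zero =>
      intro j σ hj hI hi
      obtain rfl : j = N := by omega
      refine (tri_loop_end ?_ hI le_rfl).conseq (by omega) (fun σ' h => ⟨h, le_rfl⟩) le_rfl
      simp [Test.holds, NatExpr.eval, hi, hm _ _ hI]
    | succ k ih =>
      intro j σ hj hI hi
      refine (tri_loop_step (t := t + 1 + 1) (s := k * (t + 3) + 1)
        (Q := fun σ' => σ'.nat (i, 0, 0) = j + 1 ∧ Inv (j + 1) σ') (W := W (j + 1)) ?_ ?_ ?_).conseq
        (by ring_nf; omega) (fun σ' h => ⟨h, le_rfl⟩) le_rfl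
      · simp [Test.holds, NatExpr.eval, hi, hm _ _ hI]; omega
      · refine (hbody j σ (by omega) hI hi).seq fun σ' hσ' => tri_setNat ?_ ?_
        · refine ⟨by simp [Store.writeNat, NatExpr.eval, hσ'.1], ?_⟩
          simpa [NatExpr.eval] using hInv (j + 1) σ' _ hσ'.2
        · simpa [NatExpr.eval] using hW (j + 1) σ' _ hσ'.2
      · intro σ' hσ'
        exact ih (j + 1) σ' (by omega) hσ'.2 hσ'.1
  refine (Tri.seq (s := 1) (t := N * (t + 3) + 1)
    (Q := fun σ' => σ'.nat (i, 0, 0) = 0 ∧ Inv 0 σ') (W := W 0) (tri_setNat ?_ ?_) ?_).conseq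
    (by omega) (fun σ' h => ⟨h, le_rfl⟩) le_rfl
  · refine ⟨by simp [Store.writeNat, NatExpr.eval], ?_⟩
    simpa [NatExpr.eval] using hInv 0 σ _ h0
  · simpa [NatExpr.eval] using hW 0 σ _ h0
  · intro σ' hσ'
    exact key N 0 σ' (by omega) hσ'.2 hσ'.1

theorem hoare_forLoop {i : ℕ} {m : NatExpr} {c : Program} {N t : ℕ} (Inv : ℕ → Store → Prop)
    (hInv : ∀ j σ v, Inv j σ → Inv j (σ.writeNat (i, 0, 0) v))
    (hm : ∀ j σ, Inv j σ → m.eval σ = N)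
    (hbody : ∀ j σ, j < N → Inv j σ → σ.nat (i, 0, 0) = j →
      Hoare I c t σ (fun σ' => σ'.nat (i, 0, 0) = j ∧ Inv (j + 1) σ'))
    {σ : Store} (h0 : Inv 0 σ) :
    Hoare I (forLoop i m c) (N * (t + 3) + 3) σ (Inv N) := fun v =>
  tri_forLoop Inv (fun _ _ => v) hInv (fun _ _ _ _ => le_rfl) hm
    (fun j σ hj h hi => hbody j σ hj h hi v) h0

end ForLoop

/-! ### Memory -/

namespace Store

@[simp] theorem nat_writeNat (σ : Store) (p q : ℕ × ℕ × ℕ) (v : ℕ) :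
    (σ.writeNat p v).nat q = if q = p then v else σ.nat q := by
  simp [writeNat, Function.update_apply]

@[simp] theorem nat_writeReal (σ : Store) (p q : ℕ × ℕ × ℕ) (v : ℝ) :
    (σ.writeReal p v).nat q = σ.nat q := rfl

@[simp] theorem real_writeNat (σ : Store) (p q : ℕ × ℕ × ℕ) (v : ℕ) :
    (σ.writeNat p v).real q = σ.real q := rfl

@[simp] theorem real_writeReal (σ : Store) (p q : ℕ × ℕ × ℕ) (v : ℝ) :
    (σ.writeReal p v).real q = if q = p then v else σ.real q := by
  simp [writeReal, Function.update_apply]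

theorem mem_row {σ : Store} {n s r : ℕ} {u : Fin n} :
    u ∈ σ.row n s r ↔ σ.nat (s, r, (u : ℕ)) ≠ 0 := by
  simp [row]

@[simp] theorem row_writeReal (σ : Store) (n s r : ℕ) (p : ℕ × ℕ × ℕ) (v : ℝ) :
    (σ.writeReal p v).row n s r = σ.row n s r := rfl

@[simp] theorem row_writeNat_of_ne (σ : Store) (n r : ℕ) {s : ℕ} {p : ℕ × ℕ × ℕ}
    (h : s ≠ p.1) (v : ℕ) :
    (σ.writeNat p v).row n s r = σ.row n s r := by
  ext u
  rw [mem_row, mem_row, nat_writeNat, if_neg]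
  rintro rfl
  exact h rfl

@[simp] theorem row_writeNat_self (σ : Store) {n : ℕ} (s r : ℕ) (u : Fin n) (v : ℕ) :
    (σ.writeNat (s, r, (u : ℕ)) v).row n s r =
      if v = 0 then (σ.row n s r).erase u else insert u (σ.row n s r) := by
  ext w
  rw [mem_row, nat_writeNat]
  by_cases hw : w = u
  · subst hw
    by_cases hv : v = 0 <;> simp [hv]
  · have hw' : (w : ℕ) ≠ u := fun h => hw (Fin.ext h)
    by_cases hv : v = 0 <;> simp [hv, hw, hw', mem_row]

/-- The stores differ at most in the arrays `S` of natural numbers and the arrays `R` of real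
numbers. -/
def Same (S R : List ℕ) (σ τ : Store) : Prop :=
  (∀ a, a ∉ S → ∀ i j, τ.nat (a, i, j) = σ.nat (a, i, j)) ∧
    ∀ a, a ∉ R → ∀ i j, τ.real (a, i, j) = σ.real (a, i, j)

theorem Same.refl (S R : List ℕ) (σ : Store) : Same S R σ σ := ⟨by simp, by simp⟩

theorem Same.trans {S R : List ℕ} {σ τ υ : Store} (h : Same S R σ τ) (h' : Same S R τ υ) :
    Same S R σ υ :=
  ⟨fun a ha i j => (h'.1 a ha i j).trans (h.1 a ha i j),
    fun a ha i j => (h'.2 a ha i j).trans (h.2 a ha i j)⟩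

theorem Same.mono {S R S' R' : List ℕ} {σ τ : Store} (h : Same S R σ τ) (hS : S ⊆ S')
    (hR : R ⊆ R') : Same S' R' σ τ :=
  ⟨fun a ha => h.1 a fun h' => ha (hS h'), fun a ha => h.2 a fun h' => ha (hR h')⟩

theorem Same.writeNat {S R : List ℕ} {σ τ : Store} (h : Same S R σ τ) {p : ℕ × ℕ × ℕ}
    (hp : p.1 ∈ S) (v : ℕ) : Same S R σ (τ.writeNat p v) := by
  refine ⟨fun a ha i j => ?_, h.2⟩
  rw [nat_writeNat, if_neg, h.1 a ha]
  rintro rfl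
  exact ha hp

theorem Same.writeReal {S R : List ℕ} {σ τ : Store} (h : Same S R σ τ) {p : ℕ × ℕ × ℕ}
    (hp : p.1 ∈ R) (v : ℝ) : Same S R σ (τ.writeReal p v) := by
  refine ⟨h.1, fun a ha i j => ?_⟩
  rw [real_writeReal, if_neg, h.2 a ha]
  rintro rfl
  exact ha hp

theorem Same.row {S R : List ℕ} {σ τ : Store} (h : Same S R σ τ) {s : ℕ} (hs : s ∉ S) (n r : ℕ) :
    τ.row n s r = σ.row n s r := by
  ext u
  rw [mem_row, mem_row, h.1 s hs]

end Store

/-! ### Rules for assignments and biased coins. -/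

section Rules

variable {n : ℕ} {I : MatroidInstance n}

theorem tri_setVar_seq {a : ℕ} {x : NatExpr} {y t : ℕ} {d : Program} {σ : Store}
    {Q : Store → Prop} {W : Store → ℝ} {v : ℝ} (hx : x.eval σ = y)
    (h : Tri I d t (σ.writeNat (a, 0, 0) y) Q W v) :
    Tri I (.seq (setVar a x) d) (t + 2) σ Q W v :=
  tri_setNat_seq (by subst hx; exact h)

theorem tri_setEnt_seq {a u : ℕ} {x : NatExpr} {y j t : ℕ} {d : Program} {σ : Store}
    {Q : Store → Prop} {W : Store → ℝ} {v : ℝ} (hu : σ.nat (u, 0, 0) = j) (hx : x.eval σ = y)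
    (h : Tri I d t (σ.writeNat (a, 0, j) y) Q W v) :
    Tri I (.seq (setEnt a u x) d) (t + 2) σ Q W v :=
  tri_setNat_seq (by subst hx hu; exact h)

theorem tri_setVar {a : ℕ} {x : NatExpr} {y t : ℕ} {σ : Store}
    {Q : Store → Prop} {W : Store → ℝ} {v : ℝ} (hx : x.eval σ = y)
    (hQ : Q (σ.writeNat (a, 0, 0) y)) (hW : v ≤ W (σ.writeNat (a, 0, 0) y)) :
    Tri I (setVar a x) (t + 1) σ Q W v :=
  tri_setNat (by subst hx; exact hQ) (by subst hx; exact hW)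

theorem tri_setEnt {a u : ℕ} {x : NatExpr} {y j t : ℕ} {σ : Store}
    {Q : Store → Prop} {W : Store → ℝ} {v : ℝ} (hu : σ.nat (u, 0, 0) = j) (hx : x.eval σ = y)
    (hQ : Q (σ.writeNat (a, 0, j) y)) (hW : v ≤ W (σ.writeNat (a, 0, j) y)) :
    Tri I (setEnt a u x) (t + 1) σ Q W v :=
  tri_setNat (by subst hx hu; exact hQ) (by subst hx hu; exact hW)

/-- With probability `y / (x + 1)` do `c`, otherwise do `d`. -/
def coin (a : ℕ) (x y : NatExpr) (c d : Program) : Program :=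
  .seq (.random a (.const 0) (.const 0) x) (.cond (.natLT (nvar a) y) c d)

theorem sum_range_ite_lt {k m : ℕ} (h : k ≤ m) (a b : ℝ) :
    ∑ r ∈ Finset.range m, (if r < k then a else b) = k * a + (m - k) * b := by
  rw [Finset.sum_ite, Finset.sum_const, Finset.sum_const]
  have h1 : (Finset.range m).filter (· < k) = Finset.range k := by ext i; simp; omega
  have h2 : (Finset.range m).filter (fun i => ¬ i < k) = Finset.Ico k m := by ext i; simp; omega
  rw [h1, h2]
  simp [Nat.cast_sub h]

theorem tri_coin {a : ℕ} {x y : NatExpr} {c d : Program} {m k t : ℕ} {σ : Store}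
    {Q : Store → Prop} {W : Store → ℝ} {v₁ v₂ v : ℝ} (hx : x.eval σ + 1 = m) (hk : k ≤ m)
    (hy : ∀ r, y.eval (σ.writeNat (a, 0, 0) r) = k)
    (hc : ∀ r, r < k → Tri I c t (σ.writeNat (a, 0, 0) r) Q W v₁)
    (hd : ∀ r, Tri I d t (σ.writeNat (a, 0, 0) r) Q W v₂)
    (hv : v ≤ (k : ℝ) / m * v₁ + (1 - (k : ℝ) / m) * v₂) :
    Tri I (coin a x y c d) (t + 3) σ Q W v := by
  have hm : (0 : ℝ) < m := by rw [← hx]; positivity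
  refine (Tri.seq (s := 1) (t := t + 1) (Q := fun τ => ∃ r, τ = σ.writeNat (a, 0, 0) r)
    (W := fun τ => if τ.nat (a, 0, 0) < k then v₁ else v₂) (tri_random ?_ ?_) ?_).conseq
    (by omega) (fun _ h => ⟨h, le_rfl⟩) le_rfl
  · exact fun r _ => ⟨r, rfl⟩
  · simp only [NatExpr.eval, Store.nat_writeNat, if_true]
    have hx' : (x.eval σ : ℝ) + 1 = m := by exact_mod_cast hx
    rw [hx, sum_range_ite_lt hk, hx']
    calc v * m ≤ ((k : ℝ) / m * v₁ + (1 - (k : ℝ) / m) * v₂) * m := by gcongr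
      _ = _ := by field_simp
  · rintro τ ⟨r, rfl⟩
    simp only [Store.nat_writeNat, if_true]
    refine tri_cond (fun h => ?_) (fun h => ?_) <;>
      simp only [Test.holds, NatExpr.eval, Store.nat_writeNat, if_true, hy] at h
    · rw [if_pos h]; exact hc r h
    · rw [if_neg h]; exact hd r

end Rules

/-! ### The program

Arrays of natural numbers: `0` holds `n`; row `0` of `1`, `2`, `3`, `4`, `5` describes the current
solution `A`, the base `C` that contains it, the base `B` of maximum weight, its part `P` of
positive weight, and a random sample `R`. Variables: `6` the number `L` of steps, `7` the time `K`,
`8` the product `K * L`; the others are counters and temporary. Arrays of real numbers: row `0` of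
`0` accumulates the weights. -/

/-- The real number variable `a`. -/
abbrev rvar (a : ℕ) : RealExpr := .read a (.const 0) (.const 0)

/-- The entry of the real number array `a` whose index is the variable `u`. -/
abbrev rent (a u : ℕ) : RealExpr := .read a (.const 0) (nvar u)

/-- Set row `a` to the empty set. -/
def clearRow (a : ℕ) : Program := forLoop 12 (nvar 0) (setEnt a 12 (.const 0))

/-- Find in `14` an element of maximum weight that can be added to row `3`; if there is none, then
`14` holds `n`. -/
def findHeaviest : Program :=
  .seq (setVar 14 (nvar 0)) <| forLoop 12 (nvar 0) <|
    .cond (.natLT (.const 0) (nent 3 12)) .skip <|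
      .seq (setEnt 3 12 (.const 1)) <| .seq (.member 15 (.const 0) (.const 0) 3 (.const 0)) <|
        .seq (setEnt 3 12 (.const 0)) <| .cond (.natLT (.const 0) (nvar 15))
          (.cond (.natLT (nvar 14) (nvar 0))
            (.cond (.realLT (rent 0 14) (rent 0 12)) (setVar 14 (nvar 12)) .skip)
            (setVar 14 (nvar 12)))
          .skip

/-- Compute in row `3` a base of maximum positive weight. -/
def greedyBase : Program :=
  .seq (clearRow 3) <| forLoop 19 (nvar 0) <| .seq findHeaviest <|
    .cond (.natLT (nvar 14) (nvar 0)) (setEnt 3 14 (.const 1)) .skip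

/-- Copy row `3` to row `2`. -/
def copyBase : Program :=
  forLoop 12 (nvar 0) (setEnt 2 12 (nent 3 12))

/-- Sample in row `5` a subset of row `1`, keeping each element with probability `K / L`. -/
def sample : Program :=
  forLoop 12 (nvar 0) <| .seq (setEnt 5 12 (.const 0)) <|
    .cond (.natLT (.const 0) (nent 1 12))
      (coin 16 (.sub (nvar 6) (.const 1)) (nvar 7) (setEnt 5 12 (.const 1)) .skip) .skip

/-- Add the marginal values with respect to the sample to the weights. -/
def accumulate : Program :=
  .seq (.value 1 (.const 0) (.const 0) 5 (.const 0)) <| forLoop 12 (nvar 0) <|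
    .seq (setVar 18 (nent 5 12)) <| .seq (setEnt 5 12 (.const 1)) <|
      .seq (.value 2 (.const 0) (.const 0) 5 (.const 0)) <| .seq (setEnt 5 12 (nvar 18)) <|
        .setReal 0 (.const 0) (nvar 12) (.add (rent 0 12) (.sub (rvar 2) (rvar 1)))

/-- Set all weights to zero. -/
def clearWeights : Program :=
  forLoop 12 (nvar 0) <| .setReal 0 (.const 0) (nvar 12) (.sub (rent 0 12) (rent 0 12))

/-- Sum the marginal values over `L` independent samples. -/
def estimateWeights : Program :=
  .seq clearWeights <| forLoop 11 (nvar 6) <| .seq sample accumulate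

/-! ### Correctness of the greedy base, the samples and the weights. -/

section Specs

open Store

variable {n : ℕ} {I : MatroidInstance n}

theorem hoare_clearRow {σ : Store} (hn : σ.nat (0, 0, 0) = n) {a : ℕ} (h0 : a ≠ 0)
    (h12 : a ≠ 12) : Hoare I (clearRow a) (n * 4 + 3) σ
      (fun τ => Same [a, 12] [] σ τ ∧ τ.row n a 0 = ∅) := by
  refine (hoare_forLoop (t := 1) (N := n)
    (fun j τ => Same [a, 12] [] σ τ ∧ ∀ u : Fin n, (u : ℕ) < j → u ∉ τ.row n a 0) ?_ ?_ ?_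
    ⟨Same.refl _ _ _, by simp⟩).conseq le_rfl fun τ hτ => ⟨hτ.1, Finset.eq_empty_of_forall_notMem
      fun u => hτ.2 u u.2⟩
  · rintro j τ v ⟨h1, h2⟩
    exact ⟨h1.writeNat (by simp) _, by simpa [h12] using h2⟩
  · rintro j τ ⟨h1, -⟩
    simp only [NatExpr.eval]
    rw [h1.1 0 (by simp [h0.symm]), hn]
  · rintro j τ hj ⟨h1, h2⟩ hi v
    refine tri_setEnt (t := 0) (y := 0) hi rfl
        ⟨by simp [h12.symm, hi], h1.writeNat (by simp) _, ?_⟩ le_rfl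
    obtain ⟨w, rfl⟩ : ∃ w : Fin n, (w : ℕ) = j := ⟨⟨j, hj⟩, rfl⟩
    intro u hu
    rw [row_writeNat_self, if_pos rfl, Finset.mem_erase]
    rintro ⟨h3, h4⟩
    refine h2 u ?_ h4
    have : (u : ℕ) ≠ w := fun h => h3 (Fin.ext h)
    omega

/-- The weight of `u` in the memory. -/
def weight (σ : Store) {n : ℕ} (u : Fin n) : ℝ := σ.real (0, 0, (u : ℕ))

theorem Store.Same.weight {S R : List ℕ} {σ τ : Store} (h : Same S R σ τ) (h0 : 0 ∉ R)
    (u : Fin n) : SubmodMax.weight τ u = SubmodMax.weight σ u := h.2 0 h0 _ _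

theorem hoare_findHeaviest {σ : Store} (hn : σ.nat (0, 0, 0) = n) :
    Hoare I findHeaviest (n * (14 + 3) + 5) σ (fun τ => Same [3, 12, 14, 15] [] σ τ ∧
      τ.row n 3 0 = σ.row n 3 0 ∧
      ((τ.nat (14, 0, 0) = n ∧ ∀ u, u ∉ σ.row n 3 0 → ¬ I.Feasible (insert u (σ.row n 3 0))) ∨
        ∃ b : Fin n, τ.nat (14, 0, 0) = b ∧ b ∉ σ.row n 3 0 ∧
          I.Feasible (insert b (σ.row n 3 0)) ∧ ∀ u, u ∉ σ.row n 3 0 →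
            I.Feasible (insert u (σ.row n 3 0)) → weight σ u ≤ weight σ b)) := by
  set B := σ.row n 3 0 with hB
  intro v
  refine tri_setVar_seq (t := n * (14 + 3) + 3) (y := n) (by simpa [NatExpr.eval] using hn) ?_
  refine (hoare_forLoop (t := 14) (N := n) (fun j τ => Same [3, 12, 14, 15] [] σ τ ∧
      τ.row n 3 0 = B ∧
      ((τ.nat (14, 0, 0) = n ∧ ∀ u : Fin n, (u : ℕ) < j → u ∉ B → ¬ I.Feasible (insert u B)) ∨
        ∃ b : Fin n, τ.nat (14, 0, 0) = b ∧ b ∉ B ∧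
          I.Feasible (insert b B) ∧ ∀ u : Fin n, (u : ℕ) < j → u ∉ B →
            I.Feasible (insert u B) → weight σ u ≤ weight σ b)) ?_ ?_ ?_
        ⟨(Same.refl _ _ _).writeNat (by simp) _, by simp [hB], by simp⟩).conseq le_rfl ?_ v
  · rintro j τ v ⟨h1, h2, h3⟩
    exact ⟨h1.writeNat (by simp) _, by simpa using h2, by simpa using h3⟩
  · rintro j τ ⟨h1, -⟩
    simp only [NatExpr.eval]
    rw [h1.1 0 (by simp), hn]
  · rintro j τ hj ⟨h1, h2, h3⟩ hi v
    obtain ⟨w, rfl⟩ : ∃ w : Fin n, (w : ℕ) = j := ⟨⟨j, hj⟩, rfl⟩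
    have hn' : τ.nat (0, 0, 0) = n := by rw [h1.1 0 (by simp), hn]
    have hwB : w ∈ B ↔ τ.nat (3, 0, (w : ℕ)) ≠ 0 := by rw [← h2, mem_row]
    have hlt : ∀ u : Fin n, (u : ℕ) < w + 1 → (u : ℕ) < w ∨ u = w := fun u hu => by
      rcases Nat.lt_succ_iff_lt_or_eq.1 hu with h | h
      · exact Or.inl h
      · exact Or.inr (Fin.ext h)
    refine tri_cond (fun hb => ?_) fun hb => ?_
    · have hw : w ∈ B := by
        rw [hwB]; simp [Test.holds, NatExpr.eval, hi] at hb; omega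
      refine tri_skip (t := 12) ⟨hi, h1, h2, ?_⟩ le_rfl
      rcases h3 with ⟨h3, h4⟩ | ⟨b, h3, h4, h5, h6⟩
      · refine Or.inl ⟨h3, fun u hu huB => ?_⟩
        rcases hlt u hu with h | rfl
        · exact h4 u h huB
        · exact absurd hw huB
      · refine Or.inr ⟨b, h3, h4, h5, fun u hu huB => ?_⟩
        rcases hlt u hu with h | rfl
        · exact h6 u h huB
        · exact absurd hw huB
    · have hw : w ∉ B := by
        rw [hwB]; simp [Test.holds, NatExpr.eval, hi] at hb; omega
      have hBe : B.erase w = B := Finset.erase_eq_of_notMem hw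
      refine tri_setEnt_seq (t := 11) (j := w) (y := 1) hi rfl ?_
      refine tri_member_seq (t := 9) (fun hf => ?_) (fun hf => ?_) <;>
        simp only [NatExpr.eval, row_writeNat_self, h2, one_ne_zero, if_false] at hf ⊢
      · refine tri_setEnt_seq (t := 7) (j := w) (y := 0) (by simp [hi]) rfl ?_
        refine tri_cond (fun _ => ?_) (fun hb => ?_)
        swap
        · simp [Test.holds, NatExpr.eval] at hb
        -- Shared by the two ways in which `w` becomes the candidate: it is the first element that
        -- can be added, or it is heavier than the previous candidate. The test insertion of `w` has
        -- been undone by then.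
        have hnew : ∀ ρ : Store, ρ = (((τ.writeNat (3, 0, (w : ℕ)) 1).writeNat (15, 0, 0) 1).writeNat
            (3, 0, (w : ℕ)) 0).writeNat (14, 0, 0) w →
            (∀ u : Fin n, (u : ℕ) < w → u ∉ B → I.Feasible (insert u B) → weight σ u ≤ weight σ w) →
            ρ.nat (12, 0, 0) = w ∧ Same [3, 12, 14, 15] [] σ ρ ∧
            ρ.row n 3 0 = B ∧
            ((ρ.nat (14, 0, 0) = n ∧ ∀ u : Fin n, (u : ℕ) < w + 1 → u ∉ B →
              ¬ I.Feasible (insert u B)) ∨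
            ∃ b : Fin n, ρ.nat (14, 0, 0) = b ∧ b ∉ B ∧
              I.Feasible (insert b B) ∧ ∀ u : Fin n, (u : ℕ) < w + 1 → u ∉ B →
              I.Feasible (insert u B) → weight σ u ≤ weight σ b) := by
          rintro ρ rfl hmax
          refine ⟨by simp [hi], ?_, by simp [h2, Finset.erase_insert_eq_erase, hBe], ?_⟩
          · repeat refine Same.writeNat ?_ (by simp) _
            exact h1
          · refine Or.inr ⟨w, by simp, hw, hf, fun u hu huB huF => ?_⟩
            rcases hlt u hu with h | rfl
            · exact hmax u h huB huF
            · exact le_rfl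
        refine tri_cond (fun hb => ?_) fun hb => ?_
        · simp only [Test.holds, NatExpr.eval, nat_writeNat, Prod.mk.injEq] at hb
          simp [hn'] at hb
          rcases h3 with ⟨h3, h4⟩ | ⟨b, h3, h4, h5, h6⟩
          · omega
          refine tri_cond (fun hb => ?_) fun hb => ?_
          · simp [Test.holds, RealExpr.eval, NatExpr.eval, hi, h3] at hb
            refine tri_setVar (t := 3) (y := w) (by simp [NatExpr.eval, hi]) (hnew _ rfl ?_) le_rfl
            intro u hu huB huF
            have e := h6 u hu huB huF
            rw [← h1.weight (by simp) b] at e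
            rw [← h1.weight (by simp) w]
            exact e.trans hb.le
          · simp [Test.holds, RealExpr.eval, NatExpr.eval, hi, h3] at hb
            refine tri_skip (t := 3)
                ⟨by simp [hi], ?_, by simp [h2, Finset.erase_insert_eq_erase, hBe],
              Or.inr ⟨b, by simp [h3], h4, h5, ?_⟩⟩ le_rfl
            · repeat refine Same.writeNat ?_ (by simp) _
              exact h1
            · intro u hu huB huF
              rcases hlt u hu with h | rfl
              · exact h6 u h huB huF
              · rw [← h1.weight (by simp) b, ← h1.weight (by simp) u]
                exact hb
        · simp only [Test.holds, NatExpr.eval, nat_writeNat, Prod.mk.injEq] at hb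
          simp [hn'] at hb
          rcases h3 with ⟨h3, h4⟩ | ⟨b, h3, h4, h5, h6⟩
          · exact tri_setVar (t := 4) (y := w) (by simp [NatExpr.eval, hi]) (hnew _ rfl
              fun u hu huB huF => absurd huF (h4 u hu huB)) le_rfl
          · have := b.2
            omega
      · refine tri_setEnt_seq (t := 7) (j := w) (y := 0) (by simp [hi]) rfl ?_
        refine tri_cond (fun hb => ?_) (fun _ => ?_)
        · simp [Test.holds, NatExpr.eval] at hb
        refine tri_skip (t := 5) ⟨by simp [hi], ?_, by simp [h2, Finset.erase_insert_eq_erase, hBe],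
          ?_⟩ le_rfl
        · repeat refine Same.writeNat ?_ (by simp) _
          exact h1
        · simp only [nat_writeNat, Prod.mk.injEq]
          rcases h3 with ⟨h3, h4⟩ | ⟨b, h3, h4, h5, h6⟩
          · refine Or.inl ⟨by simp [h3], fun u hu huB => ?_⟩
            rcases hlt u hu with h | rfl
            · exact h4 u h huB
            · exact hf
          · refine Or.inr ⟨b, by simp [h3], h4, h5, fun u hu huB huF => ?_⟩
            rcases hlt u hu with h | rfl
            · exact h6 u h huB huF
            · exact absurd huF hf
  · rintro τ ⟨h1, h2, h3⟩
    refine ⟨h1, h2, ?_⟩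
    rcases h3 with ⟨h3, h4⟩ | ⟨b, h3, h4, h5, h6⟩
    · exact Or.inl ⟨h3, fun u => h4 u u.2⟩
    · exact Or.inr ⟨b, h3, h4, h5, fun u => h6 u u.2⟩

end Specs

section Specs

open Store

variable {n : ℕ} {I : MatroidInstance n}

/-- After `j` rounds the row has at least `j` elements or is already a base, so `n` rounds suffice.
Elements of negative weight are added too, since merging needs a whole base. -/
theorem hoare_greedyBase {σ : Store} (hn : σ.nat (0, 0, 0) = n) :
    Hoare I greedyBase (n * (n * 17 + 8 + 3) + n * 4 + 7) σ (fun τ =>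
      Same [3, 12, 14, 15, 19] [] σ τ ∧ I.Base (τ.row n 3 0) ∧
        I.Dominates (weight σ) (τ.row n 3 0)) := by
  refine ((hoare_clearRow hn (a := 3) (by simp) (by simp)).seq (t := n * (n * 17 + 8 + 3) + 3)
    fun σ₁ h₁ => ?_).conseq (by omega) fun _ h => h
  have hw₁ : ∀ u : Fin n, weight σ₁ u = weight σ u := h₁.1.weight (by simp)
  refine (hoare_forLoop (N := n) (t := n * 17 + 8) (fun j τ => Same [3, 12, 14, 15, 19] [] σ τ ∧
    I.Feasible (τ.row n 3 0) ∧ I.Dominates (weight σ) (τ.row n 3 0) ∧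
      (j ≤ (τ.row n 3 0).card ∨ I.Base (τ.row n 3 0))) ?_ ?_ ?_ ?_).conseq le_rfl ?_
  · rintro j τ v ⟨h1, h2⟩
    exact ⟨h1.writeNat (by simp) _, by simpa using h2⟩
  · rintro j τ ⟨h1, -⟩
    simp only [NatExpr.eval]
    rw [h1.1 0 (by simp), hn]
  · rintro j τ hj ⟨h1, h2, h3, h4⟩ hi
    have hnτ : τ.nat (0, 0, 0) = n := by rw [h1.1 0 (by simp), hn]
    refine ((hoare_findHeaviest hnτ).seq (t := 2) fun ρ ⟨g1, g2, g3⟩ => ?_).conseq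
      (by omega) fun _ h => h
    have hS : Same [3, 12, 14, 15, 19] [] σ ρ :=
      h1.trans (g1.mono (by simp) (by simp))
    have hnρ : ρ.nat (0, 0, 0) = n := by rw [hS.1 0 (by simp), hn]
    have hiρ : ρ.nat (19, 0, 0) = j := by rw [g1.1 19 (by simp), hi]
    intro v
    rcases g3 with ⟨g3, g4⟩ | ⟨b, g3, g4, g5, g6⟩
    · refine tri_cond (t := 1) (fun hb => ?_) (fun _ => tri_skip (t := 0) ⟨hiρ, hS, ?_⟩ le_rfl)
      · simp [Test.holds, NatExpr.eval, g3, hnρ] at hb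
      · rw [g2]
        exact ⟨h2, h3, Or.inr (MatroidInstance.base_of_maximal h2 g4)⟩
    · refine tri_cond (t := 1) (fun _ => ?_) (fun hb => ?_)
      swap
      · simp [Test.holds, NatExpr.eval, g3, hnρ] at hb
      refine tri_setEnt (t := 0) (j := b) (y := 1) g3 rfl
          ⟨by simp [hiρ], hS.writeNat (by simp) _, ?_⟩ le_rfl
      rw [row_writeNat_self, if_neg one_ne_zero, g2]
      refine ⟨g5, h3.insert g4 g5 fun u hu huF => ?_, Or.inl ?_⟩
      · have := g6 u hu huF
        rwa [h1.weight (by simp), h1.weight (by simp)] at this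
      · rw [Finset.card_insert_of_notMem g4]
        rcases h4 with h4 | h4
        · omega
        · have := h4.eq_of_subset g5 (Finset.subset_insert _ _)
          exact absurd (this ▸ Finset.mem_insert_self b _) g4
  · refine ⟨h₁.1.mono (by simp) (by simp), ?_⟩
    rw [h₁.2]
    exact ⟨I.feasible_empty, MatroidInstance.dominates_empty _, by simp⟩
  · rintro τ ⟨h1, h2, h3, h4⟩
    refine ⟨h1, ?_, h3⟩
    rcases h4 with h4 | h4
    · have h5 : τ.row n 3 0 = Finset.univ := by
        apply Finset.eq_univ_of_card
        rw [Fintype.card_fin]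
        exact le_antisymm (card_finset_fin_le _) h4
      refine MatroidInstance.base_of_maximal h2 fun u hu => ?_
      rw [h5] at hu
      exact absurd (Finset.mem_univ u) hu
    · exact h4

theorem hoare_copyBase {σ : Store} (hn : σ.nat (0, 0, 0) = n) :
    Hoare I copyBase (n * 4 + 3) σ (fun τ => Same [2, 12] [] σ τ ∧ τ.row n 2 0 = σ.row n 3 0) := by
  refine (hoare_forLoop (t := 1) (N := n) (fun j τ => Same [2, 12] [] σ τ ∧
    ∀ u : Fin n, (u : ℕ) < j → (u ∈ τ.row n 2 0 ↔ u ∈ σ.row n 3 0)) ?_ ?_ ?_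
      ⟨Same.refl _ _ _, by simp⟩).conseq le_rfl fun τ hτ => ⟨hτ.1, Finset.ext fun u => hτ.2 u u.2⟩
  · rintro j τ v ⟨h1, h2⟩
    exact ⟨h1.writeNat (by simp) _, by simpa using h2⟩
  · rintro j τ ⟨h1, -⟩
    simp only [NatExpr.eval]
    rw [h1.1 0 (by simp), hn]
  · rintro j τ hj ⟨h1, h2⟩ hi v
    obtain ⟨w, rfl⟩ : ∃ w : Fin n, (w : ℕ) = j := ⟨⟨j, hj⟩, rfl⟩
    refine tri_setEnt (t := 0) hi rfl ⟨by simp [hi], h1.writeNat (by simp) _, fun u hu => ?_⟩ le_rfl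
    simp only [NatExpr.eval, hi]
    by_cases huw : u = w
    · subst huw
      rw [mem_row, nat_writeNat, if_pos rfl, mem_row, h1.1 3 (by simp)]
    · have : (u : ℕ) ≠ w := fun h => huw (Fin.ext h)
      rw [mem_row, nat_writeNat, if_neg (by simp [this]), ← mem_row]
      exact h2 u (by omega)

/-- The vector with value `p` on `A` and `0` elsewhere. -/
def scaled {α : Type*} [DecidableEq α] (p : ℝ) (A : Finset α) (u : α) : ℝ :=
  if u ∈ A then p else 0

theorem scaled_mem {α : Type*} [DecidableEq α] {p : ℝ} (h0 : 0 ≤ p) (h1 : p ≤ 1) (A : Finset α)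
    (u : α) : scaled p A u ∈ Set.Icc (0 : ℝ) 1 := by
  unfold scaled
  split_ifs
  · exact ⟨h0, h1⟩
  · exact ⟨le_rfl, zero_le_one⟩

/-- Reveal the coordinates one at a time. In `z`, decided coordinates are `0` or `1` and the others
keep their probability; as the extension is affine in each coordinate, each coin flip preserves its
expectation. -/
theorem tri_sample {σ : Store} (hn : σ.nat (0, 0, 0) = n) {L K : ℕ} (hL : σ.nat (6, 0, 0) = L)
    (hK : σ.nat (7, 0, 0) = K) (hL0 : 0 < L) (hKL : K ≤ L) (g : Finset (Fin n) → ℝ) :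
    Tri I sample (n * 10 + 3) σ (fun τ => Same [5, 12, 16] [] σ τ) (fun τ => g (τ.row n 5 0))
      (mlext g (scaled ((K : ℝ) / L) (σ.row n 1 0))) := by
  set A := σ.row n 1 0 with hA
  set z : ℕ → Store → Fin n → ℝ := fun j τ u =>
    if (u : ℕ) < j then (if u ∈ τ.row n 5 0 then 1 else 0) else scaled ((K : ℝ) / L) A u with hz
  have hz0 : z 0 σ = scaled ((K : ℝ) / L) A := by ext u; simp [hz]
  have hzn : ∀ τ, mlext g (z n τ) = g (τ.row n 5 0) := fun τ => by
    rw [← mlext_indicator g]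
    congr 1
    ext u
    simp [hz]
  have hupd : ∀ (w : Fin n) (τ ρ : Store), (∀ u, u ≠ w → (u ∈ ρ.row n 5 0 ↔ u ∈ τ.row n 5 0)) →
      z (w + 1) ρ = Function.update (z w τ) w (if w ∈ ρ.row n 5 0 then 1 else 0) := by
    intro w τ ρ h
    ext u
    by_cases hu : u = w
    · subst hu; simp [hz]
    · have hne : (u : ℕ) ≠ w := fun h => hu (Fin.ext h)
      have : (u : ℕ) < w + 1 ↔ (u : ℕ) < w := by omega
      simp only [hz, Function.update_of_ne hu, this, h u hu]
  have hzw : ∀ (w : Fin n) (τ : Store), z w τ w = scaled ((K : ℝ) / L) A w := fun w τ => by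
    simp [hz]
  rw [← hz0]
  refine (tri_forLoop (N := n) (t := 7) (fun _ τ => Same [5, 12, 16] [] σ τ)
    (fun j τ => mlext g (z j τ)) ?_ ?_ ?_ ?_ (Same.refl _ _ _)).conseq le_rfl
      (fun τ h => ⟨h, (hzn τ).le⟩) le_rfl
  · exact fun j τ v h => h.writeNat (by simp) _
  · intro j τ v _
    simp [hz]
  · intro j τ h
    simp only [NatExpr.eval]
    rw [h.1 0 (by simp), hn]
  · intro j τ hj h hi
    obtain ⟨w, rfl⟩ : ∃ w : Fin n, (w : ℕ) = j := ⟨⟨j, hj⟩, rfl⟩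
    have hwA : w ∈ A ↔ τ.nat (1, 0, (w : ℕ)) ≠ 0 := by rw [hA, mem_row, h.1 1 (by simp)]
    refine tri_setEnt_seq (t := 5) (y := 0) hi rfl ?_
    refine tri_cond (t := 4) (fun hb => ?_) fun hb => ?_
    · have hw : w ∈ A := by
        rw [hwA]; simp [Test.holds, NatExpr.eval, hi] at hb; omega
      refine tri_coin (t := 1) (m := L) (k := K)
        (v₁ := mlext g (Function.update (z w τ) w 1)) (v₂ := mlext g (Function.update (z w τ) w 0))
        ?_ hKL ?_ (fun r _ => ?_) (fun r => ?_) ?_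
      · simp [NatExpr.eval, h.1 6, hL]; omega
      · intro r; simp [NatExpr.eval, h.1 7, hK]
      · refine tri_setEnt (t := 0) (j := w) (y := 1) (by simp [hi]) rfl ⟨by simp [hi], ?_⟩ ?_
        · repeat refine Same.writeNat ?_ (by simp) _
          exact h
        · refine le_of_eq ?_
          rw [hupd w τ]
          · simp
          · intro u hu; simp [hu]
      · refine tri_skip (t := 0) ⟨by simp [hi], ?_⟩ ?_
        · repeat refine Same.writeNat ?_ (by simp) _
          exact h
        · refine le_of_eq ?_
          rw [hupd w τ]
          · simp
          · intro u hu; simp [hu]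
      · rw [← mlext_update_convex]
        have : (K : ℝ) / L * 1 + (1 - (K : ℝ) / L) * 0 = z w τ w := by
          rw [hzw]; simp [scaled, hw]
        rw [this, Function.update_eq_self]
    · have hw : w ∉ A := by
        rw [hwA]; simp [Test.holds, NatExpr.eval, hi] at hb; omega
      refine tri_skip (t := 3) ⟨by simp [hi], h.writeNat (by simp) _⟩ (le_of_eq ?_)
      rw [hupd w τ]
      · have : (0 : ℝ) = z w τ w := by rw [hzw]; simp [scaled, hw]
        simp only [row_writeNat_self, if_true, Finset.notMem_erase, if_false]
        rw [this, Function.update_eq_self]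
      · intro u hu; simp [hu]

theorem hoare_accumulate {σ : Store} (hn : σ.nat (0, 0, 0) = n) :
    Hoare I accumulate (n * 12 + 5) σ (fun τ => Same [5, 12, 18] [0, 1, 2] σ τ ∧
      ∀ u : Fin n, weight τ u =
        weight σ u + (I.f (insert u (σ.row n 5 0)) - I.f (σ.row n 5 0))) := by
  set R := σ.row n 5 0 with hR
  intro v
  refine tri_value_seq (t := n * 12 + 3) ?_
  refine (hoare_forLoop (N := n) (t := 9) (fun j τ => Same [5, 12, 18] [0, 1, 2] σ τ ∧
    τ.row n 5 0 = R ∧ τ.real (1, 0, 0) = I.f R ∧ ∀ u : Fin n, weight τ u =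
        weight σ u + if (u : ℕ) < j then I.f (insert u R) - I.f R else 0) ?_ ?_ ?_
      ⟨(Same.refl _ _ _).writeReal (by simp) _, by simp [hR], by simp [NatExpr.eval, hR],
        by simp [weight, NatExpr.eval]⟩).conseq le_rfl ?_ v
  · rintro j τ v ⟨h1, h2, h3, h4⟩
    exact ⟨h1.writeNat (by simp) _, by simpa using h2, h3, h4⟩
  · rintro j τ ⟨h1, -⟩
    simp only [NatExpr.eval]
    rw [h1.1 0 (by simp), hn]
  · rintro j τ hj ⟨h1, h2, h3, h4⟩ hi v
    obtain ⟨w, rfl⟩ : ∃ w : Fin n, (w : ℕ) = j := ⟨⟨j, hj⟩, rfl⟩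
    -- The old entry is saved because `w` may already belong to the sample, so erasing it afterwards
    -- would be wrong.
    refine tri_setVar_seq (t := 7) (y := τ.nat (5, 0, (w : ℕ))) (by simp [NatExpr.eval, hi]) ?_
    refine tri_setEnt_seq (t := 5) (j := w) (y := 1) (by simp [hi]) rfl ?_
    refine tri_value_seq (t := 3) ?_
    refine tri_setEnt_seq (t := 1) (j := w) (y := τ.nat (5, 0, (w : ℕ))) (by simp [hi])
      (by simp [NatExpr.eval]) ?_
    refine tri_setReal (t := 0) ⟨by simp [hi], ?_, ?_, ?_, ?_⟩ le_rfl
    · repeat first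
        | exact h1
        | refine Same.writeNat ?_ (by simp) _
        | refine Same.writeReal ?_ (by simp) _
    · ext u
      rw [← h2]
      simp only [mem_row, nat_writeNat, nat_writeReal]
      by_cases huw : (u : ℕ) = w <;> simp [huw]
    · simp [h3, NatExpr.eval]
    · intro u
      have h4u := h4 u
      by_cases huw : u = w
      · subst huw
        simp [weight, NatExpr.eval, RealExpr.eval, hi, h2, h3] at h4u ⊢
        rw [h4u]
      · have hne : (u : ℕ) ≠ w := fun h => huw (Fin.ext h)
        have hlt : (u : ℕ) < w + 1 ↔ (u : ℕ) < w := by omega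
        simp only [hlt]
        rw [← h4u]
        simp [weight, NatExpr.eval, hi, hne]
  · rintro τ ⟨h1, -, -, h4⟩
    exact ⟨h1, fun u => by rw [h4 u, if_pos u.2]⟩

theorem hoare_clearWeights {σ : Store} (hn : σ.nat (0, 0, 0) = n) :
    Hoare I clearWeights (n * 4 + 3) σ
      (fun τ => Same [12] [0] σ τ ∧ ∀ u : Fin n, weight τ u = 0) := by
  refine (hoare_forLoop (t := 1) (N := n) (fun j τ => Same [12] [0] σ τ ∧
    ∀ u : Fin n, (u : ℕ) < j → weight τ u = 0) ?_ ?_ ?_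
      ⟨Same.refl _ _ _, by simp⟩).conseq le_rfl fun τ hτ => ⟨hτ.1, fun u => hτ.2 u u.2⟩
  · rintro j τ v ⟨h1, h2⟩
    exact ⟨h1.writeNat (by simp) _, h2⟩
  · rintro j τ ⟨h1, -⟩
    simp only [NatExpr.eval]
    rw [h1.1 0 (by simp), hn]
  · rintro j τ hj ⟨h1, h2⟩ hi v
    obtain ⟨w, rfl⟩ : ∃ w : Fin n, (w : ℕ) = j := ⟨⟨j, hj⟩, rfl⟩
    refine tri_setReal (t := 0) ⟨by simp [hi], h1.writeReal (by simp) _, fun u hu => ?_⟩ le_rfl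
    by_cases huw : u = w
    · subst huw
      simp [weight, NatExpr.eval, RealExpr.eval, hi]
    · have hne : (u : ℕ) ≠ w := fun h => huw (Fin.ext h)
      have := h2 u (by omega)
      simpa [weight, NatExpr.eval, hi, hne] using this

/-- The samples estimate the expected marginal values with a small expected squared error. -/
theorem tri_estimateWeights {σ : Store} (hn : σ.nat (0, 0, 0) = n) {L K : ℕ}
    (hL : σ.nat (6, 0, 0) = L) (hK : σ.nat (7, 0, 0) = K) (hL0 : 0 < L) (hKL : K ≤ L)
    {x : Fin n → ℝ} (hx : x = scaled ((K : ℝ) / L) (σ.row n 1 0)) {D : Finset (Fin n)} {V : ℝ}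
    (hV : ∀ u ∈ D, ∀ R ⊆ σ.row n 1 0, |I.f (insert u R) - I.f R| ≤ V) (a c : ℝ) (hc : 0 ≤ c) :
    Tri I estimateWeights (L * (n * 22 + 12) + n * 4 + 7) σ
      (fun τ => Same [5, 11, 12, 16, 18] [0, 1, 2] σ τ)
      (fun τ => a - c * ∑ u ∈ D, (weight τ u - L * marginal I.f x u) ^ 2)
      (a - c * (D.card * (L * V ^ 2))) := by
  have hp0 : (0 : ℝ) ≤ (K : ℝ) / L := by positivity
  have hp1 : (K : ℝ) / L ≤ 1 := by
    rw [div_le_one (by exact_mod_cast hL0)]; exact_mod_cast hKL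
  have hx01 : ∀ i, x i ∈ Set.Icc (0 : ℝ) 1 := fun i => hx ▸ scaled_mem hp0 hp1 _ i
  have hxs : ∀ i, i ∉ σ.row n 1 0 → x i = 0 := fun i hi => by rw [hx]; simp [scaled, hi]
  refine ((hoare_clearWeights hn).seq_tri (t := L * (n * 22 + 9 + 3) + 3) fun σ₁ h₁ => ?_).conseq
    (by ring_nf; omega) (fun τ h => ⟨h, le_rfl⟩) le_rfl
  refine (tri_forLoop (N := L) (t := n * 22 + 9)
    (fun _ τ => Same [5, 11, 12, 16, 18] [0, 1, 2] σ τ)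
    -- A reserve of `V²` for each outstanding sample turns the accumulation of variances into a
    -- quantity whose expectation does not decrease.
    (fun j τ => a - c * ∑ u ∈ D, ((weight τ u - j * marginal I.f x u) ^ 2 + (L - j) * V ^ 2))
    ?_ ?_ ?_ ?_ (h₁.1.mono (by simp) (by simp))).conseq le_rfl
      (fun τ h => ⟨h, le_of_eq ?_⟩) (le_of_eq ?_)
  · exact fun j τ v h => h.writeNat (by simp) _
  · exact fun j τ v _ => le_of_eq rfl
  · intro j τ h
    simp only [NatExpr.eval]
    rw [h.1 6 (by simp), hL]
  · intro j τ hj h hi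
    have hrow : τ.row n 1 0 = σ.row n 1 0 := h.row (by simp) n 0
    refine (Tri.seq (s := n * 10 + 3) (t := n * 12 + 5)
      (Q := fun ρ => Same [5, 12, 16] [] τ ρ)
      (W := fun ρ => a - c * ∑ u ∈ D, ((weight τ u +
        (I.f (insert u (ρ.row n 5 0)) - I.f (ρ.row n 5 0)) - (j + 1) * marginal I.f x u) ^ 2 +
          (L - (j + 1)) * V ^ 2))
      ((tri_sample (by rw [h.1 0 (by simp), hn]) (L := L) (K := K) (by rw [h.1 6 (by simp), hL])
        (by rw [h.1 7 (by simp), hK]) hL0 hKL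
        (fun R => a - c * ∑ u ∈ D, ((weight τ u +
          (I.f (insert u R) - I.f R) - (j + 1) * marginal I.f x u) ^ 2 +
            (L - (j + 1)) * V ^ 2))).conseq le_rfl (fun ρ h => ⟨h, le_rfl⟩) ?_)
      fun ρ hρ => ?_).conseq (by omega) (fun τ h => ⟨h, le_rfl⟩) le_rfl
    · rw [hrow, ← hx, mlext_sub, mlext_const, mlext_const_mul, mlext_sum]
      gcongr with u hu
      set w := marginal I.f x u with hw
      -- With `Y` the deviation so far and `X` the new marginal value of mean `w`, the mean of `(Y +
      -- X - w)²` is `Y² + E X² - w² ≤ Y² + V²`.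
      have e1 : ∀ R : Finset (Fin n), (weight τ u + (I.f (insert u R) - I.f R) - (j + 1) * w) ^ 2 +
          (L - (j + 1)) * V ^ 2 =
          ((weight τ u - j * w) ^ 2 - 2 * (weight τ u - j * w) * w + w ^ 2 + (L - (j + 1)) * V ^ 2) +
          ((2 * (weight τ u - j * w) - 2 * w) * (I.f (insert u R) - I.f R) +
            (I.f (insert u R) - I.f R) ^ 2) := fun R => by ring
      simp only [e1]
      rw [mlext_add, mlext_const, mlext_add, mlext_const_mul, mlext_sub]
      have e2 : mlext (fun R => (I.f (insert u R) - I.f R) ^ 2) x ≤ V ^ 2 := by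
        rw [← mlext_const (V ^ 2) x]
        refine mlext_mono_support hx01 hxs fun R hR => ?_
        rw [← sq_abs]
        exact pow_le_pow_left₀ (abs_nonneg _) (hV u hu R hR) 2
      have e3 : mlext (fun R => I.f (insert u R)) x - mlext I.f x = w := rfl
      have e4 : mlext (fun S => I.f S) x = mlext I.f x := rfl
      rw [e4, e3]
      nlinarith [sq_nonneg w]
    · have hτρ := hρ
      refine (hoare_accumulate (by rw [hρ.1 0 (by simp), h.1 0 (by simp), hn])).tri
        (W := fun υ => a - c * ∑ u ∈ D, ((weight υ u - ((j + 1 : ℕ) : ℝ) * marginal I.f x u) ^ 2 +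
          (L - ((j + 1 : ℕ) : ℝ)) * V ^ 2)) (fun υ hυ => le_of_eq ?_) |>.conseq le_rfl
            (fun υ hυ => ⟨⟨?_, ?_⟩, le_rfl⟩) le_rfl
      · push_cast
        congr 2
        refine Finset.sum_congr rfl fun u _ => ?_
        rw [hυ.2 u, hρ.weight (by simp) u]
      · rw [hυ.1.1 11 (by simp), hρ.1 11 (by simp), hi]
      · exact h.trans ((hρ.mono (by simp) (by simp)).trans (hυ.1.mono (by simp) (by simp)))
  · simp
  · simp [h₁.2]

end Specs

/-! ### Merging two bases by random exchanges. -/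

/-- Put the elements of positive weight of row `3` into row `4`. -/
def positivePart : Program :=
  forLoop 12 (nvar 0) <| .seq (setEnt 4 12 (.const 0)) <|
    .cond (.natLT (.const 0) (nent 3 12))
      (.cond (.realLT (.sub (rvar 3) (rvar 3)) (rent 0 12)) (setEnt 4 12 (.const 1)) .skip) .skip

/-- Resample the membership in row `1` of the common elements of rows `2` and `3`. -/
def updateCommon : Program :=
  forLoop 12 (nvar 0) <| .cond (.natLT (.const 0) (nent 3 12))
    (.cond (.natLT (.const 0) (nent 2 12))
      (.seq (.cond (.natLT (.const 0) (nent 1 12))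
        (.cond (.natLT (.const 0) (nent 4 12)) (setVar 17 (.sub (.add (nvar 8) (nvar 6)) (nvar 7)))
          (setVar 17 (nvar 8)))
        (.cond (.natLT (.const 0) (nent 4 12)) (setVar 17 (nvar 6)) (setVar 17 (.const 0))))
      (coin 16 (.sub (.add (nvar 8) (nvar 6)) (.const 1)) (nvar 17)
        (setEnt 1 12 (.const 1)) (setEnt 1 12 (.const 0)))) .skip) .skip

/-- Find an element `14` of row `2` that can be exchanged with the element `13` of row `3`. -/
def findExchange : Program :=
  forLoop 12 (nvar 0) <| .cond (.natLT (.const 0) (nent 2 12))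
    (.cond (.natLT (.const 0) (nent 3 12)) .skip <|
      .seq (setEnt 2 12 (.const 0)) <| .seq (setEnt 2 13 (.const 1)) <|
      .seq (.member 15 (.const 0) (.const 0) 2 (.const 0)) <|
      .seq (setEnt 2 12 (.const 1)) <| .seq (setEnt 2 13 (.const 0)) <|
      .seq (setEnt 3 13 (.const 0)) <| .seq (setEnt 3 12 (.const 1)) <|
      .seq (.member 16 (.const 0) (.const 0) 3 (.const 0)) <|
      .seq (setEnt 3 13 (.const 1)) <| .seq (setEnt 3 12 (.const 0)) <|
      .cond (.natLT (.const 0) (nvar 15))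
        (.cond (.natLT (.const 0) (nvar 16)) (setVar 14 (nvar 12)) .skip) .skip)
    .skip

/-- Merge the base in row `2`, which has weight `K`, with the base in row `3`, which has
weight `1`. -/
def mergeBases : Program :=
  forLoop 13 (nvar 0) <| .cond (.natLT (.const 0) (nent 3 13))
    (.cond (.natLT (.const 0) (nent 2 13)) .skip <| .seq findExchange <|
      coin 16 (nvar 7) (nvar 7)
        (.seq (setEnt 3 13 (.const 0)) (setEnt 3 14 (.const 1)))
        (.seq (setEnt 2 14 (.const 0)) <| .seq (setEnt 2 13 (.const 1)) <|
          .seq (setEnt 1 14 (.const 0)) <|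
          .cond (.natLT (.const 0) (nent 4 13)) (setEnt 1 13 (.const 1)) (setEnt 1 13 (.const 0))))
    .skip

section Specs

open Store

variable {n : ℕ} {I : MatroidInstance n}

theorem hoare_positivePart {σ : Store} (hn : σ.nat (0, 0, 0) = n) :
    Hoare I positivePart (n * 8 + 3) σ (fun τ => Same [4, 12] [] σ τ ∧
      τ.row n 4 0 = (σ.row n 3 0).filter fun u => 0 < weight σ u) := by
  refine (hoare_forLoop (t := 5) (N := n) (fun j τ => Same [4, 12] [] σ τ ∧
    ∀ u : Fin n, (u : ℕ) < j → (u ∈ τ.row n 4 0 ↔ u ∈ σ.row n 3 0 ∧ 0 < weight σ u)) ?_ ?_ ?_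
      ⟨Same.refl _ _ _, by simp⟩).conseq le_rfl fun τ hτ => ⟨hτ.1, Finset.ext fun u => by
        rw [Finset.mem_filter]; exact hτ.2 u u.2⟩
  · rintro j τ v ⟨h1, h2⟩
    exact ⟨h1.writeNat (by simp) _, by simpa using h2⟩
  · rintro j τ ⟨h1, -⟩
    simp only [NatExpr.eval]
    rw [h1.1 0 (by simp), hn]
  · rintro j τ hj ⟨h1, h2⟩ hi v
    obtain ⟨w, rfl⟩ : ∃ w : Fin n, (w : ℕ) = j := ⟨⟨j, hj⟩, rfl⟩
    have hwB : w ∈ σ.row n 3 0 ↔ τ.nat (3, 0, (w : ℕ)) ≠ 0 := by rw [mem_row, h1.1 3 (by simp)]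
    have hww : weight σ w = τ.real (0, 0, (w : ℕ)) := (h1.2 0 (by simp) _ _).symm
    have hlt : ∀ u : Fin n, (u : ℕ) < w + 1 → u ≠ w → (u : ℕ) < w := fun u hu hne => by
      have : (u : ℕ) ≠ w := fun h => hne (Fin.ext h)
      omega
    refine tri_setEnt_seq (t := 3) (y := 0) hi rfl ?_
    have hout : ¬ (w ∈ σ.row n 3 0 ∧ 0 < weight σ w) → ∀ u : Fin n, (u : ℕ) < w + 1 →
        (u ∈ (τ.writeNat (4, 0, (w : ℕ)) 0).row n 4 0 ↔ u ∈ σ.row n 3 0 ∧ 0 < weight σ u) := by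
      intro h u hu
      by_cases huw : u = w
      · subst huw; simpa using h
      · simpa [huw] using h2 u (hlt u hu huw)
    refine tri_cond (fun hb => ?_) fun hb => ?_
    · have hw : w ∈ σ.row n 3 0 := by
        rw [hwB]; simp [Test.holds, NatExpr.eval, hi] at hb; omega
      refine tri_cond (fun hb => ?_) fun hb => ?_
      · have hp : 0 < weight σ w := by
          simpa [Test.holds, NatExpr.eval, RealExpr.eval, hi, hww] using hb
        refine tri_setEnt (t := 0) (j := w) (y := 1) (by simp [hi]) rfl
          ⟨by simp [hi], (h1.writeNat (by simp) _).writeNat (by simp) _, fun u hu => ?_⟩ le_rfl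
        by_cases huw : u = w
        · subst huw; simp [hw, hp]
        · simpa [huw] using h2 u (hlt u hu huw)
      · have hp : ¬ 0 < weight σ w := by
          simpa [Test.holds, NatExpr.eval, RealExpr.eval, hi, hww] using hb
        exact tri_skip (t := 0) ⟨by simp [hi], h1.writeNat (by simp) _,
          hout fun h => hp h.2⟩ le_rfl
    · have hw : w ∉ σ.row n 3 0 := by
        rw [hwB]; simp [Test.holds, NatExpr.eval, hi] at hb; omega
      exact tri_skip (t := 1) ⟨by simp [hi], h1.writeNat (by simp) _,
        hout fun h => hw h.1⟩ le_rfl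

/-- The inclusion probabilities in the middle of merging `C` and `B`. -/
noncomputable def midVector {α : Type*} [DecidableEq α] (K L : ℝ) (A C B P : Finset α)
    (u : α) : ℝ :=
  if u ∈ C then (if u ∈ B then (if u ∈ A then (K + 1) / L else 0) else if u ∈ A then K / L else 0)
  else if u ∈ B then (if u ∈ P then 1 / L else 0) else 0

theorem midVector_mem {α : Type*} [DecidableEq α] {K L : ℝ} (hK : 0 ≤ K) (hKL : K + 1 ≤ L)
    (A C B P : Finset α) (u : α) : midVector K L A C B P u ∈ Set.Icc (0 : ℝ) 1 := by
  have hL : 0 < L := by linarith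
  have h1 : (K + 1) / L ∈ Set.Icc (0 : ℝ) 1 := ⟨by positivity, by rw [div_le_one hL]; linarith⟩
  have h2 : K / L ∈ Set.Icc (0 : ℝ) 1 := ⟨by positivity, by rw [div_le_one hL]; linarith⟩
  have h3 : 1 / L ∈ Set.Icc (0 : ℝ) 1 := ⟨by positivity, by rw [div_le_one hL]; linarith⟩
  have h4 : (0 : ℝ) ∈ Set.Icc (0 : ℝ) 1 := ⟨le_rfl, zero_le_one⟩
  unfold midVector
  split_ifs <;> assumption

/-- A common element of the two bases has probability at most `(K + 1) / L`. Replacing it by `(K +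
1) / L` or `0` with the same mean changes no expectation, by affinity in that coordinate. -/
theorem tri_updateCommon {σ : Store} (hn : σ.nat (0, 0, 0) = n) {L K : ℕ}
    (hL : σ.nat (6, 0, 0) = L) (hK : σ.nat (7, 0, 0) = K) (hKL' : σ.nat (8, 0, 0) = K * L)
    (hKL : K < L) {A C B P : Finset (Fin n)} (hA : σ.row n 1 0 = A) (hC : σ.row n 2 0 = C)
    (hB : σ.row n 3 0 = B) (hP : σ.row n 4 0 = P) (hAC : A ⊆ C) (hPB : P ⊆ B)
    (φ : Finset (Fin n) → ℝ) :
    Tri I updateCommon (n * 13 + 3) σ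
      (fun τ => Same [1, 12, 16, 17] [] σ τ ∧ τ.row n 1 0 ⊆ C)
      (fun τ => mlext φ (midVector K L (τ.row n 1 0) C B P))
      (mlext φ (probAdd (1 / (L : ℝ)) P (scaled ((K : ℝ) / L) A))) := by
  have hL0 : (L : ℝ) ≠ 0 := by
    have : L ≠ 0 := by omega
    exact_mod_cast this
  have hK1 : (K : ℝ) + 1 ≠ 0 := by positivity
  set x₀ := probAdd (1 / (L : ℝ)) P (scaled ((K : ℝ) / L) A) with hx₀
  set z : ℕ → Store → Fin n → ℝ := fun j τ u =>
    if (u : ℕ) < j then midVector K L (τ.row n 1 0) C B P u else x₀ u with hz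
  have hz0 : z 0 σ = x₀ := by ext u; simp [hz]
  have hzn : ∀ τ, z n τ = midVector K L (τ.row n 1 0) C B P := fun τ => by ext u; simp [hz]
  rw [← hz0]
  refine (tri_forLoop (N := n) (t := 10)
    (fun j τ => Same [1, 12, 16, 17] [] σ τ ∧ τ.row n 1 0 ⊆ C ∧
      ∀ u : Fin n, (j ≤ (u : ℕ) ∨ u ∉ B ∨ u ∉ C) → (u ∈ τ.row n 1 0 ↔ u ∈ A))
    (fun j τ => mlext φ (z j τ)) ?_ ?_ ?_ ?_
        ⟨Same.refl _ _ _, hA ▸ hAC, by simp [hA]⟩).conseq le_rfl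
      (fun τ h => ⟨⟨h.1, h.2.1⟩, by rw [hzn]⟩) le_rfl
  · rintro j τ v ⟨h1, h2, h3⟩
    exact ⟨h1.writeNat (by simp) _, by simpa using h2, by simpa using h3⟩
  · intro j τ v _
    simp [hz]
  · rintro j τ ⟨h, -⟩
    simp only [NatExpr.eval]
    rw [h.1 0 (by simp), hn]
  · rintro j τ hj ⟨h1, h2, h3⟩ hi
    obtain ⟨w, rfl⟩ : ∃ w : Fin n, (w : ℕ) = j := ⟨⟨j, hj⟩, rfl⟩
    have hwA : w ∈ A ↔ τ.nat (1, 0, (w : ℕ)) ≠ 0 := by rw [← h3 w (by simp), mem_row]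
    have hwC : w ∈ C ↔ τ.nat (2, 0, (w : ℕ)) ≠ 0 := by rw [← hC, mem_row, h1.1 2 (by simp)]
    have hwB : w ∈ B ↔ τ.nat (3, 0, (w : ℕ)) ≠ 0 := by rw [← hB, mem_row, h1.1 3 (by simp)]
    have hwP : w ∈ P ↔ τ.nat (4, 0, (w : ℕ)) ≠ 0 := by rw [← hP, mem_row, h1.1 4 (by simp)]
    have hτL : τ.nat (6, 0, 0) = L := by rw [h1.1 6 (by simp), hL]
    have hτK : τ.nat (7, 0, 0) = K := by rw [h1.1 7 (by simp), hK]
    have hτKL : τ.nat (8, 0, 0) = K * L := by rw [h1.1 8 (by simp), hKL']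
    have hout : ¬ (w ∈ B ∧ w ∈ C) → ∀ t : ℕ, Tri I .skip (t + 1) τ
        (fun σ' => σ'.nat (12, 0, 0) = w ∧ Same [1, 12, 16, 17] [] σ σ' ∧ σ'.row n 1 0 ⊆ C ∧
          ∀ u : Fin n, ((w : ℕ) + 1 ≤ (u : ℕ) ∨ u ∉ B ∨ u ∉ C) → (u ∈ σ'.row n 1 0 ↔ u ∈ A))
        (fun σ' => mlext φ (z (w + 1) σ')) (mlext φ (z w τ)) := by
      intro hw t
      refine tri_skip ⟨hi, h1, h2, fun u hu => h3 u (hu.imp (by omega) id)⟩ (le_of_eq ?_)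
      congr 1
      ext u
      by_cases huw : u = w
      · subst huw
        have := h3 u (Or.inl le_rfl)
        simp only [hz, lt_irrefl, if_false, Nat.lt_succ_self, if_true, midVector, this, hx₀, probAdd,
          scaled]
        by_cases hc : u ∈ C
        · have hb : u ∉ B := fun hb => hw ⟨hb, hc⟩
          have hp : u ∉ P := fun hp => hb (hPB hp)
          simp [hc, hb, hp]
        · have ha : u ∉ A := fun ha => hc (hAC ha)
          by_cases hp : u ∈ P
          · simp [hc, ha, hp, hPB hp]
          · simp [hc, ha, hp]
      · have hne : (u : ℕ) ≠ w := fun h => huw (Fin.ext h)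
        have : (u : ℕ) < w + 1 ↔ (u : ℕ) < w := by omega
        simp only [hz, this]
    refine tri_cond (t := 9) (fun hb => ?_) fun hb => hout (fun h => ?_) 8
    swap
    · have := hwB.1 h.1
      simp [Test.holds, NatExpr.eval, hi] at hb; omega
    have hwB' : w ∈ B := by
      rw [hwB]; simp [Test.holds, NatExpr.eval, hi] at hb; omega
    refine tri_cond (t := 8) (fun hb => ?_) fun hb => hout (fun h => ?_) 7
    swap
    · have := hwC.1 h.2
      simp [Test.holds, NatExpr.eval, hi] at hb; omega
    have hwC' : w ∈ C := by
      rw [hwC]; simp [Test.holds, NatExpr.eval, hi] at hb; omega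
    have hupd : ∀ ρ : Store, (∀ u, u ≠ w → (u ∈ ρ.row n 1 0 ↔ u ∈ τ.row n 1 0)) →
        z (w + 1) ρ =
          Function.update (z w τ) w (if w ∈ ρ.row n 1 0 then ((K : ℝ) + 1) / L else 0) := by
      intro ρ h
      ext u
      by_cases hu : u = w
      · subst hu; simp [hz, midVector, hwB', hwC']
      · have hne : (u : ℕ) ≠ w := fun h => hu (Fin.ext h)
        have : (u : ℕ) < w + 1 ↔ (u : ℕ) < w := by omega
        simp only [hz, Function.update_of_ne hu, this, midVector, h u hu]
    -- The threshold `y` equals `x₀ w * L²`, a natural number in all four cases, so the coin needs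
    -- no division.
    have hthr : ∀ y : ℕ, y ≤ K * L + L →
        (y : ℝ) / ((K * L + L : ℕ) : ℝ) * (((K : ℝ) + 1) / L) = x₀ w →
        Tri I (coin 16 (.sub (.add (nvar 8) (nvar 6)) (.const 1)) (nvar 17)
          (setEnt 1 12 (.const 1)) (setEnt 1 12 (.const 0))) 4 (τ.writeNat (17, 0, 0) y)
          (fun σ' => σ'.nat (12, 0, 0) = w ∧ Same [1, 12, 16, 17] [] σ σ' ∧ σ'.row n 1 0 ⊆ C ∧
          ∀ u : Fin n, ((w : ℕ) + 1 ≤ (u : ℕ) ∨ u ∉ B ∨ u ∉ C) → (u ∈ σ'.row n 1 0 ↔ u ∈ A))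
          (fun σ' => mlext φ (z (w + 1) σ')) (mlext φ (z w τ)) := by
      intro y hy hval
      refine tri_coin (t := 1) (m := K * L + L) (k := y)
        (v₁ := mlext φ (Function.update (z w τ) w (((K : ℝ) + 1) / L)))
        (v₂ := mlext φ (Function.update (z w τ) w 0)) ?_ hy ?_ (fun r _ => ?_) (fun r => ?_) ?_
      · simp [NatExpr.eval, hτL, hτKL]; omega
      · intro r; simp [NatExpr.eval]
      · refine tri_setEnt (t := 0) (j := w) (y := 1) (by simp [hi]) rfl
          ⟨by simp [hi], ?_, ?_, fun u hu => ?_⟩ ?_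
        · repeat refine Same.writeNat ?_ (by simp) _
          exact h1
        · simpa [Finset.insert_subset_iff, hwC'] using h2
        · have hne : u ≠ w := by rintro rfl; simp [hwB', hwC'] at hu
          simpa [hne] using h3 u (hu.imp (by omega) id)
        · refine le_of_eq ?_
          rw [hupd]
          · simp
          · intro u hu; simp [hu]
      · refine tri_setEnt (t := 0) (j := w) (y := 0) (by simp [hi]) rfl
          ⟨by simp [hi], ?_, ?_, fun u hu => ?_⟩ ?_
        · repeat refine Same.writeNat ?_ (by simp) _
          exact h1
        · simpa using (Finset.erase_subset _ _).trans h2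
        · have hne : u ≠ w := by rintro rfl; simp [hwB', hwC'] at hu
          simpa [hne] using h3 u (hu.imp (by omega) id)
        · refine le_of_eq ?_
          rw [hupd]
          · simp
          · intro u hu; simp [hu]
      · rw [← mlext_update_convex]
        have : (y : ℝ) / ((K * L + L : ℕ) : ℝ) * (((K : ℝ) + 1) / L) +
            (1 - (y : ℝ) / ((K * L + L : ℕ) : ℝ)) * 0 = z w τ w := by
          rw [hval, mul_zero, add_zero]; simp [hz]
        rw [this, Function.update_eq_self]
    refine (Tri.seq (s := 3) (t := 4) (Q := fun ρ => ∃ y : ℕ, ρ = τ.writeNat (17, 0, 0) y ∧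
      y ≤ K * L + L ∧ (y : ℝ) / ((K * L + L : ℕ) : ℝ) * (((K : ℝ) + 1) / L) = x₀ w)
      (W := fun _ => mlext φ (z w τ)) ?_ ?_).conseq (by omega) (fun _ h => ⟨h, le_rfl⟩) le_rfl
    · have hm : (((K * L + L : ℕ) : ℝ)) = (K + 1) * L := by push_cast; ring
      have hKle : K ≤ K * L + L := by omega
      refine tri_cond (t := 2) (fun hb => ?_) fun hb => ?_
      · have ha : w ∈ A := by rw [hwA]; simp [Test.holds, NatExpr.eval, hi] at hb; omega
        refine tri_cond (t := 1) (fun hb => ?_) fun hb => ?_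
        · have hp : w ∈ P := by rw [hwP]; simp [Test.holds, NatExpr.eval, hi] at hb; omega
          refine tri_setVar (t := 0) (y := K * L + L - K) (by simp [NatExpr.eval, hτL, hτK, hτKL])
            ⟨_, rfl, by omega, ?_⟩ le_rfl
          rw [Nat.cast_sub hKle, hm]
          simp only [hx₀, probAdd, scaled, hp, ha, if_true]
          field_simp
          ring
        · have hp : w ∉ P := by rw [hwP]; simp [Test.holds, NatExpr.eval, hi] at hb; omega
          refine tri_setVar (t := 0) (y := K * L) (by simp [NatExpr.eval, hτKL])
            ⟨_, rfl, by omega, ?_⟩ le_rfl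
          rw [hm]
          simp only [hx₀, probAdd, scaled, hp, ha, if_true, if_false]
          push_cast
          field_simp
      · have ha : w ∉ A := by rw [hwA]; simp [Test.holds, NatExpr.eval, hi] at hb; omega
        refine tri_cond (t := 1) (fun hb => ?_) fun hb => ?_
        · have hp : w ∈ P := by rw [hwP]; simp [Test.holds, NatExpr.eval, hi] at hb; omega
          refine tri_setVar (t := 0) (y := L) (by simp [NatExpr.eval, hτL])
            ⟨_, rfl, by omega, ?_⟩ le_rfl
          rw [hm]
          simp only [hx₀, probAdd, scaled, hp, ha, if_true, if_false]
          field_simp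
          ring
        · have hp : w ∉ P := by rw [hwP]; simp [Test.holds, NatExpr.eval, hi] at hb; omega
          refine tri_setVar (t := 0) (y := 0) rfl ⟨_, rfl, by omega, ?_⟩ le_rfl
          simp [hx₀, probAdd, scaled, hp, ha]
    · rintro ρ ⟨y, rfl, hy, hval⟩
      exact hthr y hy hval

theorem hoare_findExchange {σ : Store} (hn : σ.nat (0, 0, 0) = n) {C B : Finset (Fin n)}
    (hC : σ.row n 2 0 = C) (hB : σ.row n 3 0 = B) (hCb : I.Base C) (hBb : I.Base B) {v : Fin n}
    (hv : σ.nat (13, 0, 0) = v) (hvB : v ∈ B) (hvC : v ∉ C) :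
    Hoare I findExchange (n * 29 + 3) σ (fun τ => Same [2, 3, 12, 14, 15, 16] [] σ τ ∧
      τ.row n 2 0 = C ∧ τ.row n 3 0 = B ∧ ∃ b : Fin n, τ.nat (14, 0, 0) = b ∧ b ∈ C ∧ b ∉ B ∧
        I.Feasible (insert v (C.erase b)) ∧ I.Feasible (insert b (B.erase v))) := by
  set good : Fin n → Prop := fun b => b ∈ C ∧ b ∉ B ∧
    I.Feasible (insert v (C.erase b)) ∧ I.Feasible (insert b (B.erase v)) with hgood
  refine (hoare_forLoop (t := 26) (N := n) (fun j τ => Same [2, 3, 12, 14, 15, 16] [] σ τ ∧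
      -- Either a partner is already stored or none has occurred so far; after the loop, symmetric
      -- exchange excludes the second case.
      τ.row n 2 0 = C ∧ τ.row n 3 0 = B ∧ ((∃ b : Fin n, τ.nat (14, 0, 0) = b ∧ good b) ∨
        ∀ u : Fin n, (u : ℕ) < j → ¬ good u)) ?_ ?_ ?_
        ⟨Same.refl _ _ _, hC, hB, Or.inr (by simp)⟩).conseq le_rfl ?_
  · rintro j τ v ⟨h1, h2, h3, h4⟩
    exact ⟨h1.writeNat (by simp) _, by simpa using h2, by simpa using h3, by simpa using h4⟩
  · rintro j τ ⟨h1, -⟩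
    simp only [NatExpr.eval]
    rw [h1.1 0 (by simp), hn]
  · rintro j τ hj ⟨h1, h2, h3, h4⟩ hi x
    obtain ⟨w, rfl⟩ : ∃ w : Fin n, (w : ℕ) = j := ⟨⟨j, hj⟩, rfl⟩
    have hwC : w ∈ C ↔ τ.nat (2, 0, (w : ℕ)) ≠ 0 := by rw [← h2, mem_row]
    have hwB : w ∈ B ↔ τ.nat (3, 0, (w : ℕ)) ≠ 0 := by rw [← h3, mem_row]
    have hv' : τ.nat (13, 0, 0) = v := by rw [h1.1 13 (by simp), hv]
    have hbad : ¬ good w → ((∃ b : Fin n, τ.nat (14, 0, 0) = b ∧ good b) ∨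
        ∀ u : Fin n, (u : ℕ) < w + 1 → ¬ good u) := by
      intro hg
      refine h4.imp id fun h u hu => ?_
      by_cases huw : u = w
      · rwa [huw]
      · have hne : (u : ℕ) ≠ w := fun h => huw (Fin.ext h)
        exact h u (by omega)
    refine tri_cond (t := 25) (fun hb => ?_) fun hb => ?_
    swap
    · exact tri_skip (t := 24) ⟨hi, h1, h2, h3, hbad fun hg => by
        have := hwC.1 hg.1
        simp [Test.holds, NatExpr.eval, hi] at hb; omega⟩ le_rfl
    have hw : w ∈ C := by rw [hwC]; simp [Test.holds, NatExpr.eval, hi] at hb; omega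
    refine tri_cond (t := 24) (fun hb => ?_) fun hb => ?_
    · exact tri_skip (t := 23) ⟨hi, h1, h2, h3, hbad fun hg => hg.2.1 (by
        rw [hwB]; simp [Test.holds, NatExpr.eval, hi] at hb; omega)⟩ le_rfl
    have hw' : w ∉ B := by rw [hwB]; simp [Test.holds, NatExpr.eval, hi] at hb; omega
    have hvw : v ≠ w := fun h => hvC (h ▸ hw)
    have hrestC : (insert w (insert v (C.erase w))).erase v = C := by
      ext u
      simp only [Finset.mem_erase, Finset.mem_insert]
      by_cases huv : u = v
      · subst huv; simp [hvC]
      · by_cases huw : u = w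
        · subst huw; simp [huv, hw]
        · simp [huv, huw]
    have hrestB : (insert v (insert w (B.erase v))).erase w = B := by
      ext u
      simp only [Finset.mem_erase, Finset.mem_insert]
      by_cases huv : u = v
      · subst huv; simp [hvB, hvw]
      · by_cases huw : u = w
        · subst huw; simp [hw']
        · simp [huv, huw]
    have hmid : ∀ a : ℕ, (I.Feasible (insert v (C.erase w)) ↔ 0 < a) →
        Tri I (.seq (setEnt 2 12 (.const 1)) <| .seq (setEnt 2 13 (.const 0)) <|
      .seq (setEnt 3 13 (.const 0)) <| .seq (setEnt 3 12 (.const 1)) <|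
      .seq (.member 16 (.const 0) (.const 0) 3 (.const 0)) <|
      .seq (setEnt 3 13 (.const 1)) <| .seq (setEnt 3 12 (.const 0)) <|
      .cond (.natLT (.const 0) (nvar 15))
        (.cond (.natLT (.const 0) (nvar 16)) (setVar 14 (nvar 12)) .skip) .skip) 18
          (((τ.writeNat (2, 0, (w : ℕ)) 0).writeNat (2, 0, (v : ℕ)) 1).writeNat (15, 0, 0) a)
          (fun σ' => σ'.nat (12, 0, 0) = w ∧ Same [2, 3, 12, 14, 15, 16] [] σ σ' ∧
            σ'.row n 2 0 = C ∧ σ'.row n 3 0 = B ∧ ((∃ b : Fin n, σ'.nat (14, 0, 0) = b ∧ good b) ∨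
            ∀ u : Fin n, (u : ℕ) < w + 1 → ¬ good u)) (fun _ => x) x := by
      intro a ha
      refine tri_setEnt_seq (t := 16) (j := w) (y := 1) (by simp [hi]) rfl ?_
      refine tri_setEnt_seq (t := 14) (j := v) (y := 0) (by simp [hv']) rfl ?_
      refine tri_setEnt_seq (t := 12) (j := v) (y := 0) (by simp [hv']) rfl ?_
      refine tri_setEnt_seq (t := 10) (j := w) (y := 1) (by simp [hi]) rfl ?_
      have hfin : ∀ b : ℕ, (I.Feasible (insert w (B.erase v)) ↔ 0 < b) →
        Tri I (.seq (setEnt 3 13 (.const 1)) <| .seq (setEnt 3 12 (.const 0)) <|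
          .cond (.natLT (.const 0) (nvar 15))
          (.cond (.natLT (.const 0) (nvar 16)) (setVar 14 (nvar 12)) .skip) .skip) 8
          ((((((((τ.writeNat (2, 0, (w : ℕ)) 0).writeNat (2, 0, (v : ℕ)) 1).writeNat
            (15, 0, 0) a).writeNat (2, 0, (w : ℕ)) 1).writeNat (2, 0, (v : ℕ)) 0).writeNat
            (3, 0, (v : ℕ)) 0).writeNat (3, 0, (w : ℕ)) 1).writeNat (16, 0, 0) b)
          (fun σ' => σ'.nat (12, 0, 0) = w ∧ Same [2, 3, 12, 14, 15, 16] [] σ σ' ∧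
            σ'.row n 2 0 = C ∧ σ'.row n 3 0 = B ∧ ((∃ b : Fin n, σ'.nat (14, 0, 0) = b ∧ good b) ∨
            ∀ u : Fin n, (u : ℕ) < w + 1 → ¬ good u)) (fun _ => x) x := by
        intro b hb
        refine tri_setEnt_seq (t := 6) (j := v) (y := 1) (by simp [hv']) rfl ?_
        refine tri_setEnt_seq (t := 4) (j := w) (y := 0) (by simp [hi]) rfl ?_
        refine tri_cond (t := 3) (fun hb1 => ?_) fun hb1 => ?_
        · refine tri_cond (t := 2) (fun hb2 => ?_) fun hb2 => ?_
          · simp [Test.holds, NatExpr.eval] at hb1 hb2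
            refine tri_setVar (t := 1) (y := w) (by simp [NatExpr.eval, hi])
              ⟨by simp [hi], ?_, by simp [h2, hrestC], by simp [h3, hrestB],
                Or.inl ⟨w, by simp, hw, hw', ha.2 hb1, hb.2 hb2⟩⟩ le_rfl
            repeat refine Same.writeNat ?_ (by simp) _
            exact h1
          · simp [Test.holds, NatExpr.eval] at hb2
            refine tri_skip (t := 1) ⟨by simp [hi], ?_, by simp [h2, hrestC], by simp [h3, hrestB],
              ?_⟩ le_rfl
            · repeat refine Same.writeNat ?_ (by simp) _
              exact h1
            · simpa using hbad fun hg => by have := hb.1 hg.2.2.2; omega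
        · simp [Test.holds, NatExpr.eval] at hb1
          refine tri_skip (t := 2) ⟨by simp [hi], ?_, by simp [h2, hrestC], by simp [h3, hrestB],
            ?_⟩ le_rfl
          · repeat refine Same.writeNat ?_ (by simp) _
            exact h1
          · simpa using hbad fun hg => by have := ha.1 hg.2.2.1; omega
      refine tri_member_seq (t := 8) (fun hf => hfin 1 ?_) (fun hf => hfin 0 ?_)
      · simp [NatExpr.eval, h3] at hf
        simp [hf]
      · simp [NatExpr.eval, h3] at hf
        simp [hf]
    refine tri_setEnt_seq (t := 22) (j := w) (y := 0) (by simp [hi]) rfl ?_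
    refine tri_setEnt_seq (t := 20) (j := v) (y := 1) (by simp [hv']) rfl ?_
    refine tri_member_seq (t := 18) (fun hf => hmid 1 ?_) (fun hf => hmid 0 ?_)
    · simp [NatExpr.eval, h2] at hf
      simp [hf]
    · simp [NatExpr.eval, h2] at hf
      simp [hf]
  · rintro τ ⟨h1, h2, h3, h4⟩
    refine ⟨h1, h2, h3, ?_⟩
    rcases h4 with h4 | h4
    · exact h4
    · obtain ⟨u, hu⟩ := hBb.symm_exchange hCb hvB hvC
      exact absurd hu (h4 u u.2)

end Specs

section Specs

open Store

variable {n : ℕ} {I : MatroidInstance n}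

/-- Swap rounding: for `v ∈ B \ C` and a partner `b ∈ C \ B`, either `B` takes `b` for `v`, with
probability `K / (K + 1)`, or `C` takes `v` for `b`. Either way `B \ C` shrinks, and convexity along
`e_b - e_v` keeps the expectation from falling. -/
theorem tri_mergeBases {σ : Store} (hn : σ.nat (0, 0, 0) = n) {L K : ℕ}
    (hK : σ.nat (7, 0, 0) = K) (hKL : K < L) (hA : σ.row n 1 0 ⊆ σ.row n 2 0)
    (hC : I.Base (σ.row n 2 0)) (hB : I.Base (σ.row n 3 0)) {φ : Finset (Fin n) → ℝ}
    (hφ : IsSubmodular φ) :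
    Tri I mergeBases (n * (n * 29 + 20) + 3) σ
      (fun τ => Same [1, 2, 3, 12, 13, 14, 15, 16] [] σ τ ∧ I.Base (τ.row n 2 0) ∧
        τ.row n 1 0 ⊆ τ.row n 2 0)
      (fun τ => mlext φ (scaled (((K : ℝ) + 1) / L) (τ.row n 1 0)))
      (mlext φ (midVector K L (σ.row n 1 0) (σ.row n 2 0) (σ.row n 3 0) (σ.row n 4 0))) := by
  set P := σ.row n 4 0 with hP
  have hKL' : (K : ℝ) + 1 ≤ L := by exact_mod_cast hKL
  refine (tri_forLoop (N := n) (t := n * 29 + 17)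
    (fun j τ => Same [1, 2, 3, 12, 13, 14, 15, 16] [] σ τ ∧ I.Base (τ.row n 2 0) ∧
      I.Base (τ.row n 3 0) ∧ τ.row n 1 0 ⊆ τ.row n 2 0 ∧
      ∀ u : Fin n, (u : ℕ) < j → u ∈ τ.row n 3 0 → u ∈ τ.row n 2 0)
    (fun _ τ => mlext φ (midVector K L (τ.row n 1 0) (τ.row n 2 0) (τ.row n 3 0) P)) ?_ ?_ ?_ ?_
      ⟨Same.refl _ _ _, hC, hB, hA, by simp⟩).conseq le_rfl ?_ le_rfl
  · rintro j τ v ⟨h1, h2, h3, h4, h5⟩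
    exact ⟨h1.writeNat (by simp) _, by simpa using h2, by simpa using h3, by simpa using h4,
      by simpa using h5⟩
  · intro j τ v _
    simp
  · rintro j τ ⟨h, -⟩
    simp only [NatExpr.eval]
    rw [h.1 0 (by simp), hn]
  · rintro j τ hj ⟨h1, h2, h3, h4, h5⟩ hi
    obtain ⟨v, rfl⟩ : ∃ w : Fin n, (w : ℕ) = j := ⟨⟨j, hj⟩, rfl⟩
    have hvC : v ∈ τ.row n 2 0 ↔ τ.nat (2, 0, (v : ℕ)) ≠ 0 := mem_row
    have hvB : v ∈ τ.row n 3 0 ↔ τ.nat (3, 0, (v : ℕ)) ≠ 0 := mem_row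
    have hskip : (v ∈ τ.row n 3 0 → v ∈ τ.row n 2 0) → ∀ u : Fin n, (u : ℕ) < v + 1 →
        u ∈ τ.row n 3 0 → u ∈ τ.row n 2 0 := by
      intro h u hu huB
      by_cases huv : u = v
      · subst huv; exact h huB
      · have hne : (u : ℕ) ≠ v := fun h => huv (Fin.ext h)
        exact h5 u (by omega) huB
    refine tri_cond (t := n * 29 + 16) (fun hb => ?_) fun hb => ?_
    swap
    · refine tri_skip (t := n * 29 + 15) ⟨hi, h1, h2, h3, h4, hskip fun h => ?_⟩ le_rfl
      have := hvB.1 h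
      simp [Test.holds, NatExpr.eval, hi] at hb; omega
    have hvB' : v ∈ τ.row n 3 0 := by
      rw [hvB]; simp [Test.holds, NatExpr.eval, hi] at hb; omega
    refine tri_cond (t := n * 29 + 15) (fun hb => ?_) fun hb => ?_
    · refine tri_skip (t := n * 29 + 14) ⟨hi, h1, h2, h3, h4, hskip fun _ => ?_⟩ le_rfl
      rw [hvC]; simp [Test.holds, NatExpr.eval, hi] at hb; omega
    have hvC' : v ∉ τ.row n 2 0 := by
      rw [hvC]; simp [Test.holds, NatExpr.eval, hi] at hb; omega
    refine ((hoare_findExchange (by rw [h1.1 0 (by simp), hn]) rfl rfl h2 h3 hi hvB' hvC').seq_tri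
      (t := 11) ?_).conseq (by omega) (fun _ h => ⟨h, le_rfl⟩) le_rfl
    rintro ρ ⟨g1, g2, g3, b, g4, hbC, hbB, hf1, hf2⟩
    set A := τ.row n 1 0 with hAdef
    set C := τ.row n 2 0 with hCdef
    set B := τ.row n 3 0 with hBdef
    have hA' : ρ.row n 1 0 = A := g1.row (by simp) n 0
    have hS : Same [1, 2, 3, 12, 13, 14, 15, 16] [] σ ρ := h1.trans (g1.mono (by simp) (by simp))
    have hi' : ρ.nat (13, 0, 0) = v := by rw [g1.1 13 (by simp), hi]
    have hK' : ρ.nat (7, 0, 0) = K := by rw [hS.1 7 (by simp), hK]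
    have hvb : v ≠ b := fun h => hvC' (h ▸ hbC)
    have hvA : v ∉ A := fun h => hvC' (h4 h)
    have hP' : v ∈ P ↔ ρ.nat (4, 0, (v : ℕ)) ≠ 0 := by rw [hP, mem_row, hS.1 4 (by simp)]
    have hz := midVector_mem (Nat.cast_nonneg K) hKL' A C B P
    set z := midVector (K : ℝ) L A C B P with hzdef
    have hzb : z b = if b ∈ A then (K : ℝ) / L else 0 := by simp [hzdef, midVector, hbC, hbB]
    have hzv : z v = if v ∈ P then 1 / (L : ℝ) else 0 := by simp [hzdef, midVector, hvC', hvB']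
    have hK1 : (K : ℝ) + 1 ≠ 0 := by positivity
    -- The weights fit because `K / (K + 1)` and `1 / (K + 1)` of `(K + 1) / L` are `K / L` and `1 /
    -- L`. An element outside `A` or `P` carries no mass, and both ends are then `0`.
    have hex := hφ.mlext_le_exchange hz (u := b) (v := v) (p := (K : ℝ) / (K + 1 : ℕ))
      (a := if b ∈ A then ((K : ℝ) + 1) / L else 0) (b := if v ∈ P then ((K : ℝ) + 1) / L else 0)
      (by
        rw [hzb]
        push_cast
        split_ifs
        · field_simp
        · simp)
      (by rw [hzv]; push_cast; split_ifs <;> field_simp <;> ring)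
    refine tri_coin (t := 8) (m := K + 1) (k := K) (by simp [NatExpr.eval, hK']) (by omega)
      (fun r => by simp [NatExpr.eval, hK']) (fun r _ => ?_) (fun r => ?_) hex
    · refine tri_setEnt_seq (t := 6) (j := v) (y := 0) (by simp [hi']) rfl ?_
      refine tri_setEnt (t := 5) (j := b) (y := 1) (by simp [g4]) rfl
        ⟨by simp [hi'], ?_, by simpa [g2] using h2, by simpa [g3] using h3.exchange hvB' hbB hf2,
          by simpa [g2, hA'] using h4, ?_⟩ (le_of_eq ?_)
      · repeat refine Same.writeNat ?_ (by simp) _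
        exact hS
      · intro u hu huB
        simp only [row_writeNat_self, g3, if_true, one_ne_zero, if_false, Finset.mem_insert,
          Finset.mem_erase, ne_eq, not_false_eq_true, row_writeNat_of_ne,
          show (3 : ℕ) ≠ 16 by simp, show (2 : ℕ) ≠ 16 by simp, show (2 : ℕ) ≠ 3 by simp,
              g2] at huB ⊢
        rcases huB with rfl | ⟨huv, huB⟩
        · exact hbC
        · have hne : (u : ℕ) ≠ v := fun h => huv (Fin.ext h)
          exact h5 u (by omega) huB
      · congr 1
        ext u
        simp only [row_writeNat_self, g3, if_true, one_ne_zero, if_false, ne_eq,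
          not_false_eq_true, row_writeNat_of_ne, hA',
          show (3 : ℕ) ≠ 16 by simp, show (2 : ℕ) ≠ 16 by simp, show (2 : ℕ) ≠ 3 by simp,
          show (1 : ℕ) ≠ 16 by simp, show (1 : ℕ) ≠ 3 by simp, g2]
        by_cases huv : u = v
        · subst huv
          simp [midVector, hvC', hvb]
        · rw [Function.update_of_ne huv]
          by_cases hub : u = b
          · subst hub
            simp [midVector, hbC]
          · rw [Function.update_of_ne hub]
            simp [hzdef, midVector, huv, hub]
    · refine tri_setEnt_seq (t := 6) (j := b) (y := 0) (by simp [g4]) rfl ?_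
      refine tri_setEnt_seq (t := 4) (j := v) (y := 1) (by simp [hi']) rfl ?_
      refine tri_setEnt_seq (t := 2) (j := b) (y := 0) (by simp [g4]) rfl ?_
      have hfin : ∀ y : ℕ, (v ∈ P ↔ y ≠ 0) → ∀ υ : Store, υ = ((((ρ.writeNat (16, 0, 0) r).writeNat
          (2, 0, (b : ℕ)) 0).writeNat (2, 0, (v : ℕ)) 1).writeNat (1, 0, (b : ℕ)) 0).writeNat
          (1, 0, (v : ℕ)) y → (υ.nat (13, 0, 0) = v ∧
            Same [1, 2, 3, 12, 13, 14, 15, 16] [] σ υ ∧ I.Base (υ.row n 2 0) ∧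
            I.Base (υ.row n 3 0) ∧ υ.row n 1 0 ⊆ υ.row n 2 0 ∧
            ∀ u : Fin n, (u : ℕ) < v + 1 → u ∈ υ.row n 3 0 → u ∈ υ.row n 2 0) ∧
          mlext φ (Function.update (Function.update z b 0) v
              (if v ∈ P then ((K : ℝ) + 1) / L else 0)) ≤
            mlext φ (midVector K L (υ.row n 1 0) (υ.row n 2 0) (υ.row n 3 0) P) := by
        rintro y hy υ rfl
        have r3 : Store.row (((((ρ.writeNat (16, 0, 0) r).writeNat
          (2, 0, (b : ℕ)) 0).writeNat (2, 0, (v : ℕ)) 1).writeNat (1, 0, (b : ℕ)) 0).writeNat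
          (1, 0, (v : ℕ)) y) n 3 0 = B := by simp [g3]
        have r2 : Store.row (((((ρ.writeNat (16, 0, 0) r).writeNat
          (2, 0, (b : ℕ)) 0).writeNat (2, 0, (v : ℕ)) 1).writeNat (1, 0, (b : ℕ)) 0).writeNat
          (1, 0, (v : ℕ)) y) n 2 0 = insert v (C.erase b) := by simp [g2]
        have r1 : Store.row (((((ρ.writeNat (16, 0, 0) r).writeNat
          (2, 0, (b : ℕ)) 0).writeNat (2, 0, (v : ℕ)) 1).writeNat (1, 0, (b : ℕ)) 0).writeNat
          (1, 0, (v : ℕ)) y) n 1 0 = if v ∈ P then insert v (A.erase b) else A.erase b := by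
          by_cases hp : v ∈ P
          · simp [hA', hp, hy.1 hp]
          · have : y = 0 := by by_contra h; exact hp (hy.2 h)
            simp [hA', hp, this, hvA]
        rw [r1, r2, r3]
        refine ⟨⟨by simp [hi'], ?_, h2.exchange hbC hvC' hf1, h3, ?_, ?_⟩, le_of_eq ?_⟩
        · repeat refine Same.writeNat ?_ (by simp) _
          exact hS
        · have : A.erase b ⊆ C.erase b := Finset.erase_subset_erase b h4
          split_ifs
          · exact Finset.insert_subset_insert v this
          · exact this.trans (Finset.subset_insert _ _)
        · intro u hu huB
          by_cases huv : u = v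
          · simp [huv]
          · have hne : (u : ℕ) ≠ v := fun h => huv (Fin.ext h)
            -- The element removed from `C` is not in `B`, so no earlier round is undone.
            have hub : u ≠ b := fun h => hbB (h ▸ huB)
            simp [hub, h5 u (by omega) huB]
        · congr 1
          ext u
          by_cases huv : u = v
          · subst huv
            by_cases hp : u ∈ P <;> simp [midVector, hvB', hp, hvA]
          · rw [Function.update_of_ne huv]
            by_cases hub : u = b
            · subst hub
              simp [midVector, huv, hbB]
            · rw [Function.update_of_ne hub]
              have : (u ∈ if v ∈ P then insert v (A.erase b) else A.erase b) ↔ u ∈ A := by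
                split_ifs <;> simp [huv, hub]
              simp [hzdef, midVector, huv, hub, this]
      refine tri_cond (t := 1) (fun hb => ?_) fun hb => ?_
      · have hp : v ∈ P := by
          rw [hP']; simp [Test.holds, NatExpr.eval, hi'] at hb; omega
        have := hfin 1 (by simp [hp]) _ rfl
        exact tri_setEnt (t := 0) (j := v) (y := 1) (by simp [hi']) rfl this.1 this.2
      · have hp : v ∉ P := by
          rw [hP']; simp [Test.holds, NatExpr.eval, hi'] at hb; omega
        have := hfin 0 (by simp [hp]) _ rfl
        exact tri_setEnt (t := 0) (j := v) (y := 0) (by simp [hi']) rfl this.1 this.2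
  · rintro τ ⟨h1, h2, h3, h4, h5⟩
    -- Nested bases coincide, and `midVector` collapses to a multiple of an indicator.
    have hBC : τ.row n 3 0 = τ.row n 2 0 := h3.eq_of_subset h2.feasible fun u => h5 u u.2
    refine ⟨⟨h1, h2, h4⟩, le_of_eq ?_⟩
    congr 1
    ext u
    rw [hBC]
    by_cases hc : u ∈ τ.row n 2 0
    · simp [midVector, scaled, hc]
    · have : u ∉ τ.row n 1 0 := fun h => hc (h4 h)
      simp [midVector, scaled, hc, this]

end Specs

/-! ### The complete algorithm and its potential. -/

/-- One step of the continuous greedy algorithm, with the new base merged into the old one. -/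
def improve : Program :=
  .seq estimateWeights <| .seq greedyBase <| .seq positivePart <| .seq updateCommon <|
    .seq mergeBases (setVar 8 (.add (nvar 8) (nvar 6)))

/-- Compute the number `(100 (n + 1)) ^ 2` of steps. -/
def setSteps : Program :=
  .seq (setVar 20 (.const 100)) <|
    .seq (forLoop 12 (nvar 0) (setVar 20 (.add (nvar 20) (.const 100))))
      (forLoop 12 (nvar 20) (setVar 6 (.add (nvar 6) (nvar 20))))

/-- The continuous greedy algorithm, which keeps its fractional solution rounded. -/
def continuousGreedy : Program :=
  .seq setSteps <| .seq greedyBase <| .seq copyBase <| forLoop 7 (nvar 6) improve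

/-- The number of steps of `greedyBase`. -/
def greedyTime (n : ℕ) : ℕ := n * (n * 17 + 8 + 3) + n * 4 + 7

/-- The number of steps of `improve`. -/
def improveTime (n L : ℕ) : ℕ :=
  L * (n * 22 + 12) + n * 4 + 7 + (greedyTime n + (n * 8 + 3 + (n * 13 + 3 +
    (n * (n * 29 + 20) + 3 + 1 + 1) + 1) + 1) + 1) + 1

/-- The number of steps of `setSteps`. -/
def setStepsTime (n : ℕ) : ℕ := n * 4 + 3 + (100 * (n + 1) * 4 + 3) + 1 + 2

/-- The number of steps of `continuousGreedy`. -/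
def totalTime (n : ℕ) : ℕ :=
  setStepsTime n + (greedyTime n + (n * 4 + 3 +
    ((100 * (n + 1)) ^ 2 * (improveTime n ((100 * (n + 1)) ^ 2) + 3) + 3) + 1) + 1) + 1

namespace MatroidInstance

variable {n : ℕ} (I : MatroidInstance n)

/-- The set `insert u R` need not be independent: the upper bound comes from `f({u})` by
submodularity, the lower bound from `f(R)`. -/
theorem abs_marginal_le {R : Finset (Fin n)} (hR : I.Feasible R) {u : Fin n}
    (hu : I.Feasible {u}) : |I.f (insert u R) - I.f R| ≤ I.opt := by
  have h1 := I.submodular R {u}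
  have h2 : R ∪ {u} = insert u R := by rw [Finset.union_comm, Finset.insert_eq]
  rw [h2] at h1
  have h3 := I.nonneg (R ∩ {u})
  have h4 := I.nonneg (insert u R)
  have h5 := I.le_opt hR
  have h6 := I.le_opt hu
  rw [abs_le]
  constructor <;> linarith

end MatroidInstance

/-- The combination of values that is preserved in expectation. -/
def potential {n : ℕ} (I : MatroidInstance n) (O : Finset (Fin n)) (a b c : ℝ)
    (S : Finset (Fin n)) : ℝ := a * I.f S + b * I.f (S ∪ O) + c

section Potential

variable {n : ℕ} {I : MatroidInstance n} {O : Finset (Fin n)}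

theorem isSubmodular_potential {a b : ℝ} (ha : 0 ≤ a) (hb : 0 ≤ b) (c : ℝ) :
    IsSubmodular (potential I O a b c) := by
  intro S T
  have h1 := mul_le_mul_of_nonneg_left (I.submodular S T) ha
  have hf : IsSubmodular I.f := I.submodular
  have h2 := mul_le_mul_of_nonneg_left (hf.comp_union O S T) hb
  simp only [potential]
  linarith

theorem mlext_potential (a b c : ℝ) (x : Fin n → ℝ) : mlext (potential I O a b c) x =
    a * mlext I.f x + b * mlext (fun S => I.f (S ∪ O)) x + c := by
  have : potential I O a b c = fun S => (a * I.f S + b * I.f (S ∪ O)) + c := rfl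
  rw [this, mlext_add, mlext_add, mlext_const_mul, mlext_const_mul, mlext_const]

end Potential

section Specs

open Store

variable {n : ℕ} {I : MatroidInstance n}

/-- One step sends the pair `(F, H)` to at least `((1 - δ) F + δ H, (1 - δ) H)`; read backwards,
this transforms the coefficients `a`, `b`. The loss consists of three errors of at most `δV / 100`:
second-order terms, sampling variance, and the passage from absolute to squared error. -/
theorem tri_improve {σ : Store} (hn : σ.nat (0, 0, 0) = n) {L K : ℕ}
    (hL : σ.nat (6, 0, 0) = L) (hLn : L = (100 * (n + 1)) ^ 2) (hK : σ.nat (7, 0, 0) = K)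
    (hKL' : σ.nat (8, 0, 0) = K * L) (hKL : K < L) (hA : σ.row n 1 0 ⊆ σ.row n 2 0)
    (hC : I.Base (σ.row n 2 0)) {O : Finset (Fin n)} (hO : I.Feasible O) {a b V : ℝ} (ha : 0 ≤ a)
    (hb : 0 ≤ b) (hV : 0 < V) (hopt : I.opt ≤ V) (c : ℝ) :
    Tri I improve (improveTime n L) σ
      (fun τ => Same [1, 2, 3, 4, 5, 8, 11, 12, 13, 14, 15, 16, 17, 18, 19] [0, 1, 2] σ τ ∧
        τ.nat (8, 0, 0) = (K + 1) * L ∧ I.Base (τ.row n 2 0) ∧ τ.row n 1 0 ⊆ τ.row n 2 0)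
      (fun τ => mlext (potential I O a b c) (scaled (((K : ℝ) + 1) / L) (τ.row n 1 0)))
      (mlext (potential I O (a * (1 - 1 / L)) (a * (1 / L) + b * (1 - 1 / L))
        (c - a * (3 / 100 * (1 / L) * V))) (scaled ((K : ℝ) / L) (σ.row n 1 0))) := by
  classical
  have hL0 : 0 < L := by omega
  have hLR : (0 : ℝ) < L := by exact_mod_cast hL0
  set t : ℝ := 100 * (n + 1) with ht
  have ht0 : 0 < t := by positivity
  have hLt : (L : ℝ) = t ^ 2 := by rw [hLn]; push_cast; rw [ht]
  set δ : ℝ := 1 / (L : ℝ) with hδ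
  have hδ0 : 0 ≤ δ := by positivity
  have hδ1 : δ ≤ 1 := by rw [hδ, div_le_one hLR]; exact_mod_cast hL0
  have hp0 : (0 : ℝ) ≤ (K : ℝ) / L := by positivity
  have hp1 : (K : ℝ) / L ≤ 1 := by
    rw [div_le_one hLR]; exact_mod_cast hKL.le
  set A := σ.row n 1 0 with hAdef
  set x : Fin n → ℝ := scaled ((K : ℝ) / L) A with hx
  have hx01 : ∀ i, x i ∈ Set.Icc (0 : ℝ) 1 := scaled_mem hp0 hp1 A
  have hxs : ∀ i, i ∉ A → x i = 0 := fun i hi => by simp [hx, scaled, hi]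
  have hAf : I.Feasible A := hC.feasible.subset hA
  -- Loops are left out, since their marginal values need not be bounded by the optimum.
  set D : Finset (Fin n) := Finset.univ.filter fun u => I.Feasible {u} with hD
  have hmarg : ∀ u ∈ D, ∀ R ⊆ A, |I.f (insert u R) - I.f R| ≤ V := fun u hu R hR =>
    (I.abs_marginal_le (hAf.subset hR) (Finset.mem_filter.1 hu).2).trans hopt
  have hsubD : ∀ S, I.Feasible S → S ⊆ D := fun S hS u hu =>
    Finset.mem_filter.2 ⟨Finset.mem_univ u, hS.subset (Finset.singleton_subset_iff.2 hu)⟩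
  have hFV : mlext I.f x ≤ V := by
    rw [← mlext_const V x]
    exact mlext_mono_support hx01 hxs fun R hR => (I.le_opt (hAf.subset hR)).trans hopt
  have hwV : ∀ u ∈ D, marginal I.f x u ≤ V := by
    intro u hu
    rw [marginal, ← mlext_sub, ← mlext_const V x]
    exact mlext_mono_support hx01 hxs fun R hR => (le_abs_self _).trans (hmarg u hu R hR)
  set F := mlext I.f x with hF
  set H := mlext (fun S => I.f (S ∪ O)) x with hH
  have hf : IsSubmodular I.f := I.submodular
  have hDn : (D.card : ℝ) ≤ n := by exact_mod_cast card_finset_fin_le D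
  -- With `L = t²` this balances the two parts of `2|e| ≤ lam * e² + 1 / lam`: summed over `D`, each
  -- is at most `nV / t`.
  set lam : ℝ := t / V with hlam
  have hlam0 : 0 < lam := by positivity
  set a₀ : ℝ := a * ((1 - δ) * F + δ * H - 2 * (n : ℝ) ^ 2 * δ ^ 2 * V) + b * (1 - δ) * H + c -
    a * δ * (D.card / lam) with ha₀
  set c₀ : ℝ := a * δ * lam / (L : ℝ) ^ 2 with hc₀
  refine ((tri_estimateWeights hn hL hK hL0 hKL.le hx hmarg a₀ c₀ (by positivity)).seq
    (t := greedyTime n + (n * 8 + 3 + (n * 13 + 3 +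
      (n * (n * 29 + 20) + 3 + 1 + 1) + 1) + 1) + 1) ?_).conseq le_rfl (fun _ h => ⟨h, le_rfl⟩) ?_
  · intro τ₁ h₁
    refine (hoare_greedyBase (by rw [h₁.1 0 (by simp), hn])).seq_tri ?_
    rintro τ₂ ⟨h₂, hB, hdom⟩
    have h₂' : Same [1, 2, 3, 4, 5, 8, 11, 12, 13, 14, 15, 16, 17, 18, 19] [0, 1, 2] σ τ₂ :=
      (h₁.mono (by simp) (by simp)).trans (h₂.mono (by simp) (by simp))
    refine (hoare_positivePart (by rw [h₂'.1 0 (by simp), hn])).seq_tri ?_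
    rintro τ₃ ⟨h₃, hPeq⟩
    have h₃' : Same [1, 2, 3, 4, 5, 8, 11, 12, 13, 14, 15, 16, 17, 18, 19] [0, 1, 2] σ τ₃ :=
      h₂'.trans (h₃.mono (by simp) (by simp))
    have eA : τ₃.row n 1 0 = A := by
      rw [h₃.row (by simp), h₂.row (by simp), h₁.row (by simp)]
    have eC : τ₃.row n 2 0 = σ.row n 2 0 := by
      rw [h₃.row (by simp), h₂.row (by simp), h₁.row (by simp)]
    have eB : τ₃.row n 3 0 = τ₂.row n 3 0 := h₃.row (by simp) n 0
    set B := τ₂.row n 3 0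
    have hw : ∀ u : Fin n, weight τ₂ u = weight τ₁ u := h₂.weight (by simp)
    set P := τ₃.row n 4 0 with hP
    have hP' : P = B.filter fun u => 0 < weight τ₁ u := by rw [hPeq]; simp only [hw]
    have hPB : P ⊆ B := by rw [hP']; exact Finset.filter_subset _ _
    have hsum : ∑ u ∈ O, weight τ₁ u / L ≤ ∑ u ∈ P, weight τ₁ u / L := by
      rw [← Finset.sum_div, ← Finset.sum_div, hP']
      exact div_le_div_of_nonneg_right (hdom.sum_le hB hO) hLR.le
    have hstep := hf.greedy_step_le I.nonneg hδ0 hδ1 (hsubD P (hB.feasible.subset hPB))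
      (hsubD O hO) hx01 hsum hFV fun u hu => hwV u (hsubD P (hB.feasible.subset hPB) hu)
    rw [Fintype.card_fin] at hstep
    have hH' : (1 - δ) * H ≤ mlext (fun S => I.f (S ∪ O)) (probAdd δ P x) := by
      have e1 := (hf.comp_union O).le_mlext_probAdd hδ0 hδ1 P hx01
      have e2 : 0 ≤ δ * mlext (fun S => I.f (S ∪ P ∪ O)) x :=
        mul_nonneg hδ0 (mlext_nonneg hx01 fun S => I.nonneg _)
      linarith
    -- The logic tracks an expected squared error, so the absolute errors are bounded by squares
    -- through the arithmetic-geometric mean inequality.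
    have herr : 2 * ∑ u ∈ D, |weight τ₁ u / L - marginal I.f x u| ≤
        lam / (L : ℝ) ^ 2 * (∑ u ∈ D, (weight τ₁ u - L * marginal I.f x u) ^ 2) + D.card / lam := by
      rw [Finset.mul_sum, Finset.mul_sum, ← nsmul_one, nsmul_eq_mul, mul_one, div_eq_mul_one_div
        (D.card : ℝ) lam, ← nsmul_eq_mul, ← Finset.sum_const, ← Finset.sum_add_distrib]
      refine Finset.sum_le_sum fun u _ => ?_
      set e := weight τ₁ u / L - marginal I.f x u with he
      have e1 : weight τ₁ u - L * marginal I.f x u = L * e := by rw [he]; field_simp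
      rw [e1]
      have e2 : lam / (L : ℝ) ^ 2 * (L * e) ^ 2 + 1 / lam =
              (lam * |e| - 1) ^ 2 / lam + 2 * |e| := by
        rw [mul_pow, ← sq_abs e]
        field_simp
        ring
      rw [e2]
      have : 0 ≤ (lam * |e| - 1) ^ 2 / lam := by positivity
      linarith
    refine ((tri_updateCommon (by rw [h₃'.1 0 (by simp), hn])
      (L := L) (K := K) (by rw [h₃'.1 6 (by simp), hL]) (by rw [h₃'.1 7 (by simp), hK])
      (by rw [h₃.1 8 (by simp), h₂.1 8 (by simp), h₁.1 8 (by simp), hKL']) hKL eA eC eB rfl hA hPB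
      (potential I O a b c)).seq (t := n * (n * 29 + 20) + 3 + 1 + 1) ?_).conseq le_rfl
        (fun _ h => ⟨h, le_rfl⟩) ?_
    · rintro τ₄ ⟨h₄, hA₄⟩
      have h₄' : Same [1, 2, 3, 4, 5, 8, 11, 12, 13, 14, 15, 16, 17, 18, 19] [0, 1, 2] σ τ₄ :=
        h₃'.trans (h₄.mono (by simp) (by simp))
      have eC₄ : τ₄.row n 2 0 = σ.row n 2 0 := by rw [h₄.row (by simp), eC]
      have eB₄ : τ₄.row n 3 0 = B := by rw [h₄.row (by simp), eB]
      have eP₄ : τ₄.row n 4 0 = P := h₄.row (by simp) n 0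
      refine ((tri_mergeBases (L := L) (K := K) (by rw [h₄'.1 0 (by simp), hn])
        (by rw [h₄'.1 7 (by simp), hK]) hKL (by rw [eC₄]; exact hA₄) (by rw [eC₄]; exact hC)
        (by rw [eB₄]; exact hB) (isSubmodular_potential (I := I) (O := O) ha hb c)).seq
          (t := 1) ?_).conseq le_rfl (fun _ h => ⟨h, le_rfl⟩) ?_
      · rintro τ₅ ⟨h₅, hC₅, hA₅⟩
        have h₅' : Same [1, 2, 3, 4, 5, 8, 11, 12, 13, 14, 15, 16, 17, 18, 19] [0, 1, 2] σ τ₅ :=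
          h₄'.trans (h₅.mono (by simp) (by simp))
        refine tri_setVar (t := 0) (y := (K + 1) * L) ?_
          ⟨h₅'.writeNat (by simp) _, by simp, by simpa using hC₅, by simpa using hA₅⟩ (by simp)
        simp only [NatExpr.eval]
        rw [h₅'.1 6 (by simp), hL, h₅.1 8 (by simp), h₄.1 8 (by simp), h₃.1 8 (by simp),
          h₂.1 8 (by simp), h₁.1 8 (by simp), hKL']
        ring
      · rw [eC₄, eB₄, eP₄]
    · rw [mlext_potential]
      have e1 := mul_le_mul_of_nonneg_left hstep ha
      have e2 := mul_le_mul_of_nonneg_left hH' hb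
      have e3 := mul_le_mul_of_nonneg_left herr (mul_nonneg ha hδ0)
      have e4 : c₀ * ∑ u ∈ D, (weight τ₁ u - L * marginal I.f x u) ^ 2 = a * δ *
        (lam / (L : ℝ) ^ 2 * ∑ u ∈ D, (weight τ₁ u - L * marginal I.f x u) ^ 2) := by
        rw [hc₀]; ring
      rw [e4, ha₀]
      linarith
  · rw [mlext_potential]
    have hn1 : (n : ℝ) ≤ t / 100 := by rw [ht]; linarith
    have e1 : (D.card : ℝ) / lam ≤ V / 100 := by
      rw [hlam, div_div_eq_mul_div, div_le_div_iff₀ ht0 (by norm_num)]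
      nlinarith
    have e2 : c₀ * (D.card * (L * V ^ 2)) ≤ a * δ * (V / 100) := by
      have e3 : c₀ * (D.card * (L * V ^ 2)) = a * δ * (D.card / t * V) := by
        rw [hc₀, hlam, hLt]; field_simp
      rw [e3]
      have e5 : (D.card : ℝ) / t ≤ 1 / 100 := by
        rw [div_le_div_iff₀ ht0 (by norm_num)]; linarith
      have e6 : (D.card : ℝ) / t * V ≤ 1 / 100 * V := by gcongr
      have e7 := mul_le_mul_of_nonneg_left e6 (mul_nonneg ha hδ0)
      linarith
    have e4 : 2 * (n : ℝ) ^ 2 * δ ^ 2 * V ≤ δ * (V / 100) := by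
      have e5 : (n : ℝ) ^ 2 * δ ≤ 1 / 10000 := by
        rw [hδ, hLt, mul_one_div, div_le_div_iff₀ (by positivity) (by norm_num)]
        have : (n : ℝ) ^ 2 ≤ (t / 100) ^ 2 := by gcongr
        nlinarith
      have e6 : (n : ℝ) ^ 2 * δ * (δ * V) ≤ 1 / 10000 * (δ * V) := by gcongr
      have : 0 ≤ δ * V := by positivity
      nlinarith
    have e5 := mul_le_mul_of_nonneg_left e1 (mul_nonneg ha hδ0)
    have e6 := mul_le_mul_of_nonneg_left e4 ha
    rw [ha₀]
    linarith

end Specs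

section Specs

open Store

variable {n : ℕ} {I : MatroidInstance n}

theorem hoare_setSteps {σ : Store} (hn : σ.nat (0, 0, 0) = n) (h6 : σ.nat (6, 0, 0) = 0) :
    Hoare I setSteps (setStepsTime n) σ (fun τ => Same [6, 12, 20] [] σ τ ∧
      τ.nat (6, 0, 0) = (100 * (n + 1)) ^ 2) := by
  intro v
  refine tri_setVar_seq (t := n * 4 + 3 + (100 * (n + 1) * 4 + 3) + 1) (y := 100) rfl ?_
  refine ((hoare_forLoop (N := n) (t := 1) (fun j τ => Same [12, 20] [] σ τ ∧
    τ.nat (20, 0, 0) = 100 * (j + 1)) ?_ ?_ ?_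
    ⟨(Same.refl _ _ _).writeNat (by simp) _, by simp⟩).seq fun τ hτ => (hoare_forLoop
      (N := 100 * (n + 1)) (t := 1) (fun j ρ => Same [6, 12, 20] [] σ ρ ∧
    ρ.nat (20, 0, 0) = 100 * (n + 1) ∧ ρ.nat (6, 0, 0) = j * (100 * (n + 1))) ?_ ?_ ?_
    ⟨hτ.1.mono (by simp) (by simp), hτ.2, by rw [hτ.1.1 6 (by simp), h6]; simp⟩).conseq le_rfl
      fun ρ hρ => ⟨hρ.1, by rw [hρ.2.2, sq]⟩) v
  · rintro j τ v ⟨h1, h2⟩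
    exact ⟨h1.writeNat (by simp) _, by simpa using h2⟩
  · rintro j τ ⟨h, -⟩
    simp only [NatExpr.eval]
    rw [h.1 0 (by simp), hn]
  · rintro j τ hj ⟨h1, h2⟩ hi v
    exact tri_setVar (t := 0) (y := 100 * (j + 1 + 1)) (by simp only [NatExpr.eval, h2]; ring)
      ⟨by simp [hi], h1.writeNat (by simp) _, by simp⟩ le_rfl
  · rintro j ρ v ⟨h1, h2, h3⟩
    exact ⟨h1.writeNat (by simp) _, by simpa using h2, by simpa using h3⟩
  · rintro j ρ ⟨h1, h2, h3⟩
    simpa [NatExpr.eval] using h2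
  · rintro j ρ hj ⟨h1, h2, h3⟩ hi v
    exact tri_setVar (t := 0) (y := (j + 1) * (100 * (n + 1)))
      (by simp only [NatExpr.eval, h2, h3]; ring)
      ⟨by simp [hi], h1.writeNat (by simp) _, by simpa using h2, by simp⟩ le_rfl

/-- Used with `m = L - 1`. The base is the inverse of `1 + 1 / m ≤ exp(1 / m)`. -/
theorem exp_neg_one_le_pow (m : ℕ) : Real.exp (-1) ≤ (1 - 1 / ((m : ℝ) + 1)) ^ m := by
  rcases Nat.eq_zero_or_pos m with rfl | hm
  · simp
  have hm' : (0 : ℝ) < m := by exact_mod_cast hm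
  have h1 : Real.exp (-(1 / (m : ℝ))) ≤ 1 - 1 / ((m : ℝ) + 1) := by
    have h2 := Real.add_one_le_exp (1 / (m : ℝ))
    rw [Real.exp_neg]
    have h3 : 1 - 1 / ((m : ℝ) + 1) = (1 / (m : ℝ) + 1)⁻¹ := by field_simp; ring
    rw [h3]
    exact inv_anti₀ (by positivity) h2
  calc Real.exp (-1) = Real.exp (-(1 / (m : ℝ))) ^ m := by
        rw [← Real.exp_nat_mul]; congr 1; field_simp
    _ ≤ _ := pow_le_pow_left₀ (Real.exp_nonneg _) h1 m

theorem tri_continuousGreedy {V : ℝ} (hV : 0 < V) (hopt : I.opt ≤ V) (M : ℝ) :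
    Tri I continuousGreedy (totalTime n) (Store.init n) (fun τ => I.Feasible (τ.output n))
      (fun τ => I.f (τ.output n) + M) (Real.exp (-1) * I.opt - 3 / 100 * V + M) := by
  obtain ⟨O, hO, hOopt⟩ := I.exists_opt
  set L : ℕ := (100 * (n + 1)) ^ 2 with hL
  have hL0 : 0 < L := by positivity
  have hLR : (0 : ℝ) < L := by exact_mod_cast hL0
  set δ : ℝ := 1 / (L : ℝ) with hδ
  have hδ0 : 0 ≤ δ := by positivity
  have hδ1 : δ ≤ 1 := by rw [hδ, div_le_one hLR]; exact_mod_cast hL0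
  have hinit : ∀ a i j, a ≠ 0 → (Store.init n).nat (a, i, j) = 0 := fun a i j h => by
    simp [Store.init, h]
  have hin : (Store.init n).nat (0, 0, 0) = n := by simp [Store.init]
  refine (hoare_setSteps hin (hinit 6 0 0 (by simp))).seq_tri ?_
  rintro τ₁ ⟨h₁, h6⟩
  refine (hoare_greedyBase (by rw [h₁.1 0 (by simp), hin])).seq_tri ?_
  rintro τ₂ ⟨h₂, hB, -⟩
  have hn₂ : τ₂.nat (0, 0, 0) = n := by rw [h₂.1 0 (by simp), h₁.1 0 (by simp), hin]
  refine (hoare_copyBase hn₂).seq_tri ?_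
  rintro τ₃ ⟨h₃, hC⟩
  -- Here `m` counts the remaining steps. At `m = 0` only `f` is left, and at `m = L` with the empty
  -- set the coefficient of `f(O)` is `(1 - δ)^(L - 1)`. The constant `M` is kept free for
  -- `halts_of_tri`.
  set pot : ℕ → Finset (Fin n) → ℝ := fun m => potential I O ((1 - δ) ^ m)
    (m * δ * (1 - δ) ^ (m - 1)) (M - 3 / 100 * δ * V * m) with hpot
  have hA₃ : τ₃.row n 1 0 = ∅ := by
    rw [h₃.row (by simp), h₂.row (by simp), h₁.row (by simp)]
    ext u
    simp [mem_row, hinit]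
  refine (tri_forLoop (N := L) (t := improveTime n L) (fun j τ => τ.nat (0, 0, 0) = n ∧
    τ.nat (6, 0, 0) = L ∧ τ.nat (8, 0, 0) = j * L ∧ I.Base (τ.row n 2 0) ∧
    τ.row n 1 0 ⊆ τ.row n 2 0)
    (fun j τ => mlext (pot (L - j)) (scaled ((j : ℝ) / L) (τ.row n 1 0))) ?_ ?_ ?_ ?_
    ⟨by rw [h₃.1 0 (by simp), hn₂], by rw [h₃.1 6 (by simp), h₂.1 6 (by simp), h6], ?_,
      by rw [hC]; exact hB, by rw [hA₃]; exact Finset.empty_subset _⟩).conseq le_rfl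
      (fun τ hτ => ⟨hτ.2.2.2.1.feasible.subset hτ.2.2.2.2, le_of_eq ?_⟩) ?_
  · rintro j τ v ⟨h1, h2, h3, h4, h5⟩
    exact ⟨by simpa using h1, by simpa using h2, by simpa using h3, by simpa using h4,
      by simpa using h5⟩
  · intro j τ v _
    simp
  · rintro j τ ⟨-, h2, -⟩
    simpa [NatExpr.eval] using h2
  · rintro j τ hj ⟨h1, h2, h3, h4, h5⟩ hi
    obtain ⟨m, hm⟩ : ∃ m, L = j + m + 1 := ⟨L - j - 1, by omega⟩
    have e1 : L - (j + 1) = m := by omega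
    have e2 : L - j = m + 1 := by omega
    have hq0 : 0 ≤ 1 - δ := by linarith
    refine (tri_improve h1 h2 hL hi h3 hj h5 h4 hO (a := (1 - δ) ^ m)
      (b := m * δ * (1 - δ) ^ (m - 1)) (pow_nonneg hq0 m) (by positivity) hV hopt
      (M - 3 / 100 * δ * V * m)).conseq le_rfl (fun ρ hρ => ⟨⟨?_, ?_, ?_, hρ.2.1, hρ.2.2⟩, ?_⟩) ?_
    · rw [hρ.1.1 7 (by simp), hi]
    · rw [hρ.1.1 0 (by simp), h1]
    · rw [hρ.1.1 6 (by simp), h2]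
    · rw [e1]
      push_cast
      exact le_rfl
    · rw [e2]
      simp only [hpot, mlext_potential, ← hδ]
      have hpow : (1 - δ) ^ m ≤ 1 := pow_le_one₀ hq0 (by linarith)
      -- For `m = 0` the truncated exponent `m - 1` is harmless, because its coefficient vanishes.
      have hb : ((m + 1 : ℕ) : ℝ) * δ * (1 - δ) ^ (m + 1 - 1) =
          (1 - δ) ^ m * δ + m * δ * (1 - δ) ^ (m - 1) * (1 - δ) := by
        rcases m with _ | m
        · simp
        · simp only [Nat.add_sub_cancel, pow_succ]
          push_cast
          ring
      rw [hb, pow_succ]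
      have hc := mul_le_mul_of_nonneg_right hpow (by positivity : 0 ≤ 3 / 100 * δ * V)
      refine add_le_add le_rfl ?_
      push_cast
      generalize (1 - δ) ^ m = q at hc ⊢
      linarith
  · rw [h₃.1 8 (by simp), h₂.1 8 (by simp), h₁.1 8 (by simp), hinit 8 0 0 (by simp)]
    simp
  · have e1 : scaled ((L : ℝ) / L) (τ.row n 1 0) = fun u => if u ∈ τ.row n 1 0 then 1 else 0 := by
      ext u; simp [scaled]
    rw [e1, mlext_indicator, Nat.sub_self]
    simp [hpot, potential, Store.output]
  · have e1 : scaled (((0 : ℕ) : ℝ) / L) (τ₃.row n 1 0) =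
          fun u => if u ∈ (∅ : Finset (Fin n)) then 1 else 0 := by
      ext u; simp [scaled]
    rw [e1, mlext_indicator, Nat.sub_zero]
    simp only [hpot, potential, Finset.empty_union, hOopt]
    obtain ⟨m, hm⟩ : ∃ m, L = m + 1 := ⟨L - 1, by omega⟩
    have hexp := exp_neg_one_le_pow m
    have hm1 : (m : ℝ) + 1 = L := by rw [hm]; push_cast; rfl
    rw [hm1, ← hδ] at hexp
    have hLδ : (L : ℝ) * δ = 1 := by rw [hδ]; field_simp
    have e3 : L - 1 = m := by omega
    have e4 : 0 ≤ (1 - δ) ^ L * I.f ∅ := mul_nonneg (pow_nonneg (by linarith) _) (I.nonneg _)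
    have e5 := mul_le_mul_of_nonneg_right hexp I.opt_nonneg
    have e6 : ∀ l d : ℝ, l * d = 1 → 3 / 100 * d * V * l = 3 / 100 * V := fun l d h => by
      linear_combination (3 / 100 * V) * h
    rw [e6 L δ hLδ, hLδ, e3, one_mul]
    generalize (1 - δ) ^ L * I.f ∅ = y at e4 ⊢
    generalize (1 - δ) ^ m * I.opt = z at e5 ⊢
    generalize Real.exp (-1) * I.opt = w at e5 ⊢
    linarith

end Specs

/-! ### From expectation bounds to the machine, and the final constants. -/

/-- Runs that have not halted, or end in an infeasible set, count as `0`. If they had probability `p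
> 0`, then `v + M ≤ (1 - p)(OPT + M)` for all `M ≥ 0`, which fails for large `M`. The case `M = 0`
is the bound on the value. -/
theorem halts_of_tri {n : ℕ} {I : MatroidInstance n} {Q : Program} {T : ℕ} {v : ℝ}
    (h : ∀ M : ℝ, 0 ≤ M → Tri I Q T (Store.init n) (fun τ => I.Feasible (τ.output n))
      (fun τ => I.f (τ.output n) + M) (v + M)) :
    HaltsFeasibly I Q T ∧ v ≤ expectedOutputValue I Q T := by
  classical
  set φ : ℝ → Store → ℝ≥0∞ := fun M σ =>
    if I.Feasible (σ.output n) then ENNReal.ofReal (I.f (σ.output n) + M) else 0 with hφ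
  have key : ∀ M : ℝ, 0 ≤ M → ENNReal.ofReal (v + M) ≤
      ∑' c, run I Q T c * haltValue I (φ M) 0 c := by
    intro M hM
    rw [tsum_run_mul_haltValue, Nat.add_zero, ← Nat.zero_add T]
    refine h M hM (φ M) [] 0 fun σ' hσ' => ?_
    rw [haltValue_nil]
    simp [hφ, hσ']
  constructor
  · intro c₀ hc₀
    by_contra hbad
    have hz : ∀ M, haltValue I (φ M) 0 c₀ = 0 := by
      intro M
      simp only [haltValue, hφ]
      by_cases h1 : c₀.1 = []
      · have : ¬ I.Feasible (c₀.2.output n) := fun h2 => hbad ⟨h1, h2⟩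
        simp [this]
      · simp [h1]
    have hsum : run I Q T c₀ + ∑' c, (if c = c₀ then 0 else run I Q T c) = 1 := by
      rw [← PMF.tsum_coe (run I Q T)]
      convert (ENNReal.tsum_eq_add_tsum_ite c₀).symm
    set p := run I Q T c₀ with hp
    set q := ∑' c, (if c = c₀ then 0 else run I Q T c) with hq
    have hpt : p ≠ ⊤ := PMF.apply_ne_top _ _
    have hqt : q ≠ ⊤ := fun hq' => by rw [hq'] at hsum; simp at hsum
    have hp0 : 0 < p.toReal := ENNReal.toReal_pos ((PMF.mem_support_iff _ _).1 hc₀) hpt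
    have hpq : p.toReal + q.toReal = 1 := by
      rw [← ENNReal.toReal_add hpt hqt, hsum, ENNReal.toReal_one]
    have hbound : ∀ M : ℝ, 0 ≤ M → v + M ≤ q.toReal * (I.opt + M) := by
      intro M hM
      have hM' : 0 ≤ I.opt + M := add_nonneg I.opt_nonneg hM
      rw [← ENNReal.ofReal_le_ofReal_iff (by positivity), ENNReal.ofReal_mul (by positivity),
        ENNReal.ofReal_toReal hqt]
      refine (key M hM).trans ?_
      rw [hq, ← ENNReal.tsum_mul_right]
      refine ENNReal.tsum_le_tsum fun c => ?_
      by_cases hc : c = c₀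
      · rw [hc, hz, mul_zero]; exact zero_le
      · rw [if_neg hc]
        gcongr
        simp only [haltValue, hφ]
        split_ifs with h1 h2
        · exact ENNReal.ofReal_le_ofReal (by linarith [I.le_opt h2])
        · exact zero_le
        · exact zero_le
    -- This makes `pM = OPT + |v| + 1`, more than the inequality can tolerate.
    have := hbound ((I.opt + |v| + 1) / p.toReal) (by have := I.opt_nonneg; positivity)
    have e1 : p.toReal * ((I.opt + |v| + 1) / p.toReal) = I.opt + |v| + 1 := by field_simp
    have e2 : q.toReal = 1 - p.toReal := by linarith
    rw [e2] at this
    have e3 := neg_abs_le v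
    have e4 := I.opt_nonneg
    have e5 := mul_nonneg hp0.le e4
    generalize (I.opt + |v| + 1) / p.toReal = M at this e1
    linarith
  · have hE : 0 ≤ expectedOutputValue I Q T :=
      Finset.sum_nonneg fun S _ => mul_nonneg ENNReal.toReal_nonneg (I.nonneg S)
    rw [← ENNReal.ofReal_le_ofReal_iff hE]
    have := key 0 le_rfl
    rw [add_zero] at this
    refine this.trans ?_
    have h2 : ENNReal.ofReal (expectedOutputValue I Q T) =
        ∑' S, ((run I Q T).map fun c => c.2.output n) S * ENNReal.ofReal (I.f S) := by
      rw [tsum_fintype, expectedOutputValue, ENNReal.ofReal_sum_of_nonneg fun S _ =>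
        mul_nonneg ENNReal.toReal_nonneg (I.nonneg S)]
      refine Finset.sum_congr rfl fun S _ => ?_
      rw [ENNReal.ofReal_mul ENNReal.toReal_nonneg, ENNReal.ofReal_toReal (PMF.apply_ne_top _ _)]
    rw [h2, tsum_pmf_map_mul]
    refine ENNReal.tsum_le_tsum fun c => ?_
    gcongr
    simp only [haltValue, hφ, add_zero]
    split_ifs
    · exact le_rfl
    · exact zero_le
    · exact zero_le

theorem exists_polynomial_eval_eq_totalTime :
    ∃ p : Polynomial ℕ, ∀ n, p.eval n = totalTime n := by
  set X : Polynomial ℕ := Polynomial.X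
  set L : Polynomial ℕ := (100 * (X + 1)) ^ 2
  set g : Polynomial ℕ := X * (X * 17 + 8 + 3) + X * 4 + 7
  refine ⟨X * 4 + 3 + (100 * (X + 1) * 4 + 3) + 1 + 2 + (g + (X * 4 + 3 + (L * (L * (X * 22 + 12) +
    X * 4 + 7 + (g + (X * 8 + 3 + (X * 13 + 3 + (X * (X * 29 + 20) + 3 + 1 + 1) + 1) + 1) + 1) + 1 +
      3) + 3) + 1) + 1) + 1, fun n => ?_⟩
  simp [X, L, g, totalTime, setStepsTime, greedyTime, improveTime]

theorem sqrt_five_bound : 1 / 4 * (-1 + Real.sqrt 5) ≤ Real.exp (-1) - 3 / 100 := by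
  have h1 : Real.sqrt 5 ≤ 2.237 := by
    rw [Real.sqrt_le_left (by norm_num)]; norm_num
  have h2 : (0.36 : ℝ) ≤ Real.exp (-1) := by
    rw [Real.exp_neg, le_inv_comm₀ (by norm_num) (Real.exp_pos 1)]
    have := Real.exp_one_lt_d9
    norm_num at this ⊢
    linarith
  norm_num at h1 h2 ⊢
  linarith

theorem continuousGreedy_spec {n : ℕ} (I : MatroidInstance n) :
    HaltsFeasibly I continuousGreedy (totalTime n) ∧
      1 / 4 * (-1 + Real.sqrt 5) * I.opt ≤
        expectedOutputValue I continuousGreedy (totalTime n) := by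
  rcases I.opt_nonneg.eq_or_lt with h0 | h0
  -- If the optimum is `0`, the positive scale `V` is taken to be `1`: halting is still obtained and
  -- the bound on the value is trivial.
  · refine ⟨(halts_of_tri fun M _ => tri_continuousGreedy one_pos (by linarith) M).1, ?_⟩
    rw [← h0, mul_zero]
    exact Finset.sum_nonneg fun S _ => mul_nonneg ENNReal.toReal_nonneg (I.nonneg S)
  · obtain ⟨h1, h2⟩ := halts_of_tri fun M _ => tri_continuousGreedy h0 le_rfl M
    refine ⟨h1, le_trans ?_ h2⟩
    have := mul_le_mul_of_nonneg_right sqrt_five_bound h0.le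
    linarith

end SubmodMax

theorem theorem1p4 :
    (∀ ε : ℝ, 0 < ε → ∃ c : ℝ, 0 < c ∧ ∃ n₀ : ℕ, ∀ n : ℕ, n₀ ≤ n →
      ∀ A : SubmodMax.RandomizedQueryAlgorithm n, A.IsApproximation (1 / 2 + ε) →
        ∃ I : SubmodMax.MatroidInstance n,
          ENNReal.ofReal (Real.exp (c * (n : ℝ))) ≤ A.expectedValueQueries I) ∧
    (∃ (Q : SubmodMax.Program) (p : Polynomial ℕ) (η : ℕ → ℝ),
      Tendsto η atTop (𝓝 0) ∧
      ∀ (n : ℕ) (I : SubmodMax.MatroidInstance n),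
        SubmodMax.HaltsFeasibly I Q (p.eval n) ∧
        1 / 4 * (-1 + Real.sqrt 5 - η n) * I.opt ≤
          SubmodMax.expectedOutputValue I Q (p.eval n)) := by
  refine ⟨fun ε hε => SubmodMax.exists_exp_le_expectedValueQueries hε, ?_⟩
  obtain ⟨p, hp⟩ := SubmodMax.exists_polynomial_eval_eq_totalTime
  -- Because `1/e - 3/100` exceeds the required constant, the error sequence can be zero.
  refine ⟨SubmodMax.continuousGreedy, p, fun _ => 0, tendsto_const_nhds, fun n I => ?_⟩
  rw [hp n, sub_zero]
  exact SubmodMax.continuousGreedy_spec I
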